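/- **Setting.** Let $\Omega\subset\mathbb R^3$ be a non-empty bounded domain with Lipschitz boundary, $\Omega'$ an open ball containing $\Omega$, and $\omega,\mu_o,\varepsilon_o>0$. For $j=1,2$ let $\mu_j,\varepsilon_j,\sigma_j:\mathbb R^3\to\mathbb R$ be Lipschitz with $\mu_j,\varepsilon_j>0$ on $\mathbb R^3$; $\mu_j\ge\mu_o$, $\varepsilon_j\ge\varepsilon_o$, $\sigma_j\ge 0$ on $\overline\Omega$; and $\mu_j=\mu_o$, $\varepsilon_j=\varepsilon_o$, $\sigma_j=0$ outside $\Omega'$. Assume $\mu_1=\mu_2$, $\varepsilon_1=\varepsilon_2$, $\sigma_1=\sigma_2$ outside $\Omega$ (in particular on $\partial\Omega$). Put $k=\omega(\varepsilon_o\mu_o)^{1/2}$, $\gamma_j=\varepsilon_j+i\sigma_j/\omega$, $\alpha_j=\nabla\log\gamma_j$, $\beta_j=\nabla\log\mu_j$, $\kappa_j=\omega(\mu_j\gamma_j)^{1/2}$ (principal branches) and $\theta_j=\omega^2(\gamma_j\mu_j-\varepsilon_o\mu_o)$. Write $\mathbb C^8$-valued functions as $w=(w_1,w_2,w_3,w_4)^T$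 with scalars $w_1,w_4$ and 3-vectors $w_2,w_3$. All products of vectors are bilinear (no complex conjugation); in particular $|\alpha|^2=\alpha\cdot\alpha$. Set $$P(i\nabla)=i\begin{pmatrix}0&\nabla\cdot&0&0\\ \nabla&0&\nabla\wedge&0\\ 0&-\nabla\wedge&0&\nabla\\ 0&0&\nabla\cdot&0\end{pmatrix},\qquad V_j=(k-\kappa_j)I_8+\frac i2\begin{pmatrix}0&\alpha_j^T&0&0\\ \beta_j&0&-\beta_j\wedge&0\\ 0&\alpha_j\wedge&0&\alpha_j\\ 0&0&\beta_j^T&0\end{pmatrix},$$ $\mathcal P_j'=P(i\nabla)+k-V_j^T$, and let $Q_j$ be the weak matrix potential given by $$\begin{aligned}\langle Q_jw,\varphi\rangle=\int_{\mathbb R^3}\Big(&\tfrac14(|\alpha_j|^2-4\theta_j)[w_1\varphi_1+w_3\cdot\varphi_3]-\tfrac12\alpha_j\cdot[\nabla(w_1\varphi_1-w_3\cdot\varphi_3)+\nabla\cdot(w_3\varphi_3^T+\varphi_3w_3^T)]\\&+\tfrac14(|\beta_j|^2-4\theta_j)[w_4\varphi_4+w_2\cdot\varphi_2]-\tfrac12\beta_j\cdot[\nabla(w_4\varphi_4-w_2\cdot\varphi_2)+\nabla\cdot(w_2\varphi_2^T+\varphi_2w_2^T)]\\&-2i\kappa_j\nabla\cdot(w_1\varphi_2+w_2\varphi_1+w_3\varphi_4+w_4\varphi_3)\Big)\,dx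 .\end{aligned}$$ The expression $\langle(Q_2-Q_1)w,v\rangle$, for $w,v\in H^1_{loc}(\mathbb R^3)^8$, is the integral over $\mathbb R^3$ of the difference of the two integrands. The Cauchy data set $C(\mu,\varepsilon,\sigma;\omega)$ on $\partial\Omega$ is the set of pairs of tangential traces $(\nu\wedge E|_{\partial\Omega},\nu\wedge H|_{\partial\Omega})$ of all weak solutions $(E,H)\in H_{\mathrm{curl}}(\Omega)^2$ of $\nabla\wedge E-i\omega\mu H=0$, $\nabla\wedge H+i\omega\gamma E=0$ in $\Omega$, where $\gamma=\varepsilon+i\sigma/\omega$ and $\nu\wedge u|_{\partial\Omega}$ is the functional $\varphi\mapsto\int_\Omega(\nabla\wedge u)\cdot\varphi-u\cdot(\nabla\wedge\varphi)\,dx$ on smooth, compactly supported vector fields $\varphi$ on $\mathbb R^3$. **Proposition.** Let $w_1\in H^1_{loc}(\mathbb R^3)^8$ be a weak solution of $[-(\Delta+k^2)+Q_1]w_1=0$ in $\Omega'$, i.e. $$\int_{\mathbb R^3}\sum_{l=1}^8\nabla w_{1,l}\cdot\nabla\varphi_l-k^2\,w_1\cdot\varphi\,dx+\langle Q_1w_1,\varphi\rangle=0\qquad\text{for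 all }\varphi\in C_c^\infty(\Omega')^8,$$ and assume that the first and the last (scalar) components of $\mathcal P_1'w_1$ vanish almost everywhere in $\Omega'$. Let $v_2\in H^1_{loc}(\mathbb R^3)^8$ satisfy $\mathcal P_2'v_2=0$ in $\Omega'$. If $C(\mu_1,\varepsilon_1,\sigma_1;\omega)=C(\mu_2,\varepsilon_2,\sigma_2;\omega)$, then the integral defining $\langle(Q_2-Q_1)w_1,v_2\rangle$ converges absolutely and $$\langle(Q_2-Q_1)w_1,v_2\rangle=0 .$$ -/

import Mathlib

open MeasureTheory
open scoped NNReal Matrix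

namespace MaxwellLip

noncomputable section

/-- Euclidean space `ℝ³`. -/
abbrev R3 : Type := EuclideanSpace ℝ (Fin 3)

/-! ### Test functions, weak derivatives and `H¹_loc(ℝ³)` -/

/-- `φ ∈ C_c^∞(U)`: complex-valued, smooth, with compact support contained in `U`. -/
def IsTest (U : Set R3) (φ : R3 → ℂ) : Prop :=
  ContDiff ℝ (⊤ : ℕ∞) φ ∧ HasCompactSupport φ ∧ tsupport φ ⊆ U

/-- The classical partial derivative `∂_j f`. -/
def pd (j : Fin 3) (f : R3 → ℂ) (x : R3) : ℂ :=
  fderiv ℝ f x (EuclideanSpace.single j 1)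

/-- `u ∈ L²_loc(ℝ³)`. -/
def MemL2loc (u : R3 → ℂ) : Prop :=
  ∀ K : Set R3, IsCompact K → MemLp u 2 (volume.restrict K)

/-- `g` is the weak partial derivative `∂_j u` on `ℝ³`. -/
def HasWeakPd (j : Fin 3) (u g : R3 → ℂ) : Prop :=
  ∀ φ : R3 → ℂ, IsTest Set.univ φ → ∫ x, u x * pd j φ x = - ∫ x, g x * φ x

/-- `u ∈ H¹_loc(ℝ³)`: `u` and its weak partial derivatives lie in `L²_loc(ℝ³)`. -/
def MemH1loc (u : R3 → ℂ) : Prop :=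
  MemL2loc u ∧ ∀ j, ∃ g, MemL2loc g ∧ HasWeakPd j u g

open Classical in
/-- The weak partial derivative `∂_j u ∈ L²_loc(ℝ³)` (unique up to null sets). -/
def weakPd (j : Fin 3) (u : R3 → ℂ) : R3 → ℂ :=
  if h : ∃ g, MemL2loc g ∧ HasWeakPd j u g then h.choose else 0

/-! ### Domains -/

/-- `∂Ω` is locally the graph of a Lipschitz function, with `Ω` on one side of it, after a rigid
motion `T` of the coordinates. -/
def HasLipschitzBoundary (Ω : Set R3) : Prop :=
  ∀ p ∈ frontier Ω, ∃ (T : R3 ≃ᵢ R3) (f : EuclideanSpace ℝ (Fin 2) → ℝ) (K : ℝ≥0) (U : Set R3),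
    LipschitzWith K f ∧ IsOpen U ∧ p ∈ U ∧
      ∀ x ∈ U, (x ∈ Ω ↔ f !₂[T x 0, T x 1] < T x 2)

/-- A non-empty bounded domain (open connected set) with Lipschitz boundary. -/
def IsBoundedLipschitzDomain (Ω : Set R3) : Prop :=
  IsOpen Ω ∧ IsConnected Ω ∧ Bornology.IsBounded Ω ∧ HasLipschitzBoundary Ω

/-! ### Electromagnetic parameters -/

/-- The standing assumptions on one triple of parameters `μ, ε, σ`, already extended from `closure Ω`
to Lipschitz functions on `ℝ³` (with `μ, ε` still positive, so that the logarithms below make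
sense), and equal to the constants `μo, εo, 0` outside the larger set `Ω'`. -/
structure IsAdmissible (Ω Ω' : Set R3) (μo εo : ℝ) (μ ε σ : R3 → ℝ) : Prop where
  lipschitz_mu : ∃ K : ℝ≥0, LipschitzWith K μ
  lipschitz_eps : ∃ K : ℝ≥0, LipschitzWith K ε
  lipschitz_sigma : ∃ K : ℝ≥0, LipschitzWith K σ
  mu_ge : ∀ x ∈ closure Ω, μo ≤ μ x
  eps_ge : ∀ x ∈ closure Ω, εo ≤ ε x
  sigma_nonneg : ∀ x ∈ closure Ω, 0 ≤ σ x
  mu_pos : ∀ x, 0 < μ x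
  eps_pos : ∀ x, 0 < ε x
  mu_const : ∀ x, x ∉ Ω' → μ x = μo
  eps_const : ∀ x, x ∉ Ω' → ε x = εo
  sigma_zero : ∀ x, x ∉ Ω' → σ x = 0

/-- `γ = ε + i σ / ω`. -/
def gam (ω : ℝ) (ε σ : R3 → ℝ) (x : R3) : ℂ := (ε x : ℂ) + Complex.I * (σ x : ℂ) / (ω : ℂ)

/-- `k = ω (εo μo)^{1/2}`. -/
def wavenumber (ω μo εo : ℝ) : ℝ := ω * Real.sqrt (εo * μo)

/-- `α = ∇ log γ` (principal branch; it exists almost everywhere for a Lipschitz `γ`). -/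
def alphaVec (ω : ℝ) (ε σ : R3 → ℝ) (x : R3) : Fin 3 → ℂ :=
  fun j => pd j (fun y => Complex.log (gam ω ε σ y)) x

/-- `β = ∇ log μ`. -/
def betaVec (μ : R3 → ℝ) (x : R3) : Fin 3 → ℂ :=
  fun j => pd j (fun y => ((Real.log (μ y) : ℝ) : ℂ)) x

/-- `κ = ω (μ γ)^{1/2}` (principal branch). -/
def kappa (ω : ℝ) (μ ε σ : R3 → ℝ) (x : R3) : ℂ :=
  (ω : ℂ) * ((μ x : ℂ) * gam ω ε σ x) ^ (1 / 2 : ℂ)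

/-- `θ = ω² (γ μ - εo μo)`. -/
def theta (ω μo εo : ℝ) (μ ε σ : R3 → ℝ) (x : R3) : ℂ :=
  (ω : ℂ) ^ 2 * (gam ω ε σ x * (μ x : ℂ) - (εo : ℂ) * (μo : ℂ))

/-! ### Maxwell's equations and the Cauchy data set -/

/-- The curl of a 3-vector field whose Jacobian matrix is `D i j = ∂_j E_i`. -/
def curlOf (D : Fin 3 → Fin 3 → ℂ) : Fin 3 → ℂ :=
  ![D 2 1 - D 1 2, D 0 2 - D 2 0, D 1 0 - D 0 1]

/-- `u ∈ L²(Ω)³`. -/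
def MemL2 (Ω : Set R3) (u : Fin 3 → R3 → ℂ) : Prop :=
  ∀ i, MemLp (u i) 2 (volume.restrict Ω)

/-- `F` is the weak curl `∇ ∧ u` of `u` in `Ω`. -/
def HasWeakCurl (Ω : Set R3) (u F : Fin 3 → R3 → ℂ) : Prop :=
  ∀ φ : Fin 3 → R3 → ℂ, (∀ i, IsTest Ω (φ i)) →
    ∫ x in Ω, ∑ i, u i x * curlOf (fun a b => pd b (φ a) x) i = ∫ x in Ω, ∑ i, F i x * φ i x

/-- Smooth compactly supported vector fields on `ℝ³`. -/
def TestField : Type := {φ : Fin 3 → R3 → ℂ // ∀ i, IsTest Set.univ (φ i)}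

/-- `u ∈ H_curl(Ω)` and `τ` is its tangential trace `ν ∧ u|_{∂Ω}`. The trace is the functional
`φ ↦ ∫_{∂Ω} (ν ∧ u) · φ dS` given by Green's formula
`∫_{∂Ω} (ν ∧ u) · φ dS = ∫_Ω (∇ ∧ u) · φ - u · (∇ ∧ φ) dx`. -/
def IsTangentialTrace (Ω : Set R3) (u : Fin 3 → R3 → ℂ) (τ : TestField → ℂ) : Prop :=
  MemL2 Ω u ∧ ∃ F : Fin 3 → R3 → ℂ, MemL2 Ω F ∧ HasWeakCurl Ω u F ∧
    ∀ φ : TestField, τ φ =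
      ∫ x in Ω, ∑ i, (F i x * φ.1 i x - u i x * curlOf (fun a b => pd b (φ.1 a) x) i)

/-- `(E, H)` solves `∇ ∧ E - i ω μ H = 0`, `∇ ∧ H + i ω γ E = 0` in `Ω`. -/
def SolvesMaxwell (Ω : Set R3) (ω : ℝ) (μ ε σ : R3 → ℝ) (E H : Fin 3 → R3 → ℂ) : Prop :=
  HasWeakCurl Ω E (fun i x => Complex.I * (ω : ℂ) * (μ x : ℂ) * H i x) ∧
  HasWeakCurl Ω H (fun i x => - (Complex.I * (ω : ℂ) * gam ω ε σ x * E i x))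

/-- The Cauchy data set `C(μ, ε, σ; ω)` on `∂Ω`: all pairs `(ν ∧ E|_{∂Ω}, ν ∧ H|_{∂Ω})` for
solutions `(E, H) ∈ H_curl(Ω)²` of Maxwell's equations in `Ω`. -/
def cauchyData (Ω : Set R3) (μ ε σ : R3 → ℝ) (ω : ℝ) :
    Set ((TestField → ℂ) × (TestField → ℂ)) :=
  {p | ∃ E H : Fin 3 → R3 → ℂ, SolvesMaxwell Ω ω μ ε σ E H ∧
    IsTangentialTrace Ω E p.1 ∧ IsTangentialTrace Ω H p.2}

/-! ### The first order operator `𝒫'`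

An 8-vector `w = (w₁, w₂, w₃, w₄)` (scalar, 3-vector, 3-vector, scalar) is stored with `w₁` in
position `0`, `w₂` in positions `1, 2, 3`, `w₃` in positions `4, 5, 6` and `w₄` in position `7`. -/

/-- The matrix
`(0, aᵀ, 0, 0; b, 0, -(b ∧), 0; 0, a ∧, 0, a; 0, 0, bᵀ, 0)`. -/
def blockMat (a b : Fin 3 → ℂ) : Matrix (Fin 8) (Fin 8) ℂ :=
  !![0,   a 0,    a 1,    a 2,    0,      0,      0,      0;
     b 0, 0,      0,      0,      0,      b 2,    -(b 1), 0;
     b 1, 0,      0,      0,      -(b 2), 0,      b 0,    0;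
     b 2, 0,      0,      0,      b 1,    -(b 0), 0,      0;
     0,   0,      -(a 2), a 1,    0,      0,      0,      a 0;
     0,   a 2,    0,      -(a 0), 0,      0,      0,      a 1;
     0,   -(a 1), a 0,    0,      0,      0,      0,      a 2;
     0,   0,      0,      0,      b 0,    b 1,    b 2,    0]

/-- The symbol `P(ξ) = (0, ξᵀ, 0, 0; ξ, 0, ξ ∧, 0; 0, -(ξ ∧), 0, ξ; 0, 0, ξᵀ, 0)`. -/
def symbolP (ξ : Fin 3 → ℂ) : Matrix (Fin 8) (Fin 8) ℂ :=
  !![0,   ξ 0,    ξ 1,    ξ 2,    0,      0,      0,      0;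
     ξ 0, 0,      0,      0,      0,      -(ξ 2), ξ 1,    0;
     ξ 1, 0,      0,      0,      ξ 2,    0,      -(ξ 0), 0;
     ξ 2, 0,      0,      0,      -(ξ 1), ξ 0,    0,      0;
     0,   0,      ξ 2,    -(ξ 1), 0,      0,      0,      ξ 0;
     0,   -(ξ 2), 0,      ξ 0,    0,      0,      0,      ξ 1;
     0,   ξ 1,    -(ξ 0), 0,      0,      0,      0,      ξ 2;
     0,   0,      0,      0,      ξ 0,    ξ 1,    ξ 2,    0]

/-- `P(i∇) w = i ∑_j P(e_j) ∂_j w`, for an 8-vector field with Jacobian `Dw l j = ∂_j w_l`. -/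
def applyP (Dw : Fin 8 → Fin 3 → ℂ) : Fin 8 → ℂ :=
  Complex.I • ∑ j : Fin 3, symbolP (Pi.single j 1) *ᵥ (fun l => Dw l j)

/-- The potential `V = (k - κ) I₈ + (i/2) (0, αᵀ, 0, 0; β, 0, -(β ∧), 0; 0, α ∧, 0, α; 0, 0, βᵀ, 0)`,
for which `(P(i∇) - k + V) (φ, e, h, ψ) = 0` is the rescaled augmented Maxwell system. -/
def matV (ω μo εo : ℝ) (μ ε σ : R3 → ℝ) (x : R3) : Matrix (Fin 8) (Fin 8) ℂ :=
  ((wavenumber ω μo εo : ℂ) - kappa ω μ ε σ x) • (1 : Matrix (Fin 8) (Fin 8) ℂ)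
    + (Complex.I / 2) • blockMat (alphaVec ω ε σ x) (betaVec μ x)

/-- `𝒫' w = P(i∇) w + k w - Vᵀ w` for `w ∈ H¹_loc(ℝ³)⁸`. -/
def opP' (ω μo εo : ℝ) (μ ε σ : R3 → ℝ) (w : Fin 8 → R3 → ℂ) (x : R3) : Fin 8 → ℂ :=
  applyP (fun l j => weakPd j (w l) x) + (wavenumber ω μo εo : ℂ) • (fun l => w l x)
    - (matV ω μo εo μ ε σ x)ᵀ *ᵥ (fun l => w l x)

/-! ### The weak potential `Q` -/

/-- Positions of the components of `w₂`. -/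
def b2 : Fin 3 → Fin 8 := ![1, 2, 3]

/-- Positions of the components of `w₃`. -/
def b3 : Fin 3 → Fin 8 := ![4, 5, 6]

/-- The integrand of `⟨Q w, φ⟩` at `x`, for 8-vectors with values `w, φ` and Jacobians
`Dw l j = ∂_j w_l`, `Dφ l j = ∂_j φ_l` at `x`. Below `d l m j = ∂_j (w_l φ_m)`. All products
of vectors are bilinear; in particular `|α|² = α · α` and `|β|² = β · β`. -/
def qDensity (ω μo εo : ℝ) (μ ε σ : R3 → ℝ) (x : R3)
    (w : Fin 8 → ℂ) (Dw : Fin 8 → Fin 3 → ℂ) (φ : Fin 8 → ℂ) (Dφ : Fin 8 → Fin 3 → ℂ) : ℂ :=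
  let α := alphaVec ω ε σ x
  let β := betaVec μ x
  let θ := theta ω μo εo μ ε σ x
  let κ := kappa ω μ ε σ x
  let d : Fin 8 → Fin 8 → Fin 3 → ℂ := fun l m j => Dw l j * φ m + w l * Dφ m j
  (1 / 4) * (α ⬝ᵥ α - 4 * θ) * (w 0 * φ 0 + ∑ m, w (b3 m) * φ (b3 m))
    - (1 / 2) * ∑ j, α j * (d 0 0 j - ∑ m, d (b3 m) (b3 m) j
        + ∑ m, (d (b3 m) (b3 j) m + d (b3 j) (b3 m) m))
    + (1 / 4) * (β ⬝ᵥ β - 4 * θ) * (w 7 * φ 7 + ∑ m, w (b2 m) * φ (b2 m))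
    - (1 / 2) * ∑ j, β j * (d 7 7 j - ∑ m, d (b2 m) (b2 m) j
        + ∑ m, (d (b2 m) (b2 j) m + d (b2 j) (b2 m) m))
    - 2 * Complex.I * κ * ∑ j, (d 0 (b2 j) j + d (b2 j) 0 j + d (b3 j) 7 j + d 7 (b3 j) j)

/-- `w ∈ H¹_loc(ℝ³)⁸` is a weak solution of `[-(Δ + k²) + Q] w = 0` in `U`. -/
def IsWeakSchrodingerSolution (U : Set R3) (ω μo εo : ℝ) (μ ε σ : R3 → ℝ)
    (w : Fin 8 → R3 → ℂ) : Prop :=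
  ∀ φ : Fin 8 → R3 → ℂ, (∀ l, IsTest U (φ l)) →
    (∫ x, ((∑ l, ∑ j, weakPd j (w l) x * pd j (φ l) x)
        - (wavenumber ω μo εo : ℂ) ^ 2 * ∑ l, w l x * φ l x))
      + ∫ x, qDensity ω μo εo μ ε σ x (fun l => w l x) (fun l j => weakPd j (w l) x)
          (fun l => φ l x) (fun l j => pd j (φ l) x) = 0

/-- The integrand of `⟨(Q₂ - Q₁) w, v⟩` for `w, v ∈ H¹_loc(ℝ³)⁸`. -/
def qDiffDensity (ω μo εo : ℝ) (μ₁ ε₁ σ₁ μ₂ ε₂ σ₂ : R3 → ℝ) (w v : Fin 8 → R3 → ℂ)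
    (x : R3) : ℂ :=
  qDensity ω μo εo μ₂ ε₂ σ₂ x (fun l => w l x) (fun l j => weakPd j (w l) x)
      (fun l => v l x) (fun l j => weakPd j (v l) x)
    - qDensity ω μo εo μ₁ ε₁ σ₁ x (fun l => w l x) (fun l j => weakPd j (w l) x)
      (fun l => v l x) (fun l j => weakPd j (v l) x)

end

end MaxwellLip

open MaxwellLip

/-! Everything rests on a factorization. Pointwise almost everywhere, the density `∇w·∇φ - k² w·φ +
Q_j(w, φ)` equals `-𝒫_j'w · 𝒫_j'φ` plus terms that integrate to zero under suitable support
conditions (`factorization`). These terms are a null Lagrangian in `∇w, ∇φ` that does not see the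
parameters, and combinations of `∂(κ w_a φ_b)` and of components of `∇ log γ ∧ ∇(w_a φ_b)` and `∇
log μ ∧ ∇(w_a φ_b)`.

Subtract the identities for `j = 1` and `j = 2`. The null Lagrangian cancels. The other terms now
carry the differences of `κ`, `log γ`, `log μ`, which are Lipschitz with compact support, so they
integrate to zero against products of `H¹_loc` functions. Since `𝒫₂'v₂ = 0` in `Ω'` and the
coefficients agree a.e. outside `Ω`, what remains is `⟨(Q₂ - Q₁)w₁, v₂⟩ = ∫_Ω 𝒫₁'w₁ · 𝒫₁'v₂`
(`exists_qDiffDensity_eq`).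

The same factorization with test functions `φ` gives `∫_Ω 𝒫₁'w₁ · 𝒫₁'φ = 0`. As the scalar
components of `𝒫₁'w₁` vanish, it has the form `(0, γ₁^{1/2} E₁, μ₁^{1/2} H₁, 0)`, and this weak
equation says that `(E₁, H₁)` solves Maxwell's equations (`IsAdmissible.exists_maxwell`). Let
`M_j(E, H; ψ)` be the weak Maxwell form, divergence equations included, and `W_j` the diagonal
weights `(γ_j^{-1/2}, μ_j^{1/2}, γ_j^{1/2}, μ_j^{-1/2})`. Then `(0, γ_j^{1/2} E, μ_j^{1/2} H, 0) ·
𝒫_j'u` is the density of `M_j(E, H; W_j u)` (`sum_rescaled_mul_firstOrder`).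

On smooth `ψ`, the form `M_j` of a solution is a sum of tangential traces paired with test fields
(`maxwellForm_eq_traceDensity`). Equality of the Cauchy data supplies a solution `(E₂, H₂)` for the
second parameters with the traces of `(E₁, H₁)`, so by density `M₁(E₁, H₁; W₁v₂) = M₂(E₂, H₂;
W₁v₂)`. Split `W₁v₂ = (W₁ - W₂)v₂ + W₂v₂`. The second part contributes zero because `𝒫₂'v₂ = 0`. The
first does because `W₁ - W₂` is Lipschitz and vanishes off `Ω`, which makes `(W₁ - W₂)v₂` admissible
in the interior weak form.

Two density results carry the analysis: `integral_eq_zero_of_forall_test` passes from test functions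
to `H¹_loc`, and `setIntegral_eq_zero_of_lipschitz` passes from test functions in `Ω` to products of
an `H¹_loc` function with a Lipschitz function vanishing off `Ω`. -/

namespace MaxwellLip

/-! ### Extension of first order functionals from test functions to `H¹_loc` -/

open scoped Convolution

/-- Translates of an `L²` function depend continuously on the translation, tested against `L²`. -/
theorem continuous_integral_translate_mul {𝕜 : Type*} [RCLike 𝕜] {a u : R3 → 𝕜}
    (ha : MemLp a 2 volume) (hu : MemLp u 2 volume) :
    Continuous fun y => ∫ x, a (x - y) * u x := by
  -- Conjugating `u` turns the bilinear pairing into the `L²` inner product; continuity is then that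
  -- of the translation action on `L²`.
  have hu' : MemLp (fun x => star (u x)) 2 volume := hu.star
  let A : Lp 𝕜 2 (volume : Measure R3) := ha.toLp a
  let U : Lp 𝕜 2 (volume : Measure R3) := hu'.toLp _
  have key : ∀ y : R3, ∫ x, a (x - y) * u x = inner 𝕜 U ((DomAddAct.mk (-y)) +ᵥ A) := by
    intro y
    rw [L2.inner_def]
    apply integral_congr_ae
    have h1 := DomAddAct.vadd_Lp_ae_eq (DomAddAct.mk (-y)) A
    have h2 := hu'.coeFn_toLp
    have h3 := (measurePreserving_vadd (-y) (volume : Measure R3)).quasiMeasurePreserving.ae_eq_comp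
      ha.coeFn_toLp
    filter_upwards [h1, h2, h3] with x h1 h2 h3
    simp only [A, U] at *
    rw [h1, h2]
    simp only [Function.comp, vadd_eq_add] at h3
    simp only [Equiv.symm_apply_apply, vadd_eq_add, h3, RCLike.inner_apply]
    rw [neg_add_eq_sub]
    simp
  simp_rw [key]
  have : Continuous fun y : R3 => (DomAddAct.mk (-y)) +ᵥ A := by
    have : Continuous fun y : R3 => (DomAddAct.mk (-y)) :=
      DomAddAct.continuous_mk.comp continuous_neg
    have hp : Fact ((2 : ENNReal) ≠ ⊤) := ⟨by norm_num⟩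
    exact this.vadd continuous_const
  fun_prop

theorem integrable_translate_mul {𝕜 : Type*} [RCLike 𝕜] {a u : R3 → 𝕜}
    (ha : MemLp a 2 volume) (hu : MemLp u 2 volume) (y : R3) :
    Integrable fun x => a (x - y) * u x :=
  MemLp.integrable_mul (ha.comp_measurePreserving (measurePreserving_sub_right volume y)) hu

/-- Fubini. Absolute integrability holds because `y ↦ ∫ |a(x - y)| |u(x)| dx` is continuous and `ρ`
has compact support. -/
theorem integral_mul_integral_translate {a u ρ : R3 → ℂ}
    (ha : MemLp a 2 volume) (hu : MemLp u 2 volume) (hρ : Continuous ρ)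
    (hρc : HasCompactSupport ρ) :
    ∫ y, ρ y * ∫ x, a (x - y) * u x
      = ∫ x, (a ⋆[ContinuousLinearMap.mul ℝ ℂ, volume] ρ) x * u x := by
  have hint : Integrable (Function.uncurry fun y x => ρ y * (a (x - y) * u x))
      ((volume : Measure R3).prod volume) := by
    have hm : AEStronglyMeasurable (Function.uncurry fun y x => ρ y * (a (x - y) * u x))
        ((volume : Measure R3).prod volume) := by
      refine AEStronglyMeasurable.mul (hρ.comp continuous_fst).aestronglyMeasurable
        (AEStronglyMeasurable.mul ?_ hu.1.comp_snd)
      have := (Measure.measurePreserving_swap (μ := (volume : Measure R3))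
        (ν := (volume : Measure R3))).quasiMeasurePreserving
      have h2 := (quasiMeasurePreserving_sub (volume : Measure R3) volume).comp this
      exact ha.1.comp_quasiMeasurePreserving h2
    rw [integrable_prod_iff hm]
    refine ⟨Filter.Eventually.of_forall fun y =>
      (integrable_translate_mul ha hu y).const_mul (ρ y), ?_⟩
    have hc := continuous_integral_translate_mul ha.norm hu.norm
    have : (fun y => ∫ x, ‖Function.uncurry (fun y x => ρ y * (a (x - y) * u x)) (y, x)‖)
        = fun y => ‖ρ y‖ * ∫ x, ‖a (x - y)‖ * ‖u x‖ := by
      ext y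
      simp only [Function.uncurry_apply_pair, norm_mul]
      rw [integral_const_mul]
    rw [this]
    exact (hρ.norm.mul hc).integrable_of_hasCompactSupport (hρc.norm.mul_right)
  calc ∫ y, ρ y * ∫ x, a (x - y) * u x = ∫ y, ∫ x, ρ y * (a (x - y) * u x) := by
        simp_rw [integral_const_mul]
    _ = ∫ x, ∫ y, ρ y * (a (x - y) * u x) := integral_integral_swap hint
    _ = _ := by
        congr 1; ext x
        rw [convolution_eq_swap, ← integral_mul_const]
        congr 1; ext y
        simp; ring

theorem IsTest.differentiable {U : Set R3} {φ : R3 → ℂ} (h : IsTest U φ) : Differentiable ℝ φ :=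
  h.1.differentiable (by simp)

theorem IsTest.mono {U V : Set R3} {φ : R3 → ℂ} (h : IsTest U φ) (hUV : U ⊆ V) : IsTest V φ :=
  ⟨h.1, h.2.1, h.2.2.trans hUV⟩

theorem IsTest.univ {U : Set R3} {φ : R3 → ℂ} (h : IsTest U φ) : IsTest Set.univ φ :=
  h.mono (Set.subset_univ _)

theorem tsupport_pd_subset (j : Fin 3) (f : R3 → ℂ) : tsupport (pd j f) ⊆ tsupport f := by
  refine closure_minimal ?_ (isClosed_tsupport f)
  intro x hx
  by_contra h
  apply hx
  have : fderiv ℝ f x = 0 := by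
    by_contra h'
    exact h (support_fderiv_subset ℝ h')
  simp [pd, this]

theorem IsTest.pd {U : Set R3} {φ : R3 → ℂ} (h : IsTest U φ) (j : Fin 3) : IsTest U (pd j φ) := by
  refine ⟨?_, ?_, (tsupport_pd_subset j φ).trans h.2.2⟩
  · exact (h.1.fderiv_right (m := (⊤ : ℕ∞)) (by simp)).clm_apply contDiff_const
  · exact h.2.1.mono' ((subset_tsupport _).trans (tsupport_pd_subset j φ))

theorem IsTest.mul {U V : Set R3} {φ χ : R3 → ℂ} (h : IsTest U φ) (h' : IsTest V χ) :
    IsTest U (fun x => χ x * φ x) :=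
  ⟨h'.1.mul h.1, h.2.1.mul_left,
    (closure_mono (Function.support_mul_subset_right _ _)).trans h.2.2⟩

theorem pd_const_sub (j : Fin 3) {ρ : R3 → ℂ} (h : Differentiable ℝ ρ) (x y : R3) :
    pd j (fun y => ρ (x - y)) y = - pd j ρ (x - y) := by
  have := (h (x - y)).hasFDerivAt.comp y ((hasFDerivAt_const x y).sub (hasFDerivAt_id y))
  have h2 := this.fderiv
  simp only [Function.comp_def] at h2
  unfold pd
  erw [h2]
  simp

theorem IsTest.const_sub {ρ : R3 → ℂ} (h : IsTest Set.univ ρ) (x : R3) :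
    IsTest Set.univ (fun y => ρ (x - y)) := by
  refine ⟨h.1.comp (contDiff_const.sub contDiff_id), ?_, Set.subset_univ _⟩
  exact h.2.1.comp_homeomorph (Homeomorph.subLeft x)

theorem integrable_of_memLp_two_of_bounded_support {a : R3 → ℂ} {R : ℝ} (ha : MemLp a 2 volume)
    (hR : ∀ x, x ∉ Metric.closedBall (0 : R3) R → a x = 0) : Integrable a := by
  have h1 : IntegrableOn a (Metric.closedBall (0 : R3) R) := by
    have : IsFiniteMeasure (volume.restrict (Metric.closedBall (0 : R3) R)) :=
      ⟨by simpa using (isCompact_closedBall (0 : R3) R).measure_lt_top (μ := volume)⟩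
    exact (ha.restrict _).integrable (by norm_num)
  rw [← integrableOn_univ]
  exact (integrableOn_iff_integrable_of_support_subset
    (fun x hx => by_contra fun h => hx (hR x h))).1 h1 |>.integrableOn

theorem hasCompactSupport_conv {a ρ : R3 → ℂ} {R : ℝ}
    (hR : ∀ x, x ∉ Metric.closedBall (0 : R3) R → a x = 0) (h : HasCompactSupport ρ) :
    HasCompactSupport (a ⋆[ContinuousLinearMap.mul ℝ ℂ, volume] ρ) :=
  HasCompactSupport.convolution (ContinuousLinearMap.mul ℝ ℂ)
    (HasCompactSupport.intro (isCompact_closedBall (0 : R3) R) hR) h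

theorem IsTest.conv {a ρ : R3 → ℂ} {R : ℝ} (ha : Integrable a)
    (hR : ∀ x, x ∉ Metric.closedBall (0 : R3) R → a x = 0) (h : IsTest Set.univ ρ) :
    IsTest Set.univ (a ⋆[ContinuousLinearMap.mul ℝ ℂ, volume] ρ) :=
  ⟨h.2.1.contDiff_convolution_right _ ha.locallyIntegrable h.1, hasCompactSupport_conv hR h.2.1,
    Set.subset_univ _⟩

theorem pd_conv {a ρ : R3 → ℂ} (ha : Integrable a) (h : IsTest Set.univ ρ) (j : Fin 3) (x : R3) :
    pd j (a ⋆[ContinuousLinearMap.mul ℝ ℂ, volume] ρ) x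
      = (a ⋆[ContinuousLinearMap.mul ℝ ℂ, volume] (pd j ρ)) x := by
  have h1 : ContDiff ℝ 1 ρ := h.1.of_le (by exact_mod_cast le_top)
  have := h.2.1.hasFDerivAt_convolution_right (ContinuousLinearMap.mul ℝ ℂ)
    ha.locallyIntegrable h1 x
  rw [pd, this.fderiv, convolution_precompR_apply _ ha.locallyIntegrable (h.2.1.fderiv ℝ)
    (h1.continuous_fderiv (by norm_num))]
  rfl

theorem conv_eq_zero {a ρ : R3 → ℂ} {R : ℝ}
    (hR : ∀ x, x ∉ Metric.closedBall (0 : R3) R → a x = 0)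
    (hρ : tsupport ρ ⊆ Metric.ball 0 1) {x : R3} (hx : x ∉ Metric.closedBall (0 : R3) (R + 1)) :
    (a ⋆[ContinuousLinearMap.mul ℝ ℂ, volume] ρ) x = 0 := by
  rw [convolution_def]
  apply integral_eq_zero_of_ae
  filter_upwards with t
  by_cases ht : t ∈ Metric.closedBall (0 : R3) R
  · have : x - t ∉ tsupport ρ := by
      intro h
      have := hρ h
      simp only [Metric.mem_ball, Metric.mem_closedBall, dist_zero_right, not_le] at *
      have := norm_sub_norm_le x t
      linarith
    simp [image_eq_zero_of_notMem_tsupport this]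
  · simp [hR t ht]

/-- `u ∈ H¹_loc(ℝ³)` with weak gradient `D`. -/
structure HasWeakGrad (u : R3 → ℂ) (D : Fin 3 → R3 → ℂ) : Prop where
  memL2 : MemL2loc u
  memL2_grad : ∀ j, MemL2loc (D j)
  weak : ∀ j, HasWeakPd j u (D j)

theorem MemH1loc.hasWeakGrad {u : R3 → ℂ} (h : MemH1loc u) :
    HasWeakGrad u (fun j => weakPd j u) := by
  have key : ∀ j, MemL2loc (weakPd j u) ∧ HasWeakPd j u (weakPd j u) := by
    intro j
    have := h.2 j
    rw [weakPd, dif_pos this]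
    exact this.choose_spec
  exact ⟨h.1, fun j => (key j).1, fun j => (key j).2⟩

theorem MemL2loc.locallyIntegrable {u : R3 → ℂ} (h : MemL2loc u) : LocallyIntegrable u := by
  rw [locallyIntegrable_iff]
  intro K hK
  have : IsFiniteMeasure (volume.restrict K) := ⟨by simpa using hK.measure_lt_top (μ := volume)⟩
  exact (h K hK).integrable (by norm_num)

theorem MemL2loc.memLp_indicator {u : R3 → ℂ} (h : MemL2loc u) {K : Set R3} (hK : IsCompact K) :
    MemLp (K.indicator u) 2 volume :=
  (memLp_indicator_iff_restrict hK.measurableSet).2 (h K hK)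

theorem MemL2loc.integrable_test_mul {u φ : R3 → ℂ} (h : MemL2loc u) (hφ : IsTest Set.univ φ) :
    Integrable fun x => φ x * u x :=
  h.locallyIntegrable.integrable_smul_left_of_hasCompactSupport hφ.1.continuous hφ.2.1

/-- A first order functional with compactly supported `L²` coefficients that vanishes on all test
functions vanishes on `H¹_loc`. -/
theorem integral_eq_zero_of_forall_test {a : R3 → ℂ} {b : Fin 3 → R3 → ℂ} {R : ℝ}
    (ha : MemLp a 2 volume) (hb : ∀ j, MemLp (b j) 2 volume)
    (haR : ∀ x, x ∉ Metric.closedBall (0 : R3) R → a x = 0)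
    (hbR : ∀ j x, x ∉ Metric.closedBall (0 : R3) R → b j x = 0)
    (h : ∀ φ, IsTest Set.univ φ → ∫ x, (a x * φ x + ∑ j, b j x * pd j φ x) = 0)
    {u : R3 → ℂ} {D : Fin 3 → R3 → ℂ} (hu : HasWeakGrad u D) :
    Integrable (fun x => a x * u x + ∑ j, b j x * D j x) ∧
      ∫ x, (a x * u x + ∑ j, b j x * D j x) = 0 := by
  -- The margin `1` leaves room for mollifiers supported in the unit ball: `a ⋆ ρ` and `b j ⋆ ρ`
  -- still vanish off `S`, so `u` and `D` may be truncated to `S`.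
  set S : Set R3 := Metric.closedBall 0 (R + 1) with hS
  have hSc : IsCompact S := isCompact_closedBall _ _
  have hu' := hu.memL2.memLp_indicator hSc
  have hD' := fun j => (hu.memL2_grad j).memLp_indicator hSc
  have hai := integrable_of_memLp_two_of_bounded_support ha haR
  have hbi := fun j => integrable_of_memLp_two_of_bounded_support (hb j) (hbR j)
  set G0 : R3 → ℂ := fun y => ∫ x, a (x - y) * S.indicator u x with hG0
  set G : Fin 3 → R3 → ℂ := fun j y => ∫ x, b j (x - y) * S.indicator (D j) x with hG
  have hG0c : Continuous G0 := continuous_integral_translate_mul ha hu'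
  have hGc : ∀ j, Continuous (G j) := fun j => continuous_integral_translate_mul (hb j) (hD' j)
  -- `H y` is the functional with coefficients translated by `y`, applied to `(u, D)`; the claim is
  -- `H 0 = 0`. Mollifying the coefficients instead of `u` only requires `H` to be continuous and to
  -- vanish a.e. near `0`.
  set H : R3 → ℂ := fun y => G0 y + ∑ j, G j y with hH
  have hHc : Continuous H := hG0c.add (continuous_finsetSum _ fun j _ => hGc j)
  have hRS : ∀ x, x ∉ S → x ∉ Metric.closedBall (0 : R3) R := fun x hx h' =>
    hx (Metric.closedBall_subset_closedBall (by linarith) h')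
  have hint0 : Integrable fun x => a x * S.indicator u x := MemLp.integrable_mul ha hu'
  have hint : ∀ j, Integrable fun x => b j x * S.indicator (D j) x :=
    fun j => MemLp.integrable_mul (hb j) (hD' j)
  have hpt : ∀ x, a x * u x + ∑ j, b j x * D j x
      = a x * S.indicator u x + ∑ j, b j x * S.indicator (D j) x := by
    intro x
    by_cases hx : x ∈ S
    · simp [hx]
    · simp [hx, haR x (hRS x hx), hbR _ x (hRS x hx)]
  simp_rw [hpt]
  refine ⟨hint0.add (integrable_finsetSum _ fun j _ => hint j), ?_⟩
  have hH0 : ∫ x, (a x * S.indicator u x + ∑ j, b j x * S.indicator (D j) x) = H 0 := by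
    simp only [hH, hG0, hG, sub_zero]
    rw [← integral_finsetSum _ fun j _ => hint j, ← integral_add hint0
      (integrable_finsetSum _ fun j _ => hint j)]
  rw [hH0]
  have hae : ∀ᵐ y, y ∈ Metric.ball (0 : R3) 1 → H y = 0 := by
    refine Metric.isOpen_ball.ae_eq_zero_of_integral_contDiff_smul_eq_zero
      (hHc.locallyIntegrable.locallyIntegrableOn _) ?_
    intro r hr hrc hrs
    set ρ : R3 → ℂ := fun x => (r x : ℂ) with hρ
    have hρt : IsTest Set.univ ρ :=
      ⟨Complex.ofRealCLM.contDiff.comp hr, hrc.comp_left (g := Complex.ofReal) (by simp),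
        Set.subset_univ _⟩
    have hρs : tsupport ρ ⊆ Metric.ball 0 1 :=
      (closure_mono fun x hx => by simpa [hρ] using hx).trans hrs
    have e1 : ∫ x, r x • H x = (∫ y, ρ y * G0 y) + ∑ j, ∫ y, ρ y * G j y := by
      rw [← integral_finsetSum, ← integral_add]
      · congr 1; ext y
        simp [hH, hρ, Finset.mul_sum]
      · exact (hρt.1.continuous.mul hG0c).integrable_of_hasCompactSupport hρt.2.1.mul_right
      · exact integrable_finsetSum _ fun j _ =>
          (hρt.1.continuous.mul (hGc j)).integrable_of_hasCompactSupport hρt.2.1.mul_right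
      · exact fun j _ =>
          (hρt.1.continuous.mul (hGc j)).integrable_of_hasCompactSupport hρt.2.1.mul_right
    rw [e1]
    simp only [hG0, hG]
    rw [integral_mul_integral_translate ha hu' hρt.1.continuous hρt.2.1]
    simp_rw [fun j => integral_mul_integral_translate (hb j) (hD' j) hρt.1.continuous hρt.2.1]
    have f0 : ∀ x, (a ⋆[ContinuousLinearMap.mul ℝ ℂ, volume] ρ) x * S.indicator u x
        = (a ⋆[ContinuousLinearMap.mul ℝ ℂ, volume] ρ) x * u x := by
      intro x
      by_cases hx : x ∈ S
      · simp [hx]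
      · simp [hx, conv_eq_zero haR hρs hx]
    -- The mollified coefficient `b j ⋆ ρ` is itself a test function, so the definition of the weak
    -- derivative moves `D j` onto it.
    have f1 : ∀ j, ∫ x, (b j ⋆[ContinuousLinearMap.mul ℝ ℂ, volume] ρ) x * S.indicator (D j) x
        = - ∫ x, (b j ⋆[ContinuousLinearMap.mul ℝ ℂ, volume] (pd j ρ)) x * u x := by
      intro j
      have t := hρt.conv (hbi j) (hbR j)
      have := hu.weak j _ t
      simp_rw [fun x => pd_conv (hbi j) hρt j x] at this
      simp_rw [mul_comm _ (u _)]
      rw [this, neg_neg]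
      congr 1; ext x
      by_cases hx : x ∈ S
      · simp [hx, mul_comm]
      · simp [hx, conv_eq_zero (hbR j) hρs hx]
    simp_rw [f0, f1]
    rw [Finset.sum_neg_distrib, ← integral_finsetSum, ← sub_eq_add_neg, ← integral_sub]
    · apply integral_eq_zero_of_ae
      filter_upwards with x
      -- For fixed `x`, the mollified coefficients combine into the functional evaluated at the test
      -- function `t ↦ ρ(x - t)`, which is zero by hypothesis.
      have := h _ (hρt.const_sub x)
      simp_rw [pd_const_sub _ hρt.differentiable] at this
      simp only [mul_neg, Finset.sum_neg_distrib, ← sub_eq_add_neg] at this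
      have g0 : Integrable fun t => a t * ρ (x - t) :=
        by
          simpa [mul_comm] using
            hai.locallyIntegrable.integrable_smul_left_of_hasCompactSupport
              (hρt.const_sub x).1.continuous (hρt.const_sub x).2.1
      have g1 : ∀ j, Integrable fun t => b j t * pd j ρ (x - t) := fun j => by
          simpa [mul_comm] using
            (hbi j).locallyIntegrable.integrable_smul_left_of_hasCompactSupport
              ((hρt.pd j).const_sub x).1.continuous ((hρt.pd j).const_sub x).2.1
      rw [integral_sub g0 (integrable_finsetSum _ fun j _ => g1 j),
        integral_finsetSum _ fun j _ => g1 j] at this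
      rw [← Finset.sum_mul, ← sub_mul]
      simp only [convolution_def, ContinuousLinearMap.mul_apply', Pi.zero_apply]
      rw [this, zero_mul]
    · exact hu.memL2.integrable_test_mul (hρt.conv hai haR)
    · exact integrable_finsetSum _ fun j _ =>
        hu.memL2.integrable_test_mul ((hρt.pd j).conv (hbi j) (hbR j))
    · exact fun j _ => hu.memL2.integrable_test_mul ((hρt.pd j).conv (hbi j) (hbR j))
  -- If the continuous `H` were nonzero at `0`, it would be nonzero on an open set of positive
  -- measure in the unit ball.
  by_contra hne
  have hopen : IsOpen (Metric.ball (0 : R3) 1 ∩ {y | H y ≠ 0}) :=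
    Metric.isOpen_ball.inter (isOpen_ne_fun hHc continuous_const)
  have hpos := hopen.measure_pos volume ⟨0, by simp, hne⟩
  refine hpos.ne' (measure_mono_null ?_ (ae_iff.1 hae))
  rintro y ⟨hy1, hy2⟩
  simpa using ⟨by simpa using hy1, hy2⟩

/-! ### Lipschitz functions -/

theorem norm_pd_le {g : R3 → ℂ} {K : ℝ≥0} (hg : LipschitzWith K g) (j : Fin 3) (x : R3) :
    ‖pd j g x‖ ≤ K := by
  refine (ContinuousLinearMap.le_opNorm _ _).trans ?_
  simpa using norm_fderiv_le_of_lipschitz ℝ hg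

theorem measurable_pd (j : Fin 3) (g : R3 → ℂ) : Measurable (pd j g) :=
  measurable_fderiv_apply_const ℝ g _

theorem pd_eq_zero_of_notMem {g : R3 → ℂ} {K : Set R3} (hK : IsClosed K)
    (h : ∀ x, x ∉ K → g x = 0) (j : Fin 3) {x : R3} (hx : x ∉ K) : pd j g x = 0 := by
  have : g =ᶠ[nhds x] fun _ => 0 := by
    filter_upwards [hK.isOpen_compl.mem_nhds hx] with y hy using h y hy
  rw [pd, this.fderiv_eq]
  simp

theorem DifferentiableAt.pd_mul {f g : R3 → ℂ} {x : R3} (hf : DifferentiableAt ℝ f x)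
    (hg : DifferentiableAt ℝ g x) (j : Fin 3) :
    pd j (fun y => f y * g y) x = pd j f x * g x + f x * pd j g x := by
  simp only [pd]
  rw [fderiv_fun_mul hf hg]
  simp
  ring

/-- By Rademacher, line derivatives and Fréchet derivatives agree a.e., so this is integration by
parts for line derivatives of Lipschitz functions. -/
theorem integral_pd_mul_real {f h : R3 → ℝ} {K K' : ℝ≥0} (hf : LipschitzWith K f)
    (hh : LipschitzWith K' h) (hc : HasCompactSupport h) (v : R3) :
    ∫ x, fderiv ℝ f x v * h x = - ∫ x, f x * fderiv ℝ h x v := by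
  have h1 := hf.integral_lineDeriv_mul_eq hh hc v (μ := volume)
  have e1 : ∫ x, fderiv ℝ f x v * h x = ∫ x, lineDeriv ℝ f x v * h x := by
    apply integral_congr_ae
    filter_upwards [hf.ae_differentiableAt (μ := volume)] with x hx
    rw [hx.lineDeriv_eq_fderiv]
  have e2 : ∫ x, f x * fderiv ℝ h x v = - ∫ x, lineDeriv ℝ h x (-v) * f x := by
    rw [← integral_neg]
    apply integral_congr_ae
    filter_upwards [hh.ae_differentiableAt (μ := volume)] with x hx
    rw [hx.lineDeriv_eq_fderiv]
    simp; ring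
  rw [e1, e2, h1, neg_neg]

theorem integrable_pd_mul {g h : R3 → ℂ} {K : ℝ≥0} (hg : LipschitzWith K g)
    (hh : Continuous h) (hc : HasCompactSupport h) (j : Fin 3) :
    Integrable fun x => pd j g x * h x :=
  (hh.integrable_of_hasCompactSupport hc).bdd_mul (measurable_pd j g).aestronglyMeasurable
    (Filter.Eventually.of_forall (norm_pd_le hg j))

theorem integrable_mul_pd {g h : R3 → ℂ} {K : ℝ≥0} (hg : Continuous g)
    (hh : LipschitzWith K h) (hc : HasCompactSupport h) (j : Fin 3) :
    Integrable fun x => g x * pd j h x := by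
  obtain ⟨C, hC⟩ := hc.isCompact.exists_bound_of_continuousOn hg.continuousOn
  have h0 : ∀ x, x ∉ tsupport h → pd j h x = 0 := fun x hx =>
    pd_eq_zero_of_notMem (isClosed_tsupport h) (fun y hy => image_eq_zero_of_notMem_tsupport hy) j hx
  have h1 : IntegrableOn (fun x => g x * pd j h x) (tsupport h) := by
    refine Measure.integrableOn_of_bounded (M := C * K) hc.isCompact.measure_lt_top.ne
      (hg.aestronglyMeasurable.mul (measurable_pd j h).aestronglyMeasurable) ?_
    filter_upwards [ae_restrict_mem (isClosed_tsupport h).measurableSet] with x hx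
    rw [norm_mul]
    exact mul_le_mul (hC x hx) (norm_pd_le hh j x) (norm_nonneg _)
      ((norm_nonneg _).trans (hC x hx))
  exact (integrableOn_iff_integrable_of_support_subset
    (fun x hx => by_contra fun h => hx (by simp [h0 x h]))).1 h1

theorem pd_re {g : R3 → ℂ} {x : R3} (hg : DifferentiableAt ℝ g x) (j : Fin 3) :
    fderiv ℝ (fun y => (g y).re) x (EuclideanSpace.single j 1) = (pd j g x).re := by
  have := (Complex.reCLM.hasFDerivAt.comp x hg.hasFDerivAt).fderiv
  simp only [Function.comp_def, Complex.reCLM_apply] at this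
  rw [this]; simp [pd]

theorem pd_im {g : R3 → ℂ} {x : R3} (hg : DifferentiableAt ℝ g x) (j : Fin 3) :
    fderiv ℝ (fun y => (g y).im) x (EuclideanSpace.single j 1) = (pd j g x).im := by
  have := (Complex.imCLM.hasFDerivAt.comp x hg.hasFDerivAt).fderiv
  simp only [Function.comp_def, Complex.imCLM_apply] at this
  rw [this]; simp [pd]

theorem _root_.LipschitzWith.complex_re {g : R3 → ℂ} {K : ℝ≥0} (hg : LipschitzWith K g) :
    LipschitzWith K fun x => (g x).re :=
  LipschitzWith.of_dist_le_mul fun x y =>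
    (by simpa [Real.dist_eq, Complex.dist_eq] using Complex.abs_re_le_norm (g x - g y) :
      dist (g x).re (g y).re ≤ dist (g x) (g y)).trans (hg.dist_le_mul x y)

theorem _root_.LipschitzWith.complex_im {g : R3 → ℂ} {K : ℝ≥0} (hg : LipschitzWith K g) :
    LipschitzWith K fun x => (g x).im :=
  LipschitzWith.of_dist_le_mul fun x y =>
    (by simpa [Real.dist_eq, Complex.dist_eq] using Complex.abs_im_le_norm (g x - g y) :
      dist (g x).im (g y).im ≤ dist (g x) (g y)).trans (hg.dist_le_mul x y)

/-- Integration by parts for Lipschitz functions, one of them compactly supported. -/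
theorem integral_pd_mul {g h : R3 → ℂ} {K K' : ℝ≥0} (hg : LipschitzWith K g)
    (hh : LipschitzWith K' h) (hc : HasCompactSupport h) (j : Fin 3) :
    ∫ x, pd j g x * h x = - ∫ x, g x * pd j h x := by
  have cre : HasCompactSupport fun x => (h x).re := hc.comp_left (g := Complex.re) rfl
  have cim : HasCompactSupport fun x => (h x).im := hc.comp_left (g := Complex.im) rfl
  have I := integrable_pd_mul hg hh.continuous hc j
  have J := integrable_mul_pd hg.continuous hh hc j
  have dg := hg.ae_differentiableAt (μ := volume)
  have dh := hh.ae_differentiableAt (μ := volume)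
  have key : ∀ {f p : R3 → ℝ} {K K' : ℝ≥0}, LipschitzWith K f → LipschitzWith K' p →
      HasCompactSupport p →
      Integrable (fun x => fderiv ℝ f x (EuclideanSpace.single j 1) * p x) ∧
      Integrable (fun x => f x * fderiv ℝ p x (EuclideanSpace.single j 1)) := by
    intro f p K K' hf hp hpc
    have l1 : LipschitzWith K fun x => (f x : ℂ) :=
      LipschitzWith.of_dist_le_mul fun x y => by
        simpa [Complex.dist_eq, ← Complex.ofReal_sub, Real.dist_eq] using hf.dist_le_mul x y
    have l2 : LipschitzWith K' fun x => (p x : ℂ) :=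
      LipschitzWith.of_dist_le_mul fun x y => by
        simpa [Complex.dist_eq, ← Complex.ofReal_sub, Real.dist_eq] using hp.dist_le_mul x y
    have c2 : HasCompactSupport fun x => (p x : ℂ) := hpc.comp_left (g := Complex.ofReal) (by simp)
    have i1 := (integrable_pd_mul l1 l2.continuous c2 j).re
    have i2 := (integrable_mul_pd l1.continuous l2 c2 j).re
    refine ⟨i1.congr ?_, i2.congr ?_⟩
    · filter_upwards [l1.ae_differentiableAt (μ := volume)] with x hx
      simp [← pd_re hx]
    · filter_upwards [l2.ae_differentiableAt (μ := volume)] with x hx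
      simp [← pd_re hx]
  have rr := integral_pd_mul_real hg.complex_re hh.complex_re cre (EuclideanSpace.single j 1)
  have ri := integral_pd_mul_real hg.complex_re hh.complex_im cim (EuclideanSpace.single j 1)
  have ir := integral_pd_mul_real hg.complex_im hh.complex_re cre (EuclideanSpace.single j 1)
  have ii := integral_pd_mul_real hg.complex_im hh.complex_im cim (EuclideanSpace.single j 1)
  have krr := key hg.complex_re hh.complex_re cre
  have kri := key hg.complex_re hh.complex_im cim
  have kir := key hg.complex_im hh.complex_re cre
  have kii := key hg.complex_im hh.complex_im cim
  apply Complex.ext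
  · rw [Complex.neg_re, ← RCLike.re_eq_complex_re, ← integral_re I, ← integral_re J]
    have e1 : ∫ x, RCLike.re (pd j g x * h x)
        = ∫ x, (fderiv ℝ (fun y => (g y).re) x (EuclideanSpace.single j 1) * (h x).re
          - fderiv ℝ (fun y => (g y).im) x (EuclideanSpace.single j 1) * (h x).im) := by
      apply integral_congr_ae
      filter_upwards [dg] with x hx
      simp [pd_re hx, pd_im hx]
    have e2 : ∫ x, RCLike.re (g x * pd j h x)
        = ∫ x, ((g x).re * fderiv ℝ (fun y => (h y).re) x (EuclideanSpace.single j 1)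
          - (g x).im * fderiv ℝ (fun y => (h y).im) x (EuclideanSpace.single j 1)) := by
      apply integral_congr_ae
      filter_upwards [dh] with x hx
      simp [pd_re hx, pd_im hx]
    rw [e1, e2, integral_sub krr.1 kii.1, integral_sub krr.2 kii.2, rr, ii]
    ring
  · rw [Complex.neg_im, ← RCLike.im_eq_complex_im, ← integral_im I, ← integral_im J]
    have e1 : ∫ x, RCLike.im (pd j g x * h x)
        = ∫ x, (fderiv ℝ (fun y => (g y).re) x (EuclideanSpace.single j 1) * (h x).im
          + fderiv ℝ (fun y => (g y).im) x (EuclideanSpace.single j 1) * (h x).re) := by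
      apply integral_congr_ae
      filter_upwards [dg] with x hx
      simp [pd_re hx, pd_im hx]
    have e2 : ∫ x, RCLike.im (g x * pd j h x)
        = ∫ x, ((g x).re * fderiv ℝ (fun y => (h y).im) x (EuclideanSpace.single j 1)
          + (g x).im * fderiv ℝ (fun y => (h y).re) x (EuclideanSpace.single j 1)) := by
      apply integral_congr_ae
      filter_upwards [dh] with x hx
      simp [pd_re hx, pd_im hx]
    rw [e1, e2, integral_add kri.1 kir.1, integral_add kri.2 kir.2, ri, ir]
    ring

theorem IsTest.exists_lipschitz {U : Set R3} {φ : R3 → ℂ} (h : IsTest U φ) :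
    ∃ K, LipschitzWith K φ :=
  (h.1.of_le (m := 1) (by exact_mod_cast le_top)).lipschitzWith_of_hasCompactSupport h.2.1
    (by norm_num)

/-! ### Locally bounded coefficients -/

/-- Measurable and bounded on compact sets. -/
structure LocBdd (g : R3 → ℂ) : Prop where
  meas : AEStronglyMeasurable g volume
  bdd : ∀ K : Set R3, IsCompact K → ∃ C : ℝ, ∀ x ∈ K, ‖g x‖ ≤ C

theorem _root_.Continuous.locBdd {g : R3 → ℂ} (hg : Continuous g) : LocBdd g :=
  ⟨hg.aestronglyMeasurable, fun _ hK => hK.exists_bound_of_continuousOn hg.continuousOn⟩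

theorem _root_.LipschitzWith.locBdd_pd {g : R3 → ℂ} {K : ℝ≥0} (hg : LipschitzWith K g)
    (j : Fin 3) : LocBdd (pd j g) :=
  ⟨(measurable_pd j g).aestronglyMeasurable, fun _ _ => ⟨K, fun x _ => norm_pd_le hg j x⟩⟩

theorem LocBdd.mul {f g : R3 → ℂ} (hf : LocBdd f) (hg : LocBdd g) : LocBdd fun x => f x * g x := by
  refine ⟨hf.meas.mul hg.meas, fun K hK => ?_⟩
  obtain ⟨C, hC⟩ := hf.bdd K hK
  obtain ⟨C', hC'⟩ := hg.bdd K hK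
  refine ⟨C * C', fun x hx => ?_⟩
  rw [norm_mul]
  exact mul_le_mul (hC x hx) (hC' x hx) (norm_nonneg _) ((norm_nonneg _).trans (hC x hx))

theorem LocBdd.add {f g : R3 → ℂ} (hf : LocBdd f) (hg : LocBdd g) : LocBdd fun x => f x + g x := by
  refine ⟨hf.meas.add hg.meas, fun K hK => ?_⟩
  obtain ⟨C, hC⟩ := hf.bdd K hK
  obtain ⟨C', hC'⟩ := hg.bdd K hK
  exact ⟨C + C', fun x hx => (norm_add_le _ _).trans (add_le_add (hC x hx) (hC' x hx))⟩

theorem LocBdd.neg {f : R3 → ℂ} (hf : LocBdd f) : LocBdd fun x => - f x :=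
  ⟨hf.meas.neg, fun K hK => by simpa using hf.bdd K hK⟩

theorem LocBdd.const (c : ℂ) : LocBdd fun _ => c := continuous_const.locBdd

theorem LocBdd.memLp {f : R3 → ℂ} (hf : LocBdd f) {K : Set R3} (hK : IsCompact K) (p : ENNReal) :
    MemLp f p (volume.restrict K) := by
  have : IsFiniteMeasure (volume.restrict K) := ⟨by simpa using hK.measure_lt_top (μ := volume)⟩
  obtain ⟨C, hC⟩ := hf.bdd K hK
  exact MemLp.of_bound hf.meas.restrict C ((ae_restrict_mem hK.measurableSet).mono hC)

theorem LocBdd.memL2loc {f : R3 → ℂ} (hf : LocBdd f) : MemL2loc f := fun _ hK => hf.memLp hK 2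

theorem LocBdd.mul_memLp {g u : R3 → ℂ} {S : Set R3} (hg : LocBdd g)
    (hu : MemLp u 2 (volume.restrict S)) (hS : Bornology.IsBounded S) (hm : MeasurableSet S) :
    MemLp (fun x => g x * u x) 2 (volume.restrict S) := by
  obtain ⟨C, hC⟩ := hg.bdd _ hS.isCompact_closure
  refine (hu.const_mul (C : ℂ)).of_le (hg.meas.restrict.mul hu.1) ?_
  filter_upwards [ae_restrict_mem hm] with x hx
  have := hC x (subset_closure hx)
  rw [norm_mul, norm_mul]
  gcongr
  simpa using this.trans (le_abs_self C)

theorem LocBdd.mul_memL2loc {g u : R3 → ℂ} (hg : LocBdd g) (hu : MemL2loc u) :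
    MemL2loc fun x => g x * u x :=
  fun K hK => hg.mul_memLp (hu K hK) hK.isBounded hK.measurableSet

theorem MemL2loc.add {u v : R3 → ℂ} (hu : MemL2loc u) (hv : MemL2loc v) :
    MemL2loc fun x => u x + v x := fun K hK => (hu K hK).add (hv K hK)

theorem MemL2loc.memLp_of_support {u : R3 → ℂ} (hu : MemL2loc u) {R : ℝ}
    (hR : ∀ x, x ∉ Metric.closedBall (0 : R3) R → u x = 0) : MemLp u 2 volume := by
  have := hu.memLp_indicator (isCompact_closedBall (0 : R3) R)
  rwa [Set.indicator_eq_self.2 fun x hx => by_contra fun h => hx (hR x h)] at this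

theorem _root_.HasCompactSupport.exists_closedBall {g : R3 → ℂ} (hg : HasCompactSupport g) :
    ∃ R, tsupport g ⊆ Metric.closedBall 0 R := hg.isCompact.isBounded.subset_closedBall 0

/-! ### Weak gradients and functionals that vanish identically -/

theorem _root_.LipschitzWith.hasWeakGrad {g : R3 → ℂ} {K : ℝ≥0} (hg : LipschitzWith K g) :
    HasWeakGrad g fun j => pd j g where
  memL2 := hg.continuous.locBdd.memL2loc
  memL2_grad j := (hg.locBdd_pd j).memL2loc
  weak j φ hφ := by
    obtain ⟨K', hK'⟩ := hφ.exists_lipschitz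
    rw [integral_pd_mul hg hK' hφ.2.1, neg_neg]

theorem IsTest.hasWeakGrad {U : Set R3} {φ : R3 → ℂ} (hφ : IsTest U φ) :
    HasWeakGrad φ fun j => MaxwellLip.pd j φ :=
  hφ.exists_lipschitz.choose_spec.hasWeakGrad

/-- Integrable with vanishing integral. -/
def IntegralZero (f : R3 → ℂ) : Prop := Integrable f ∧ ∫ x, f x = 0

theorem IntegralZero.add {f g : R3 → ℂ} (hf : IntegralZero f) (hg : IntegralZero g) :
    IntegralZero fun x => f x + g x :=
  ⟨hf.1.add hg.1, by rw [integral_add hf.1 hg.1, hf.2, hg.2, add_zero]⟩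

theorem IntegralZero.sub {f g : R3 → ℂ} (hf : IntegralZero f) (hg : IntegralZero g) :
    IntegralZero fun x => f x - g x :=
  ⟨hf.1.sub hg.1, by rw [integral_sub hf.1 hg.1, hf.2, hg.2, sub_zero]⟩

theorem IntegralZero.const_mul {f : R3 → ℂ} (hf : IntegralZero f) (c : ℂ) :
    IntegralZero fun x => c * f x :=
  ⟨hf.1.const_mul c, by rw [integral_const_mul, hf.2, mul_zero]⟩

theorem IntegralZero.congr {f g : R3 → ℂ} (hf : IntegralZero f) (h : ∀ᵐ x, f x = g x) :
    IntegralZero g := ⟨hf.1.congr h, by rw [← integral_congr_ae h, hf.2]⟩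

/-- Pass from test functions to `H¹_loc` in a first order functional. -/
theorem HasWeakGrad.integralZero {a : R3 → ℂ} {b : Fin 3 → R3 → ℂ} {R : ℝ}
    (ha : MemL2loc a) (hb : ∀ j, MemL2loc (b j))
    (haR : ∀ x, x ∉ Metric.closedBall (0 : R3) R → a x = 0)
    (hbR : ∀ j x, x ∉ Metric.closedBall (0 : R3) R → b j x = 0)
    (h : ∀ φ, IsTest Set.univ φ → ∫ x, (a x * φ x + ∑ j, b j x * pd j φ x) = 0)
    {u : R3 → ℂ} {D : Fin 3 → R3 → ℂ} (hu : HasWeakGrad u D) :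
    IntegralZero fun x => a x * u x + ∑ j, b j x * D j x :=
  integral_eq_zero_of_forall_test (ha.memLp_of_support haR) (fun j => (hb j).memLp_of_support
    (hbR j)) haR hbR h hu

theorem IsTest.exists_closedBall {U : Set R3} {v : R3 → ℂ} (hv : IsTest U v) :
    ∃ R, (∀ x, x ∉ Metric.closedBall (0 : R3) R → v x = 0) ∧
      ∀ j x, x ∉ Metric.closedBall (0 : R3) R → MaxwellLip.pd j v x = 0 := by
  obtain ⟨R, hR⟩ := hv.2.1.exists_closedBall
  exact ⟨R, fun x hx => image_eq_zero_of_notMem_tsupport fun h => hx (hR h),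
    fun j x hx => image_eq_zero_of_notMem_tsupport fun h => hx (hR (tsupport_pd_subset j v h))⟩

/-- The integrand is `∂_j(g u v)`. For a test function in place of `u` this is integration by parts
for Lipschitz functions; both sides are first order functionals of `u`, so density applies. -/
theorem integralZero_pd_mul_test {g u v : R3 → ℂ} {K : ℝ≥0} {D : Fin 3 → R3 → ℂ} {U : Set R3}
    (hg : LipschitzWith K g) (hu : HasWeakGrad u D) (hv : IsTest U v) (j : Fin 3) :
    IntegralZero fun x => pd j g x * (u x * v x) + g x * (D j x * v x + u x * pd j v x) := by
  obtain ⟨R, h0, h1⟩ := hv.exists_closedBall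
  have := hu.integralZero (a := fun x => pd j g x * v x + g x * pd j v x)
    (b := fun i x => if i = j then g x * v x else 0) (R := R)
    (((hg.locBdd_pd j).mul hv.1.continuous.locBdd).add
      (hg.continuous.locBdd.mul (hv.pd j).1.continuous.locBdd)).memL2loc
    (fun i => by
      split_ifs
      · exact (hg.continuous.mul hv.1.continuous).locBdd.memL2loc
      · exact (LocBdd.const 0).memL2loc)
    (fun x hx => by simp [h0 x hx, h1 j x hx]) (fun i x hx => by simp [h0 x hx]) ?_
  · refine this.congr (Filter.Eventually.of_forall fun x => ?_)
    simp
    ring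
  · intro φ hφ
    have ht := hv.univ.mul hφ.univ
    obtain ⟨K', hK'⟩ := ht.exists_lipschitz
    have := integral_pd_mul hg hK' ht.2.1 j
    rw [← add_eq_zero_iff_eq_neg, ← integral_add] at this
    · refine Eq.trans ?_ this
      congr 1; ext x
      rw [DifferentiableAt.pd_mul (hφ.differentiable x) (hv.differentiable x)]
      simp
      ring
    · exact integrable_pd_mul hg hK'.continuous ht.2.1 j
    · exact integrable_mul_pd hg.continuous hK' ht.2.1 j

/-- The product rule. -/
theorem HasWeakGrad.lipschitz_mul {g u : R3 → ℂ} {K : ℝ≥0} {D : Fin 3 → R3 → ℂ}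
    (hu : HasWeakGrad u D) (hg : LipschitzWith K g) :
    HasWeakGrad (fun x => g x * u x) fun j x => pd j g x * u x + g x * D j x where
  memL2 := hg.continuous.locBdd.mul_memL2loc hu.memL2
  memL2_grad j := ((hg.locBdd_pd j).mul_memL2loc hu.memL2).add
    (hg.continuous.locBdd.mul_memL2loc (hu.memL2_grad j))
  weak j φ hφ := by
    have h := (integralZero_pd_mul_test hg hu hφ j).2
    have i1 : Integrable fun x => g x * u x * pd j φ x := by
      simpa [mul_comm] using
        (hg.continuous.locBdd.mul_memL2loc hu.memL2).integrable_test_mul (hφ.pd j)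
    have i2 : Integrable fun x => (pd j g x * u x + g x * D j x) * φ x := by
      have := MemL2loc.integrable_test_mul (((hg.locBdd_pd j).mul_memL2loc hu.memL2).add
        (hg.continuous.locBdd.mul_memL2loc (hu.memL2_grad j))) hφ
      simpa only [mul_comm] using this
    rw [← add_eq_zero_iff_eq_neg, ← integral_add i1 i2, ← h]
    congr 1; ext x; ring

/-- Again `∂_j(g u v)`, with the compact support moved from `v` to `g`. Extending one factor at a
time keeps each functional linear with `L²` coefficients, although `u v` itself need not be in
`H¹_loc`. -/
theorem integralZero_pd_mul {g u v : R3 → ℂ} {K : ℝ≥0} {D D' : Fin 3 → R3 → ℂ}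
    (hg : LipschitzWith K g) (hc : HasCompactSupport g) (hu : HasWeakGrad u D)
    (hv : HasWeakGrad v D') (j : Fin 3) :
    IntegralZero fun x => pd j g x * (u x * v x) + g x * (D j x * v x + u x * D' j x) := by
  obtain ⟨R, hR⟩ := hc.exists_closedBall
  have h0 : ∀ x, x ∉ Metric.closedBall (0 : R3) R → g x = 0 := fun x hx =>
    image_eq_zero_of_notMem_tsupport fun h => hx (hR h)
  have h1 : ∀ x, x ∉ Metric.closedBall (0 : R3) R → pd j g x = 0 := fun x hx =>
    pd_eq_zero_of_notMem Metric.isClosed_closedBall h0 j hx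
  have := hv.integralZero (a := fun x => pd j g x * u x + g x * D j x)
    (b := fun i x => if i = j then g x * u x else 0) (R := R)
    (((hg.locBdd_pd j).mul_memL2loc hu.memL2).add
      (hg.continuous.locBdd.mul_memL2loc (hu.memL2_grad j)))
    (fun i => by
      split_ifs
      · exact hg.continuous.locBdd.mul_memL2loc hu.memL2
      · exact (LocBdd.const 0).memL2loc)
    (fun x hx => by simp [h0 x hx, h1 x hx]) (fun i x hx => by simp [h0 x hx]) ?_
  · refine this.congr (Filter.Eventually.of_forall fun x => ?_)
    simp
    ring
  · intro φ hφ
    refine Eq.trans ?_ (integralZero_pd_mul_test hg hu hφ j).2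
    congr 1; ext x
    simp
    ring

theorem pd_comm {φ : R3 → ℂ} {U : Set R3} (hφ : IsTest U φ) (j k : Fin 3) (x : R3) :
    pd j (pd k φ) x = pd k (pd j φ) x := by
  have h2 : ContDiff ℝ 2 φ :=
    hφ.1.of_le (mod_cast le_top : (((2 : ℕ) : ℕ∞) : WithTop ℕ∞) ≤ ((⊤ : ℕ∞) : WithTop ℕ∞))
  have hs := h2.contDiffAt.isSymmSndFDerivAt (x := x) (by simp)
  have hd : DifferentiableAt ℝ (fderiv ℝ φ) x :=
    ((h2.fderiv_right (m := 1) (by norm_num)).differentiable (by norm_num)) x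
  have key : ∀ i l : Fin 3, pd i (pd l φ) x
      = fderiv ℝ (fderiv ℝ φ) x (EuclideanSpace.single i 1) (EuclideanSpace.single l 1) := by
    intro i l
    have := (hd.hasFDerivAt.clm_apply (hasFDerivAt_const (EuclideanSpace.single l (1 : ℝ)) x)).fderiv
    unfold pd
    rw [this]
    simp
  rw [key, key, hs.eq]

/-- The weak form of curl grad `= 0`: move the derivative off `g` and commute the second derivatives
of `φ`. -/
theorem integral_pd_mul_pd_comm {g φ : R3 → ℂ} {K : ℝ≥0} (hg : LipschitzWith K g)
    {U : Set R3} (hφ : IsTest U φ) (j k : Fin 3) :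
    ∫ x, pd j g x * pd k φ x = ∫ x, pd k g x * pd j φ x := by
  obtain ⟨K1, h1⟩ := (hφ.pd k).exists_lipschitz
  obtain ⟨K2, h2⟩ := (hφ.pd j).exists_lipschitz
  rw [integral_pd_mul hg h1 (hφ.pd k).2.1, integral_pd_mul hg h2 (hφ.pd j).2.1]
  simp_rw [pd_comm hφ j k]

/-- This is a component of `∇g ∧ ∇(u v)`, the curl of `g ∇(u v)`. It follows from
`integral_pd_mul_pd_comm` for `v` times a test function, then density in `u`. -/
theorem integralZero_curl_test {g u v : R3 → ℂ} {K : ℝ≥0} {D : Fin 3 → R3 → ℂ} {U : Set R3}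
    (hg : LipschitzWith K g) (hu : HasWeakGrad u D) (hv : IsTest U v) (j k : Fin 3) :
    IntegralZero fun x => pd j g x * (D k x * v x + u x * pd k v x)
      - pd k g x * (D j x * v x + u x * pd j v x) := by
  obtain ⟨R, h0, h1⟩ := hv.exists_closedBall
  have := hu.integralZero (a := fun x => pd j g x * pd k v x + - (pd k g x * pd j v x))
    (b := fun i x => (if i = k then pd j g x * v x else 0)
      + - (if i = j then pd k g x * v x else 0)) (R := R)
    (((hg.locBdd_pd j).mul (hv.pd k).1.continuous.locBdd).add
      ((hg.locBdd_pd k).mul (hv.pd j).1.continuous.locBdd).neg).memL2loc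
    (fun i => by
      refine LocBdd.memL2loc (LocBdd.add ?_ (LocBdd.neg ?_))
      · split_ifs
        · exact (hg.locBdd_pd j).mul hv.1.continuous.locBdd
        · exact LocBdd.const 0
      · split_ifs
        · exact (hg.locBdd_pd k).mul hv.1.continuous.locBdd
        · exact LocBdd.const 0)
    (fun x hx => by simp [h1 k x hx, h1 j x hx]) (fun i x hx => by simp [h0 x hx]) ?_
  · refine this.congr (Filter.Eventually.of_forall fun x => ?_)
    simp [add_mul, Finset.sum_add_distrib, ite_mul]
    ring
  · intro φ hφ
    have ht := hv.univ.mul hφ.univ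
    have := integral_pd_mul_pd_comm hg ht j k
    rw [← sub_eq_zero, ← integral_sub] at this
    · refine Eq.trans ?_ this
      congr 1; ext x
      rw [DifferentiableAt.pd_mul (hφ.differentiable x) (hv.differentiable x),
        DifferentiableAt.pd_mul (hφ.differentiable x) (hv.differentiable x)]
      simp [add_mul, Finset.sum_add_distrib, ite_mul]
      ring
    · exact integrable_pd_mul hg (ht.pd k).1.continuous (ht.pd k).2.1 j
    · exact integrable_pd_mul hg (ht.pd j).1.continuous (ht.pd j).2.1 k

/-- As in `integralZero_pd_mul`, the second factor is passed to `H¹_loc` by density once `g`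
supplies the compact support. -/
theorem integralZero_curl {g u v : R3 → ℂ} {K : ℝ≥0} {D D' : Fin 3 → R3 → ℂ}
    (hg : LipschitzWith K g) (hc : HasCompactSupport g) (hu : HasWeakGrad u D)
    (hv : HasWeakGrad v D') (j k : Fin 3) :
    IntegralZero fun x => pd j g x * (D k x * v x + u x * D' k x)
      - pd k g x * (D j x * v x + u x * D' j x) := by
  obtain ⟨R, hR⟩ := hc.exists_closedBall
  have h0 : ∀ x, x ∉ Metric.closedBall (0 : R3) R → g x = 0 := fun x hx =>
    image_eq_zero_of_notMem_tsupport fun h => hx (hR h)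
  have h1 : ∀ j x, x ∉ Metric.closedBall (0 : R3) R → pd j g x = 0 := fun j x hx =>
    pd_eq_zero_of_notMem Metric.isClosed_closedBall h0 j hx
  have := hv.integralZero (a := fun x => pd j g x * D k x + (- pd k g x) * D j x)
    (b := fun i x => ((if i = k then pd j g x else 0) + - (if i = j then pd k g x else 0)) * u x)
    (R := R)
    (((hg.locBdd_pd j).mul_memL2loc (hu.memL2_grad k)).add
      ((hg.locBdd_pd k).neg.mul_memL2loc (hu.memL2_grad j)))
    (fun i => by
      refine LocBdd.mul_memL2loc (LocBdd.add ?_ (LocBdd.neg ?_)) hu.memL2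
      · split_ifs
        · exact hg.locBdd_pd j
        · exact LocBdd.const 0
      · split_ifs
        · exact hg.locBdd_pd k
        · exact LocBdd.const 0)
    (fun x hx => by simp [h1 k x hx, h1 j x hx]) (fun i x hx => by simp [h1 _ x hx]) ?_
  · refine this.congr (Filter.Eventually.of_forall fun x => ?_)
    simp [add_mul, Finset.sum_add_distrib, ite_mul]
    ring
  · intro φ hφ
    refine Eq.trans ?_ (integralZero_curl_test hg hu hφ j k).2
    congr 1; ext x
    simp [add_mul, Finset.sum_add_distrib, ite_mul]
    ring

/-- Both terms integrate to `-∫ u ∂_j∂_k v`. -/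
theorem integralZero_null {u v : R3 → ℂ} {D : Fin 3 → R3 → ℂ} {U : Set R3}
    (hu : HasWeakGrad u D) (hv : IsTest U v) (j k : Fin 3) :
    IntegralZero fun x => D j x * pd k v x - D k x * pd j v x := by
  have i : ∀ j k, Integrable fun x => D j x * pd k v x := fun j k => by
    simpa only [mul_comm] using (hu.memL2_grad j).integrable_test_mul (hv.univ.pd k)
  refine ⟨(i j k).sub (i k j), ?_⟩
  rw [integral_sub (i j k) (i k j)]
  have h1 := hu.weak j _ (hv.univ.pd k)
  have h2 := hu.weak k _ (hv.univ.pd j)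
  simp_rw [pd_comm hv.univ j k] at h1
  rw [h1] at h2
  rw [neg_injective h2, sub_self]

/-! ### Functionals on a bounded open set -/

theorem exists_test_eq_one {Ω K : Set R3} (hΩ : IsOpen Ω) (hK : IsCompact K) (hKΩ : K ⊆ Ω) :
    ∃ χ, IsTest Ω χ ∧ ∀ x ∈ K, χ x = 1 ∧ ∀ j, pd j χ x = 0 := by
  obtain ⟨L, hL, hKL, hLΩ⟩ := exists_compact_between hK hΩ hKΩ
  obtain ⟨f, hf1, hf0, -⟩ := exists_contMDiffMap_one_nhds_of_subset_interior
    (n := (⊤ : ℕ∞)) (modelWithCornersSelf ℝ R3) hK.isClosed hKL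
  have hs : tsupport (fun x => (f x : ℂ)) ⊆ L := by
    refine closure_minimal (fun x hx => ?_) hL.isClosed
    by_contra h
    exact hx (by simp [hf0 x h])
  refine ⟨fun x => (f x : ℂ), ⟨Complex.ofRealCLM.contDiff.comp f.contMDiff.contDiff,
    hL.of_isClosed_subset (isClosed_tsupport _) hs, hs.trans hLΩ⟩, fun x hx => ?_⟩
  have hx1 : ∀ᶠ y in nhds x, f y = 1 := (mem_nhdsSet_iff_forall.1 hf1) x hx
  refine ⟨by simpa using hx1.self_of_nhds, fun j => ?_⟩
  have : (fun x => (f x : ℂ)) =ᶠ[nhds x] fun _ => 1 := by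
    filter_upwards [hx1] with y hy
    have : f y = 1 := hy
    simp [this]
  rw [pd, this.fderiv_eq]
  simp

theorem MemL2loc.memLp_restrict {u : R3 → ℂ} (hu : MemL2loc u) {S : Set R3}
    (hS : Bornology.IsBounded S) : MemLp u 2 (volume.restrict S) :=
  (hu _ hS.isCompact_closure).mono_measure (Measure.restrict_mono subset_closure le_rfl)

theorem memLp_finset_sum {ι : Type*} (s : Finset ι) {f : ι → R3 → ℂ} {μ : Measure R3}
    (h : ∀ i ∈ s, MemLp (f i) 2 μ) : MemLp (fun x => ∑ i ∈ s, f i x) 2 μ := by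
  simpa using memLp_finsetSum s h

/-- A smooth `χ` in `C_c^∞(Ω)` equal to `1` on `K` makes `φ ↦ χ φ` map all test functions to tests
in `Ω`. The functional composed with this map vanishes on all tests, hence on `g u`, on which `χ`
has no effect. -/
theorem setIntegral_eq_zero_of_compact {Ω : Set R3} (hΩ : IsOpen Ω) (hb : Bornology.IsBounded Ω)
    {a : R3 → ℂ} {b : Fin 3 → R3 → ℂ} (ha : MemLp a 2 (volume.restrict Ω))
    (hbL : ∀ j, MemLp (b j) 2 (volume.restrict Ω))
    (h : ∀ φ, IsTest Ω φ → ∫ x in Ω, (a x * φ x + ∑ j, b j x * pd j φ x) = 0)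
    {u g : R3 → ℂ} {D : Fin 3 → R3 → ℂ} (hu : HasWeakGrad u D) {L : ℝ≥0}
    (hg : LipschitzWith L g) {K : Set R3} (hK : IsCompact K) (hKΩ : K ⊆ Ω)
    (hgK : ∀ x, x ∉ K → g x = 0) :
    ∫ x in Ω, (a x * (g x * u x) + ∑ j, b j x * (pd j g x * u x + g x * D j x)) = 0 := by
  obtain ⟨χ, hχ, hχ1⟩ := exists_test_eq_one hΩ hK hKΩ
  obtain ⟨R, hR⟩ := hb.subset_closedBall 0
  have hm := hΩ.measurableSet
  have lχ := hχ.1.continuous.locBdd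
  have lχ' := fun j => (hχ.pd j).1.continuous.locBdd
  -- These coefficients come from expanding `∂_j(χ φ)` and collecting the terms in `φ` and in `∂_j
  -- φ`.
  have key := integral_eq_zero_of_forall_test (R := R)
    (a := Ω.indicator fun x => χ x * a x + ∑ j, pd j χ x * b j x)
    (b := fun j => Ω.indicator fun x => χ x * b j x)
    ((memLp_indicator_iff_restrict hm).2 ((lχ.mul_memLp ha hb hm).add
      (memLp_finset_sum _ fun j _ => (lχ' j).mul_memLp (hbL j) hb hm)))
    (fun j => (memLp_indicator_iff_restrict hm).2 (lχ.mul_memLp (hbL j) hb hm))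
    (fun x hx => Set.indicator_of_notMem (fun h' => hx (hR h')) _)
    (fun j x hx => Set.indicator_of_notMem (fun h' => hx (hR h')) _) ?_
    (hu.lipschitz_mul hg)
  · rw [← integral_indicator hm]
    refine Eq.trans ?_ key.2
    congr 1; ext x
    by_cases hx : x ∈ Ω
    · simp only [hx, Set.indicator_of_mem]
      by_cases hxK : x ∈ K
      · simp [(hχ1 x hxK).1, (hχ1 x hxK).2]
      · simp [hgK x hxK, pd_eq_zero_of_notMem hK.isClosed hgK _ hxK]
    · simp [hx]
  · intro φ hφ
    refine Eq.trans ?_ (h _ (hφ.mul hχ |> fun t => ⟨t.1, t.2.1, ?_⟩ : IsTest Ω fun x => χ x * φ x))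
    · rw [← integral_indicator hm]
      congr 1; ext x
      by_cases hx : x ∈ Ω
      · simp only [hx, Set.indicator_of_mem]
        simp_rw [DifferentiableAt.pd_mul (hχ.differentiable x) (hφ.differentiable x)]
        simp only [mul_add, add_mul, Finset.sum_add_distrib, Finset.sum_mul]
        rw [add_assoc]
        congr 1
        · ring
        · congr 1
          · exact Finset.sum_congr rfl fun j _ => by ring
          · exact Finset.sum_congr rfl fun j _ => by ring
      · simp [hx]
    · exact (closure_mono (Function.support_mul_subset_left _ _)).trans hχ.2.2

theorem norm_le_mul_infDist {Ω : Set R3} (hΩ : IsOpen Ω) (hne : (Ωᶜ).Nonempty) {g : R3 → ℂ}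
    {L : ℝ≥0} (hg : LipschitzWith L g) (hgΩ : ∀ x, x ∉ Ω → g x = 0) (x : R3) :
    ‖g x‖ ≤ L * Metric.infDist x Ωᶜ := by
  obtain ⟨y, hy, hxy⟩ := hΩ.isClosed_compl.exists_infDist_eq_dist hne x
  rw [hxy]
  simpa [hgΩ y hy, dist_eq_norm] using hg.dist_le_mul x y

/-- The cut-off function that vanishes at distance at most `1 / n` from the complement of `Ω` and
equals `1` at distance at least `2 / n`. -/
noncomputable def distCutoff (Ω : Set R3) (n : ℝ) (x : R3) : ℝ :=
  max 0 (min 1 (n * Metric.infDist x Ωᶜ - 1))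

theorem distCutoff_nonneg (Ω : Set R3) (n : ℝ) (x : R3) : 0 ≤ distCutoff Ω n x := le_max_left _ _

theorem distCutoff_le_one (Ω : Set R3) (n : ℝ) (x : R3) : distCutoff Ω n x ≤ 1 :=
  max_le zero_le_one (min_le_left _ _)

theorem distCutoff_eq_one {Ω : Set R3} {n : ℝ} {x : R3} (h : 2 ≤ n * Metric.infDist x Ωᶜ) :
    distCutoff Ω n x = 1 := by
  rw [distCutoff, min_eq_left (by linarith), max_eq_right zero_le_one]

theorem distCutoff_eq_zero {Ω : Set R3} {n : ℝ} {x : R3} (h : n * Metric.infDist x Ωᶜ ≤ 1) :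
    distCutoff Ω n x = 0 := by
  rw [distCutoff, max_eq_left ((min_le_right _ _).trans (by linarith))]

theorem abs_distCutoff_sub_le {Ω : Set R3} {n : ℝ} (hn : 0 ≤ n) (x y : R3) :
    |distCutoff Ω n x - distCutoff Ω n y| ≤ n * dist x y := by
  have h1 : |Metric.infDist x Ωᶜ - Metric.infDist y Ωᶜ| ≤ dist x y := by
    simpa [Real.dist_eq] using (Metric.lipschitz_infDist_pt Ωᶜ).dist_le_mul x y
  unfold distCutoff
  refine (abs_max_sub_max_le_max _ _ _ _).trans (max_le (by simp; positivity) ?_)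
  refine (abs_min_sub_min_le_max _ _ _ _).trans (max_le (by simp; positivity) ?_)
  rw [sub_sub_sub_cancel_right, ← mul_sub, abs_mul, abs_of_nonneg hn]
  gcongr

/-- Multiply `g` by distance cut-offs. Their slope `n` acts only where the distance to the
complement is at most `2 / n`, and there `|g| ≤ 2L / n`, so the products stay uniformly Lipschitz
and dominated convergence applies. -/
theorem setIntegral_eq_zero_of_lipschitz {Ω : Set R3} (hΩ : IsOpen Ω)
    (hb : Bornology.IsBounded Ω)
    {a : R3 → ℂ} {b : Fin 3 → R3 → ℂ} (ha : MemLp a 2 (volume.restrict Ω))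
    (hbL : ∀ j, MemLp (b j) 2 (volume.restrict Ω))
    (h : ∀ φ, IsTest Ω φ → ∫ x in Ω, (a x * φ x + ∑ j, b j x * pd j φ x) = 0)
    {u g : R3 → ℂ} {D : Fin 3 → R3 → ℂ} (hu : HasWeakGrad u D) {L : ℝ≥0}
    (hg : LipschitzWith L g) (hgΩ : ∀ x, x ∉ Ω → g x = 0) :
    ∫ x in Ω, (a x * (g x * u x) + ∑ j, b j x * (pd j g x * u x + g x * D j x)) = 0 := by
  have hne : (Ωᶜ).Nonempty := by
    by_contra hcon
    rw [Set.not_nonempty_iff_eq_empty, Set.compl_empty_iff] at hcon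
    exact NormedSpace.unbounded_univ ℝ R3 (hcon ▸ hb)
  have hm := hΩ.measurableSet
  set G : ℕ → R3 → ℂ := fun n x => (distCutoff Ω (n + 1) x : ℂ) * g x with hG
  have hgd := norm_le_mul_infDist hΩ hne hg hgΩ
  have hGlip : ∀ n, LipschitzWith (3 * L) (G n) := by
    intro n
    have hn : (0 : ℝ) < n + 1 := by positivity
    -- Only one of the two points needs to be near the complement: it carries the slope of the
    -- cut-off, at cost `2L`, and the other term of the product rule costs `L`. This is the source
    -- of the constant `3 * L`.
    have half : ∀ x y, (n + 1 : ℝ) * Metric.infDist y Ωᶜ ≤ 2 →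
        dist (G n x) (G n y) ≤ 3 * L * dist x y := by
      intro x y hy
      have e : G n x - G n y = (distCutoff Ω (n + 1) x : ℂ) * (g x - g y)
          + ((distCutoff Ω (n + 1) x - distCutoff Ω (n + 1) y : ℝ) : ℂ) * g y := by
        simp only [hG]; push_cast; ring
      rw [dist_eq_norm, e]
      refine (norm_add_le _ _).trans ?_
      rw [norm_mul, norm_mul, Complex.norm_real, Complex.norm_real, Real.norm_eq_abs,
        Real.norm_eq_abs, abs_of_nonneg (distCutoff_nonneg _ _ _)]
      have h1 : distCutoff Ω (n + 1) x * ‖g x - g y‖ ≤ 1 * (L * dist x y) :=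
        mul_le_mul (distCutoff_le_one _ _ _) (by simpa [dist_eq_norm] using hg.dist_le_mul x y)
          (norm_nonneg _) zero_le_one
      have h2 : |distCutoff Ω (n + 1) x - distCutoff Ω (n + 1) y| * ‖g y‖
          ≤ ((n + 1) * dist x y) * (L * Metric.infDist y Ωᶜ) :=
        mul_le_mul (abs_distCutoff_sub_le hn.le x y) (hgd y) (norm_nonneg _) (by positivity)
      have h3 : ((n + 1 : ℝ) * dist x y) * (L * Metric.infDist y Ωᶜ)
          ≤ 2 * (L * dist x y) := by
        calc ((n + 1 : ℝ) * dist x y) * (L * Metric.infDist y Ωᶜ)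
            = ((n + 1) * Metric.infDist y Ωᶜ) * (L * dist x y) := by ring
          _ ≤ 2 * (L * dist x y) := by gcongr
      linarith
    refine LipschitzWith.of_dist_le_mul fun x y => ?_
    simp only [NNReal.coe_mul, NNReal.coe_ofNat]
    by_cases hy : (n + 1 : ℝ) * Metric.infDist y Ωᶜ ≤ 2
    · exact half x y hy
    by_cases hx : (n + 1 : ℝ) * Metric.infDist x Ωᶜ ≤ 2
    · rw [dist_comm, dist_comm x y]
      exact half y x hx
    · simp only [hG, distCutoff_eq_one (not_le.1 hy).le, distCutoff_eq_one (not_le.1 hx).le]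
      refine (by simpa using hg.dist_le_mul x y : _ ≤ (L : ℝ) * dist x y).trans ?_
      have : 0 ≤ (L : ℝ) * dist x y := by positivity
      linarith
  have hzero : ∀ n, ∫ x in Ω, (a x * (G n x * u x)
      + ∑ j, b j x * (pd j (G n) x * u x + G n x * D j x)) = 0 := by
    intro n
    have hcl : IsClosed {x : R3 | 1 ≤ ((n : ℝ) + 1) * Metric.infDist x Ωᶜ} :=
      isClosed_le continuous_const (continuous_const.mul (Metric.continuous_infDist_pt _))
    have hsub : {x : R3 | 1 ≤ ((n : ℝ) + 1) * Metric.infDist x Ωᶜ} ⊆ Ω := by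
      intro x hx
      by_contra hxΩ
      have : Metric.infDist x Ωᶜ = 0 := Metric.infDist_zero_of_mem hxΩ
      simp only [Set.mem_ofPred_eq, this, mul_zero] at hx
      linarith
    refine setIntegral_eq_zero_of_compact hΩ hb ha hbL h hu (hGlip n)
      (Metric.isCompact_of_isClosed_isBounded hcl (hb.subset hsub)) hsub fun x hx => ?_
    simp only [Set.mem_ofPred_eq, not_le] at hx
    simp [hG, distCutoff_eq_zero hx.le]
  -- Equality on a neighbourhood, not just at `x`, is needed so that the derivatives agree as well.
  have hev : ∀ x ∈ Ω, ∀ᶠ n in Filter.atTop, G n =ᶠ[nhds x] g := by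
    intro x hx
    have hd : 0 < Metric.infDist x Ωᶜ :=
      (hΩ.isClosed_compl.notMem_iff_infDist_pos hne).1 (by simpa using hx)
    obtain ⟨N, hN⟩ := exists_nat_gt (2 / Metric.infDist x Ωᶜ)
    filter_upwards [Filter.eventually_ge_atTop N] with n hn
    have hlt : 2 < ((n : ℝ) + 1) * Metric.infDist x Ωᶜ := by
      rw [div_lt_iff₀ hd] at hN
      have : (N : ℝ) ≤ n := by exact_mod_cast hn
      nlinarith
    have := (continuous_const.mul (Metric.continuous_infDist_pt Ωᶜ)).continuousAt.eventually
      (lt_mem_nhds hlt)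
    filter_upwards [this] with y hy
    simp [hG, distCutoff_eq_one (le_of_lt hy)]
  obtain ⟨C, hC⟩ := hg.continuous.locBdd.bdd _ hb.isCompact_closure
  have hGC : ∀ n, ∀ x ∈ Ω, ‖G n x‖ ≤ C := by
    intro n x hx
    rw [hG, norm_mul, Complex.norm_real, Real.norm_eq_abs, abs_of_nonneg (distCutoff_nonneg _ _ _)]
    exact (mul_le_of_le_one_left (norm_nonneg _) (distCutoff_le_one _ _ _)).trans
      (hC x (subset_closure hx))
  have huL := hu.memL2.memLp_restrict hb
  have hDL := fun j => (hu.memL2_grad j).memLp_restrict hb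
  have hlim := tendsto_integral_of_dominated_convergence (μ := volume.restrict Ω)
    (F := fun n x => a x * (G n x * u x) + ∑ j, b j x * (pd j (G n) x * u x + G n x * D j x))
    (f := fun x => a x * (g x * u x) + ∑ j, b j x * (pd j g x * u x + g x * D j x))
    (fun x => C * (‖a x‖ * ‖u x‖)
      + ∑ j, (((3 * L : ℝ≥0) : ℝ) * (‖b j x‖ * ‖u x‖) + C * (‖b j x‖ * ‖D j x‖)))
    (fun n => by
      have m1 := (hGlip n).continuous.aestronglyMeasurable (μ := volume.restrict Ω)
      have m2 := fun j => (measurable_pd j (G n)).aestronglyMeasurable (μ := volume.restrict Ω)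
      refine (ha.1.mul (m1.mul huL.1)).add ?_
      have := Finset.aestronglyMeasurable_fun_sum (μ := volume.restrict Ω)
        (f := fun j x => b j x * (pd j (G n) x * u x + G n x * D j x)) Finset.univ
        fun j _ => (hbL j).1.mul (((m2 j).mul huL.1).add (m1.mul (hDL j).1))
      exact this)
    (by
      refine Integrable.add ((ha.norm.integrable_mul huL.norm).const_mul C)
        (integrable_finsetSum _ fun j _ => ?_)
      exact (((hbL j).norm.integrable_mul huL.norm).const_mul _).add
        (((hbL j).norm.integrable_mul (hDL j).norm).const_mul C))
    (fun n => by
      filter_upwards [ae_restrict_mem hm] with x hx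
      have c1 := hGC n x hx
      refine (norm_add_le _ _).trans (add_le_add ?_ ((norm_sum_le _ _).trans
        (Finset.sum_le_sum fun j _ => ?_)))
      · rw [norm_mul, norm_mul]
        calc ‖a x‖ * (‖G n x‖ * ‖u x‖) ≤ ‖a x‖ * (C * ‖u x‖) := by gcongr
          _ = _ := by ring
      · have c2 := norm_pd_le (hGlip n) j x
        rw [norm_mul]
        calc ‖b j x‖ * ‖pd j (G n) x * u x + G n x * D j x‖
            ≤ ‖b j x‖ * (‖pd j (G n) x‖ * ‖u x‖ + ‖G n x‖ * ‖D j x‖) := by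
              gcongr
              exact (norm_add_le _ _).trans (by rw [norm_mul, norm_mul])
          _ ≤ ‖b j x‖ * (((3 * L : ℝ≥0) : ℝ) * ‖u x‖ + C * ‖D j x‖) := by gcongr
          _ = _ := by ring)
    (by
      filter_upwards [ae_restrict_mem hm] with x hx
      refine tendsto_const_nhds.congr' ?_
      filter_upwards [hev x hx] with n hn
      simp only [pd, hn.eq_of_nhds, hn.fderiv_eq])
  simp_rw [hzero] at hlim
  exact (tendsto_nhds_unique hlim tendsto_const_nhds)

/-! ### Pointwise algebra -/

/-- `P(i∇) w + κ w - (i/2) Bᵀ w`, which is `𝒫' w`. -/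
noncomputable def firstOrder (κ : ℂ) (α β : Fin 3 → ℂ) (w : Fin 8 → ℂ) (Dw : Fin 8 → Fin 3 → ℂ) :
    Fin 8 → ℂ :=
  applyP Dw + κ • w - (Complex.I / 2) • ((blockMat α β)ᵀ *ᵥ w)

/-- The constant `k` cancels between `k w` and `Vᵀ w`, leaving only `κ`. -/
theorem opP'_eq_firstOrder (ω μo εo : ℝ) (μ ε σ : R3 → ℝ) (w : Fin 8 → R3 → ℂ) (x : R3) :
    opP' ω μo εo μ ε σ w x = firstOrder (kappa ω μ ε σ x) (alphaVec ω ε σ x) (betaVec μ x)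
      (fun l => w l x) (fun l j => weakPd j (w l) x) := by
  simp only [opP', firstOrder, matV, Matrix.transpose_add, Matrix.transpose_smul,
    Matrix.transpose_one, Matrix.add_mulVec, Matrix.smul_mulVec, Matrix.one_mulVec]
  rw [sub_smul]
  abel

theorem firstOrder_eq (κ : ℂ) (α β : Fin 3 → ℂ) (w : Fin 8 → ℂ) (D : Fin 8 → Fin 3 → ℂ) :
    firstOrder κ α β w D =
    ![Complex.I * (D 1 0 + D 2 1 + D 3 2) + κ * w 0
        - Complex.I / 2 * (β 0 * w 1 + β 1 * w 2 + β 2 * w 3),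
      Complex.I * (D 0 0 + (D 6 1 - D 5 2)) + κ * w 1
        - Complex.I / 2 * (α 0 * w 0 - (α 1 * w 6 - α 2 * w 5)),
      Complex.I * (D 0 1 + (D 4 2 - D 6 0)) + κ * w 2
        - Complex.I / 2 * (α 1 * w 0 - (α 2 * w 4 - α 0 * w 6)),
      Complex.I * (D 0 2 + (D 5 0 - D 4 1)) + κ * w 3
        - Complex.I / 2 * (α 2 * w 0 - (α 0 * w 5 - α 1 * w 4)),
      Complex.I * (D 7 0 - (D 3 1 - D 2 2)) + κ * w 4
        - Complex.I / 2 * (β 0 * w 7 + (β 1 * w 3 - β 2 * w 2)),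
      Complex.I * (D 7 1 - (D 1 2 - D 3 0)) + κ * w 5
        - Complex.I / 2 * (β 1 * w 7 + (β 2 * w 1 - β 0 * w 3)),
      Complex.I * (D 7 2 - (D 2 0 - D 1 1)) + κ * w 6
        - Complex.I / 2 * (β 2 * w 7 + (β 0 * w 2 - β 1 * w 1)),
      Complex.I * (D 4 0 + D 5 1 + D 6 2) + κ * w 7
        - Complex.I / 2 * (α 0 * w 4 + α 1 * w 5 + α 2 * w 6)] := by
  ext l
  rw [firstOrder, Pi.sub_apply, Pi.add_apply, Pi.smul_apply, Pi.smul_apply]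
  fin_cases l <;>
    simp [ applyP, symbolP, blockMat, Matrix.mulVec, dotProduct, Fin.sum_univ_succ,
      Matrix.transpose_apply, Pi.single_apply] <;> ring

/-- The density of `⟨Q w, φ⟩` in terms of the values of the coefficients. -/
noncomputable def potentialForm (κ θ : ℂ) (α β : Fin 3 → ℂ) (w : Fin 8 → ℂ) (Dw : Fin 8 → Fin 3 → ℂ)
    (φ : Fin 8 → ℂ) (Dφ : Fin 8 → Fin 3 → ℂ) : ℂ :=
  let d : Fin 8 → Fin 8 → Fin 3 → ℂ := fun l m j => Dw l j * φ m + w l * Dφ m j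
  (1 / 4) * (α ⬝ᵥ α - 4 * θ) * (w 0 * φ 0 + ∑ m, w (b3 m) * φ (b3 m))
    - (1 / 2) * ∑ j, α j * (d 0 0 j - ∑ m, d (b3 m) (b3 m) j
        + ∑ m, (d (b3 m) (b3 j) m + d (b3 j) (b3 m) m))
    + (1 / 4) * (β ⬝ᵥ β - 4 * θ) * (w 7 * φ 7 + ∑ m, w (b2 m) * φ (b2 m))
    - (1 / 2) * ∑ j, β j * (d 7 7 j - ∑ m, d (b2 m) (b2 m) j
        + ∑ m, (d (b2 m) (b2 j) m + d (b2 j) (b2 m) m))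
    - 2 * Complex.I * κ * ∑ j, (d 0 (b2 j) j + d (b2 j) 0 j + d (b3 j) 7 j + d 7 (b3 j) j)

/-- `∂_j w_a ∂_k φ_b - ∂_k w_a ∂_j φ_b`. -/
def nullTerm (Dw Dφ : Fin 8 → Fin 3 → ℂ) (a b : Fin 8) (j k : Fin 3) : ℂ :=
  Dw a j * Dφ b k - Dw a k * Dφ b j

/-- `∂_j (κ w_a φ_b)`. -/
def divTerm (κ : ℂ) (dκ : Fin 3 → ℂ) (w : Fin 8 → ℂ) (Dw : Fin 8 → Fin 3 → ℂ)
    (φ : Fin 8 → ℂ) (Dφ : Fin 8 → Fin 3 → ℂ) (a b : Fin 8) (j : Fin 3) : ℂ :=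
  dκ j * (w a * φ b) + κ * (Dw a j * φ b + w a * Dφ b j)

/-- `α_j ∂_k (w_a φ_b) - α_k ∂_j (w_a φ_b)`. -/
def curlTerm (α : Fin 3 → ℂ) (w : Fin 8 → ℂ) (Dw : Fin 8 → Fin 3 → ℂ)
    (φ : Fin 8 → ℂ) (Dφ : Fin 8 → Fin 3 → ℂ) (a b : Fin 8) (j k : Fin 3) : ℂ :=
  α j * (Dw a k * φ b + w a * Dφ b k) - α k * (Dw a j * φ b + w a * Dφ b j)

/-- The null Lagrangian that distinguishes `P(∇) w · P(∇) φ` from `∇ w · ∇ φ`. -/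
def nullPart (Dw Dφ : Fin 8 → Fin 3 → ℂ) : ℂ :=
  let n := nullTerm Dw Dφ
  n 1 2 0 1 + n 2 1 1 0 + (n 1 3 0 2 + n 3 1 2 0) + (n 2 3 1 2 + n 3 2 2 1)
    + (n 4 5 0 1 + n 5 4 1 0 + (n 4 6 0 2 + n 6 4 2 0) + (n 5 6 1 2 + n 6 5 2 1))
    + (n 0 6 0 1 + n 0 4 1 2 + n 0 5 2 0) + (n 6 0 1 0 + n 4 0 2 1 + n 5 0 0 2)
    - (n 7 3 0 1 + n 7 1 1 2 + n 7 2 2 0) - (n 3 7 1 0 + n 1 7 2 1 + n 2 7 0 2)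

/-- The divergence terms by which the densities of `𝒫' w · 𝒫' φ` and `Q` differ. -/
noncomputable def divPart (κ : ℂ) (dκ α β : Fin 3 → ℂ) (w : Fin 8 → ℂ) (Dw : Fin 8 → Fin 3 → ℂ)
    (φ : Fin 8 → ℂ) (Dφ : Fin 8 → Fin 3 → ℂ) : ℂ :=
  let v := divTerm κ dκ w Dw φ Dφ
  let c := curlTerm α w Dw φ Dφ
  let e := curlTerm β w Dw φ Dφ
  Complex.I * ((v 5 3 0 - v 6 2 0 - v 2 6 0 + v 3 5 0) + (v 6 1 1 - v 4 3 1 - v 3 4 1 + v 1 6 1)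
      + (v 4 2 2 - v 5 1 2 - v 1 5 2 + v 2 4 2))
    - Complex.I * ((v 0 1 0 + v 1 0 0 + v 4 7 0 + v 7 4 0) + (v 0 2 1 + v 2 0 1 + v 5 7 1 + v 7 5 1)
      + (v 0 3 2 + v 3 0 2 + v 6 7 2 + v 7 6 2))
    + (1 / 2) * ((c 0 6 0 1 + c 0 4 1 2 + c 0 5 2 0) + (c 6 0 0 1 + c 4 0 1 2 + c 5 0 2 0))
    - (1 / 2) * ((e 7 3 0 1 + e 7 1 1 2 + e 7 2 2 0) + (e 3 7 0 1 + e 1 7 1 2 + e 2 7 2 0))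

-- The symbol is symmetric with `P(ξ)² = |ξ|² I`, so `∇w·∇φ` and `-P(i∇)w · P(i∇)φ` differ by a null
-- Lagrangian. The cross terms of derivatives with `κ, α, β` match the first order part of `Q` once
-- complete divergences are added. `κ² = θ + k²` settles the zeroth order terms in `θ`, and `∇κ =
-- κ(α + β)/2` those in which `κ` multiplies `α` or `β`.
set_option maxRecDepth 10000 in
set_option maxHeartbeats 1600000 in
theorem factorization {κ θ k : ℂ} {α β dκ : Fin 3 → ℂ} (hκ : κ ^ 2 = θ + k ^ 2)
    (hdκ : ∀ j, dκ j = κ * (α j + β j) / 2)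
    (w : Fin 8 → ℂ) (Dw : Fin 8 → Fin 3 → ℂ) (φ : Fin 8 → ℂ) (Dφ : Fin 8 → Fin 3 → ℂ) :
    (∑ l, ∑ j, Dw l j * Dφ l j) - k ^ 2 * (∑ l, w l * φ l) + potentialForm κ θ α β w Dw φ Dφ
      = - (∑ l, firstOrder κ α β w Dw l * firstOrder κ α β φ Dφ l)
        + (divPart κ dκ α β w Dw φ Dφ - nullPart Dw Dφ) := by
  have hI : Complex.I ^ 2 = -1 := Complex.I_sq
  rw [firstOrder_eq, firstOrder_eq]
  simp only [Fin.sum_univ_eight, Fin.sum_univ_three, potentialForm, b2, b3, divPart, nullPart,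
    nullTerm, divTerm, curlTerm, dotProduct, hdκ]
  simp only [Matrix.cons_val]
  have hθ : θ = κ ^ 2 - k ^ 2 := by rw [hκ]; ring
  subst hθ
  ring_nf
  rw [hI]
  ring

/-! ### The electromagnetic parameters -/

/-- Lipschitz functions that agree on a set have the same derivatives almost everywhere on it. -/
theorem ae_pd_eq_of_eqOn {f g : R3 → ℂ} {K K' : ℝ≥0} (hf : LipschitzWith K f)
    (hg : LipschitzWith K' g) {S : Set R3} (hS : MeasurableSet S) (h : ∀ x ∈ S, f x = g x) :
    ∀ᵐ x, x ∈ S → ∀ j, pd j f x = pd j g x := by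
  -- An injective real-linear map of `ℂ` into `ℝ³`, because the measure theoretic result used below
  -- concerns maps from a space to itself.
  let A : ℂ →L[ℝ] R3 := (Complex.reCLM.smulRight (EuclideanSpace.single 0 1 : R3))
    + (Complex.imCLM.smulRight (EuclideanSpace.single 1 1 : R3))
  have hA : ∀ z, A z = 0 → z = 0 := by
    intro z hz
    have h0 := congrArg (fun v : R3 => v 0) hz
    have h1 := congrArg (fun v : R3 => v 1) hz
    simp [A] at h0 h1
    exact Complex.ext h0 h1
  let F : R3 → R3 := fun x => A (f x - g x)
  have df := hf.ae_differentiableAt (μ := volume)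
  have dg := hg.ae_differentiableAt (μ := volume)
  let T : Set R3 := S ∩ {x | DifferentiableAt ℝ f x} ∩ {x | DifferentiableAt ℝ g x}
  have hT : MeasurableSet T :=
    (hS.inter (measurableSet_of_differentiableAt ℝ f)).inter (measurableSet_of_differentiableAt ℝ g)
  have hF : ∀ x ∈ T, HasFDerivWithinAt F (A.comp (fderiv ℝ f x - fderiv ℝ g x)) T x := by
    rintro x ⟨⟨-, h1⟩, h2⟩
    exact (A.hasFDerivAt.comp x
      ((DifferentiableAt.hasFDerivAt h1).sub (DifferentiableAt.hasFDerivAt h2))).hasFDerivWithinAt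
  -- On `T` the map `F` is identically zero, so it is approximated by the zero map with constant
  -- `0`. Hence its derivative vanishes a.e. on `T`.
  have happ : ApproximatesLinearOn F (0 : R3 →L[ℝ] R3) T 0 := by
    intro x hx y hy
    simp [F, h x hx.1.1, h y hy.1.1]
  have key := happ.norm_fderiv_sub_le volume hT _ hF
  rw [ae_restrict_iff' hT] at key
  filter_upwards [df, dg, key] with x h1 h2 h3 hx j
  have h4 := h3 ⟨⟨hx, h1⟩, h2⟩
  simp only [sub_zero, nonpos_iff_eq_zero, nnnorm_eq_zero] at h4
  have := hA _ (DFunLike.congr_fun h4 (EuclideanSpace.single j 1))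
  simpa [sub_eq_zero, pd] using this

theorem exists_bounds_of_eq_const {f : R3 → ℝ} (hf : Continuous f) (hpos : ∀ x, 0 < f x) {c : R3}
    {R a : ℝ} (h : ∀ x, x ∉ Metric.ball c R → f x = a) :
    ∃ m M : ℝ, 0 < m ∧ ∀ x, m ≤ f x ∧ f x ≤ M := by
  -- Adjoining one point outside the ball makes the exterior value `a` one of the values attained on
  -- the compact set; `|R|` covers negative radii.
  have hK : IsCompact (insert (c + EuclideanSpace.single 0 |R|) (Metric.closedBall c R)) :=
    (isCompact_closedBall c R).insert _
  obtain ⟨p, -, hp⟩ := hK.exists_isMinOn ⟨_, Set.mem_insert _ _⟩ hf.continuousOn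
  obtain ⟨q, -, hq⟩ := hK.exists_isMaxOn ⟨_, Set.mem_insert _ _⟩ hf.continuousOn
  have hout : f (c + EuclideanSpace.single 0 |R|) = a := by
    apply h
    simp [le_abs_self]
  refine ⟨f p, f q, hpos p, fun x => ?_⟩
  by_cases hx : x ∈ Metric.closedBall c R
  · exact ⟨hp (Set.mem_insert_of_mem _ hx), hq (Set.mem_insert_of_mem _ hx)⟩
  · rw [h x fun h' => hx (Metric.ball_subset_closedBall h'), ← hout]
    exact ⟨hp (Set.mem_insert _ _), hq (Set.mem_insert _ _)⟩

theorem exists_norm_le_of_eq_const {f : R3 → ℂ} (hf : Continuous f) {c : R3}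
    {R : ℝ} {a : ℂ} (h : ∀ x, x ∉ Metric.ball c R → f x = a) : ∃ M : ℝ, ∀ x, ‖f x‖ ≤ M := by
  obtain ⟨C, hC⟩ := (isCompact_closedBall c R).exists_bound_of_continuousOn hf.continuousOn
  refine ⟨max C ‖a‖, fun x => ?_⟩
  by_cases hx : x ∈ Metric.closedBall c R
  · exact (hC x hx).trans (le_max_left _ _)
  · rw [h x fun h' => hx (Metric.ball_subset_closedBall h')]
    exact le_max_right _ _

/-- The half-plane `Re z ≥ m` is convex, avoids the branch cut, and has `|1 / z| ≤ 1 / m`. -/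
theorem _root_.LipschitzWith.complex_log {f : R3 → ℂ} {K : ℝ≥0} (hf : LipschitzWith K f) {m : ℝ}
    (hm : 0 < m) (h : ∀ x, m ≤ (f x).re) : ∃ K', LipschitzWith K' fun x => Complex.log (f x) := by
  have hl : LipschitzOnWith (Real.toNNReal m⁻¹) Complex.log {z : ℂ | m ≤ z.re} := by
    refine (convex_halfSpace_re_ge m).lipschitzOnWith_of_nnnorm_hasDerivWithin_le
      (f' := fun z => z⁻¹) (fun z hz => ?_) fun z hz => ?_
    · have hz : m ≤ z.re := hz
      exact (Complex.hasDerivAt_log (Or.inl (hm.trans_le hz))).hasDerivWithinAt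
    · have hz : m ≤ z.re := hz
      rw [← NNReal.coe_le_coe, Real.coe_toNNReal _ (by positivity), coe_nnnorm, norm_inv]
      exact inv_anti₀ hm (hz.trans (Complex.re_le_norm z))
  refine ⟨_, lipschitzOnWith_univ.1 (hl.comp (hf.lipschitzOnWith (s := Set.univ)) fun x _ => h x)⟩

theorem _root_.LipschitzWith.complex_exp {f : R3 → ℂ} {K : ℝ≥0} (hf : LipschitzWith K f) {M : ℝ}
    (h : ∀ x, ‖f x‖ ≤ M) : ∃ K', LipschitzWith K' fun x => Complex.exp (f x) := by
  have hl : LipschitzOnWith (Real.toNNReal (Real.exp M)) Complex.exp (Metric.closedBall 0 M) := by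
    refine (convex_closedBall (0 : ℂ) M).lipschitzOnWith_of_nnnorm_hasDerivWithin_le
      (f' := Complex.exp) (fun z hz => (Complex.hasDerivAt_exp z).hasDerivWithinAt) fun z hz => ?_
    rw [← NNReal.coe_le_coe, Real.coe_toNNReal _ (by positivity), coe_nnnorm, Complex.norm_exp]
    exact Real.exp_le_exp.2 ((Complex.re_le_norm z).trans (by simpa using hz))
  exact ⟨_, lipschitzOnWith_univ.1 (hl.comp (hf.lipschitzOnWith (s := Set.univ)) fun x _ => by
    simpa using h x)⟩

/-- Bounded and Lipschitz. -/
structure BddLip (f : R3 → ℂ) : Prop where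
  lip : ∃ K, LipschitzWith K f
  bdd : ∃ M : ℝ, ∀ x, ‖f x‖ ≤ M

theorem BddLip.continuous {f : R3 → ℂ} (hf : BddLip f) : Continuous f :=
  hf.lip.choose_spec.continuous

theorem BddLip.ae_differentiableAt {f : R3 → ℂ} (hf : BddLip f) :
    ∀ᵐ x, DifferentiableAt ℝ f x := hf.lip.choose_spec.ae_differentiableAt

theorem BddLip.exp {f : R3 → ℂ} (hf : BddLip f) : BddLip fun x => Complex.exp (f x) := by
  obtain ⟨K, hK⟩ := hf.lip
  obtain ⟨M, hM⟩ := hf.bdd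
  exact ⟨hK.complex_exp hM, Real.exp M, fun x => by
    rw [Complex.norm_exp]
    exact Real.exp_le_exp.2 ((Complex.re_le_norm _).trans (hM x))⟩

theorem BddLip.const_mul {f : R3 → ℂ} (hf : BddLip f) (s : ℂ) : BddLip fun x => s * f x := by
  obtain ⟨K, hK⟩ := hf.lip
  obtain ⟨M, hM⟩ := hf.bdd
  refine ⟨⟨‖s‖₊ * K, ?_⟩, ‖s‖ * M, fun x => by rw [norm_mul]; gcongr; exact hM x⟩
  exact (lipschitzWith_smul s).comp hK

theorem BddLip.add {f g : R3 → ℂ} (hf : BddLip f) (hg : BddLip g) :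
    BddLip fun x => f x + g x := by
  obtain ⟨K, hK⟩ := hf.lip
  obtain ⟨M, hM⟩ := hf.bdd
  obtain ⟨K', hK'⟩ := hg.lip
  obtain ⟨M', hM'⟩ := hg.bdd
  exact ⟨⟨_, hK.add hK'⟩, _, fun x => (norm_add_le _ _).trans (add_le_add (hM x) (hM' x))⟩

theorem pd_exp_add {f g : R3 → ℂ} {x : R3} (hf : DifferentiableAt ℝ f x)
    (hg : DifferentiableAt ℝ g x) (s t : ℂ) (j : Fin 3) :
    pd j (fun y => Complex.exp (s * f y + t * g y)) x
      = (s * pd j f x + t * pd j g x) * Complex.exp (s * f x + t * g x) := by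
  have := ((hf.hasFDerivAt.const_mul s).add (hg.hasFDerivAt.const_mul t)).cexp.fderiv
  simp only [Pi.add_apply] at this
  unfold pd
  erw [this]
  simp
  ring

/-- `log γ`. -/
noncomputable def logGam (ω : ℝ) (ε σ : R3 → ℝ) (x : R3) : ℂ := Complex.log (gam ω ε σ x)

/-- `log μ`. -/
noncomputable def logMu (μ : R3 → ℝ) (x : R3) : ℂ := ((Real.log (μ x) : ℝ) : ℂ)

theorem _root_.LipschitzWith.ofReal {f : R3 → ℝ} {K : ℝ≥0} (hf : LipschitzWith K f) :
    LipschitzWith K fun x => (f x : ℂ) :=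
  LipschitzWith.of_dist_le_mul fun x y => by
    simpa [Complex.dist_eq, ← Complex.ofReal_sub, Real.dist_eq] using hf.dist_le_mul x y

section Admissible

variable {Ω : Set R3} {c : R3} {R μo εo : ℝ} {μ ε σ : R3 → ℝ}

theorem gam_re (ω : ℝ) (ε σ : R3 → ℝ) (x : R3) : (gam ω ε σ x).re = ε x := by
  simp [gam, Complex.div_re, Complex.mul_re]

theorem IsAdmissible.gam_ne_zero (h : IsAdmissible Ω (Metric.ball c R) μo εo μ ε σ) (ω : ℝ)
    (x : R3) : gam ω ε σ x ≠ 0 := fun h0 => by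
  have := gam_re ω ε σ x
  rw [h0] at this
  exact (h.eps_pos x).ne this

theorem IsAdmissible.exp_logGam (h : IsAdmissible Ω (Metric.ball c R) μo εo μ ε σ) (ω : ℝ)
    (x : R3) : Complex.exp (logGam ω ε σ x) = gam ω ε σ x := Complex.exp_log (h.gam_ne_zero ω x)

theorem IsAdmissible.exp_logMu (h : IsAdmissible Ω (Metric.ball c R) μo εo μ ε σ)
    (x : R3) : Complex.exp (logMu μ x) = μ x := by
  rw [logMu, ← Complex.ofReal_exp, Real.exp_log (h.mu_pos x)]

theorem IsAdmissible.bddLip_logMu (h : IsAdmissible Ω (Metric.ball c R) μo εo μ ε σ) :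
    BddLip (logMu μ) := by
  obtain ⟨K, hK⟩ := h.lipschitz_mu
  obtain ⟨m, M, hm, hmM⟩ := exists_bounds_of_eq_const hK.continuous h.mu_pos h.mu_const
  have hL : ∃ K, LipschitzWith K (logMu μ) := by
    obtain ⟨K', hK'⟩ := hK.ofReal.complex_log hm fun x => by simpa using (hmM x).1
    refine ⟨K', ?_⟩
    have : logMu μ = fun x => Complex.log (μ x : ℂ) :=
      funext fun x => Complex.ofReal_log (h.mu_pos x).le
    rwa [this]
  exact ⟨hL, exists_norm_le_of_eq_const hL.choose_spec.continuous (c := c) (R := R)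
    (a := ((Real.log μo : ℝ) : ℂ)) fun x hx => by rw [logMu, h.mu_const x hx]⟩

theorem IsAdmissible.lipschitz_gam (h : IsAdmissible Ω (Metric.ball c R) μo εo μ ε σ) (ω : ℝ) :
    ∃ K, LipschitzWith K (gam ω ε σ) := by
  obtain ⟨K, hK⟩ := h.lipschitz_eps
  obtain ⟨K', hK'⟩ := h.lipschitz_sigma
  have e : gam ω ε σ = fun x => (ε x : ℂ) + (Complex.I / (ω : ℂ)) • (σ x : ℂ) := by
    funext x
    rw [gam, smul_eq_mul, mul_div_right_comm]
  rw [e]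
  exact ⟨_, hK.ofReal.add ((lipschitzWith_smul (Complex.I / (ω : ℂ))).comp hK'.ofReal)⟩

theorem IsAdmissible.bddLip_logGam (h : IsAdmissible Ω (Metric.ball c R) μo εo μ ε σ) (ω : ℝ) :
    BddLip (logGam ω ε σ) := by
  obtain ⟨K, hK⟩ := h.lipschitz_gam ω
  obtain ⟨K', hK'⟩ := h.lipschitz_eps
  obtain ⟨m, M, hm, hmM⟩ := exists_bounds_of_eq_const hK'.continuous h.eps_pos h.eps_const
  have hL : ∃ K, LipschitzWith K (logGam ω ε σ) :=
    hK.complex_log hm fun x => by simpa [gam_re] using (hmM x).1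
  exact ⟨hL, exists_norm_le_of_eq_const hL.choose_spec.continuous (c := c) (R := R)
    (a := Complex.log εo) fun x hx => by
      simp [logGam, gam, h.eps_const x hx, h.sigma_zero x hx]⟩

/-- Since `μ` is real and positive, `log (μ γ) = log μ + log γ` on principal branches. The
exponential form gives regularity and derivatives of `κ` from those of the logarithms. -/
theorem IsAdmissible.kappa_eq (h : IsAdmissible Ω (Metric.ball c R) μo εo μ ε σ) (ω : ℝ) (x : R3) :
    kappa ω μ ε σ x
      = ω * Complex.exp ((1 / 2) * logGam ω ε σ x + (1 / 2) * logMu μ x) := by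
  have hg := h.gam_ne_zero ω x
  have hμ : (μ x : ℂ) ≠ 0 := by exact_mod_cast (h.mu_pos x).ne'
  rw [kappa, Complex.cpow_def_of_ne_zero (mul_ne_zero hμ hg), Complex.log_ofReal_mul (h.mu_pos x) hg,
    logGam, logMu]
  congr 2
  ring

theorem IsAdmissible.kappa_sq (h : IsAdmissible Ω (Metric.ball c R) μo εo μ ε σ) (ω : ℝ)
    (hμo : 0 < μo) (hεo : 0 < εo) (x : R3) :
    kappa ω μ ε σ x ^ 2 = theta ω μo εo μ ε σ x + (wavenumber ω μo εo : ℂ) ^ 2 := by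
  have hk : (wavenumber ω μo εo : ℂ) ^ 2 = (ω : ℂ) ^ 2 * ((εo : ℂ) * (μo : ℂ)) := by
    rw [wavenumber, ← Complex.ofReal_pow, mul_pow, Real.sq_sqrt (by positivity)]
    push_cast; ring
  rw [hk, h.kappa_eq, mul_pow, ← Complex.exp_nat_mul, theta, ← h.exp_logGam ω x, ← h.exp_logMu x]
  have : ((2 : ℕ) : ℂ) * (1 / 2 * logGam ω ε σ x + 1 / 2 * logMu μ x)
      = logGam ω ε σ x + logMu μ x := by push_cast; ring
  rw [this, Complex.exp_add]
  ring

theorem IsAdmissible.lipschitz_kappa (h : IsAdmissible Ω (Metric.ball c R) μo εo μ ε σ) (ω : ℝ) :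
    ∃ K, LipschitzWith K (kappa ω μ ε σ) := by
  rw [show kappa ω μ ε σ = _ from funext (h.kappa_eq ω)]
  exact ((((h.bddLip_logGam ω).const_mul _).add (h.bddLip_logMu.const_mul _)).exp.const_mul _).lip

theorem IsAdmissible.ae_pd_kappa (h : IsAdmissible Ω (Metric.ball c R) μo εo μ ε σ) (ω : ℝ) :
    ∀ᵐ x, ∀ j, pd j (kappa ω μ ε σ) x
      = kappa ω μ ε σ x * (alphaVec ω ε σ x j + betaVec μ x j) / 2 := by
  filter_upwards [(h.bddLip_logGam ω).ae_differentiableAt, h.bddLip_logMu.ae_differentiableAt]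
    with x h1 h2 j
  have e := pd_exp_add h1 h2 (1 / 2) (1 / 2) j
  have hd : DifferentiableAt ℝ
      (fun y => Complex.exp (1 / 2 * logGam ω ε σ y + 1 / 2 * logMu μ y)) x :=
    ((h1.const_mul _).add (h2.const_mul _)).cexp
  rw [show kappa ω μ ε σ = _ from funext (h.kappa_eq ω)]
  rw [DifferentiableAt.pd_mul (differentiableAt_const (ω : ℂ)) hd, e]
  have h0 : pd j (fun _ => (ω : ℂ)) x = 0 := by simp [pd]
  have ha : alphaVec ω ε σ x j = pd j (logGam ω ε σ) x := rfl
  have hb : betaVec μ x j = pd j (logMu μ) x := rfl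
  rw [h0, ha, hb]
  ring

end Admissible

/-! ### Vector functionals -/

/-- Extending the coefficients by zero off `Ω` reduces to the whole space. Since the tests need not
vanish near the boundary, functionals that encode boundary traces are covered. -/
theorem setIntegral_eq_zero_of_forall_test {Ω : Set R3} (hm : MeasurableSet Ω)
    (hb : Bornology.IsBounded Ω)
    {a : R3 → ℂ} {b : Fin 3 → R3 → ℂ} (ha : MemLp a 2 (volume.restrict Ω))
    (hbL : ∀ j, MemLp (b j) 2 (volume.restrict Ω))
    (h : ∀ φ, IsTest Set.univ φ → ∫ x in Ω, (a x * φ x + ∑ j, b j x * pd j φ x) = 0)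
    {u : R3 → ℂ} {D : Fin 3 → R3 → ℂ} (hu : HasWeakGrad u D) :
    ∫ x in Ω, (a x * u x + ∑ j, b j x * D j x) = 0 := by
  obtain ⟨R, hR⟩ := hb.subset_closedBall 0
  have e : ∀ (f : R3 → ℂ) (df : Fin 3 → R3 → ℂ),
      ∫ x in Ω, (a x * f x + ∑ j, b j x * df j x)
        = ∫ x, (Ω.indicator a x * f x + ∑ j, Ω.indicator (b j) x * df j x) := by
    intro f df
    rw [← integral_indicator hm]
    congr 1; ext x
    by_cases hx : x ∈ Ω <;> simp [hx]
  rw [e]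
  refine (integral_eq_zero_of_forall_test (R := R) ((memLp_indicator_iff_restrict hm).2 ha)
    (fun j => (memLp_indicator_iff_restrict hm).2 (hbL j))
    (fun x hx => Set.indicator_of_notMem (fun h' => hx (hR h')) _)
    (fun j x hx => Set.indicator_of_notMem (fun h' => hx (hR h')) _) (fun φ hφ => ?_) hu).2
  rw [← e]
  exact h φ hφ

theorem isTest_zero (U : Set R3) : IsTest U fun _ => 0 :=
  ⟨contDiff_const, HasCompactSupport.zero, by simp [tsupport, Function.support]⟩

theorem pd_zero (j : Fin 3) (x : R3) : pd j (fun _ => (0 : ℂ)) x = 0 := by simp [pd]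

theorem integrableOn_firstOrder {Ω : Set R3} {a : R3 → ℂ} {b : Fin 3 → R3 → ℂ}
    (ha : MemLp a 2 (volume.restrict Ω)) (hbL : ∀ j, MemLp (b j) 2 (volume.restrict Ω))
    {u : R3 → ℂ} {D : Fin 3 → R3 → ℂ} (hu : MemLp u 2 (volume.restrict Ω))
    (hD : ∀ j, MemLp (D j) 2 (volume.restrict Ω)) :
    IntegrableOn (fun x => a x * u x + ∑ j, b j x * D j x) Ω :=
  (MemLp.integrable_mul ha hu).add
    (integrable_finsetSum _ fun j _ => MemLp.integrable_mul (hbL j) (hD j))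

section Vector

variable {ι : Type*} [Fintype ι] {Ω : Set R3} {a : ι → R3 → ℂ} {b : ι → Fin 3 → R3 → ℂ}

theorem setIntegral_component_eq_zero [DecidableEq ι] {U : Set R3}
    (h : ∀ φ : ι → R3 → ℂ, (∀ l, IsTest U (φ l)) →
      ∫ x in Ω, ∑ l, (a l x * φ l x + ∑ j, b l j x * pd j (φ l) x) = 0)
    (l : ι) (φ : R3 → ℂ) (hφ : IsTest U φ) :
    ∫ x in Ω, (a l x * φ x + ∑ j, b l j x * pd j φ x) = 0 := by
  have := h (fun m => if m = l then φ else fun _ => 0) fun m => by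
    split_ifs
    · exact hφ
    · exact isTest_zero U
  rw [← this]
  congr 1; ext x
  rw [Finset.sum_eq_single l]
  · simp
  · intro m _ hm
    simp [hm, pd_zero]
  · simp

theorem setIntegral_sum_eq_zero_of_forall_test (hm : MeasurableSet Ω)
    (hb : Bornology.IsBounded Ω) (ha : ∀ l, MemLp (a l) 2 (volume.restrict Ω))
    (hbL : ∀ l j, MemLp (b l j) 2 (volume.restrict Ω))
    (h : ∀ φ : ι → R3 → ℂ, (∀ l, IsTest Set.univ (φ l)) →
      ∫ x in Ω, ∑ l, (a l x * φ l x + ∑ j, b l j x * pd j (φ l) x) = 0)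
    {u : ι → R3 → ℂ} {D : ι → Fin 3 → R3 → ℂ} (hu : ∀ l, HasWeakGrad (u l) (D l)) :
    ∫ x in Ω, ∑ l, (a l x * u l x + ∑ j, b l j x * D l j x) = 0 := by
  classical
  rw [integral_finsetSum _ fun l _ => integrableOn_firstOrder (ha l) (hbL l)
    ((hu l).memL2.memLp_restrict hb) fun j => ((hu l).memL2_grad j).memLp_restrict hb]
  exact Finset.sum_eq_zero fun l _ => setIntegral_eq_zero_of_forall_test hm hb (ha l) (hbL l)
    (setIntegral_component_eq_zero h l) (hu l)

theorem setIntegral_sum_eq_zero_of_lipschitz (hΩ : IsOpen Ω)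
    (hb : Bornology.IsBounded Ω) (ha : ∀ l, MemLp (a l) 2 (volume.restrict Ω))
    (hbL : ∀ l j, MemLp (b l j) 2 (volume.restrict Ω))
    (h : ∀ φ : ι → R3 → ℂ, (∀ l, IsTest Ω (φ l)) →
      ∫ x in Ω, ∑ l, (a l x * φ l x + ∑ j, b l j x * pd j (φ l) x) = 0)
    {u g : ι → R3 → ℂ} {D : ι → Fin 3 → R3 → ℂ} (hu : ∀ l, HasWeakGrad (u l) (D l))
    (hg : ∀ l, ∃ K, LipschitzWith K (g l)) (hgΩ : ∀ l x, x ∉ Ω → g l x = 0) :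
    ∫ x in Ω, ∑ l, (a l x * (g l x * u l x)
      + ∑ j, b l j x * (pd j (g l) x * u l x + g l x * D l j x)) = 0 := by
  classical
  have hgu : ∀ l, HasWeakGrad (fun x => g l x * u l x)
      fun j x => pd j (g l) x * u l x + g l x * D l j x :=
    fun l => (hu l).lipschitz_mul (hg l).choose_spec
  rw [integral_finsetSum _ fun l _ => integrableOn_firstOrder (ha l) (hbL l)
    ((hgu l).memL2.memLp_restrict hb) fun j => ((hgu l).memL2_grad j).memLp_restrict hb]
  exact Finset.sum_eq_zero fun l _ => setIntegral_eq_zero_of_lipschitz hΩ hb (ha l) (hbL l)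
    (setIntegral_component_eq_zero h l) (hu l) (hg l).choose_spec (hgΩ l)

end Vector

/-! ### Maxwell's equations as a first order form -/

/-- Zeroth order coefficients of the Maxwell form. -/
def maxwellCoeff0 (ω γ μ : ℂ) (E H : Fin 3 → ℂ) : Fin 8 → ℂ :=
  ![0, ω * γ * E 0, ω * γ * E 1, ω * γ * E 2, ω * μ * H 0, ω * μ * H 1, ω * μ * H 2, 0]

/-- First order coefficients of the Maxwell form. -/
noncomputable def maxwellCoeff1 (γ μ : ℂ) (E H : Fin 3 → ℂ) : Fin 8 → Fin 3 → ℂ :=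
  fun l => Complex.I • (![![γ * E 0, γ * E 1, γ * E 2],
    ![0, H 2, -H 1], ![-H 2, 0, H 0], ![H 1, -H 0, 0],
    ![0, -E 2, E 1], ![E 2, 0, -E 0], ![-E 1, E 0, 0],
    ![μ * H 0, μ * H 1, μ * H 2]] : Fin 8 → Fin 3 → ℂ) l

/-- The density `i [E · ∇ ∧ ψ₃ - i ω μ H · ψ₃] - i [H · ∇ ∧ ψ₂ + i ω γ E · ψ₂] + i γ E · ∇ ψ₁
+ i μ H · ∇ ψ₄` of the weak form of Maxwell's equations together with the divergence equations. -/
noncomputable def maxwellForm (ω γ μ : ℂ) (E H : Fin 3 → ℂ) (ψ : Fin 8 → ℂ)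
    (Dψ : Fin 8 → Fin 3 → ℂ) : ℂ :=
  ∑ l, (maxwellCoeff0 ω γ μ E H l * ψ l + ∑ j, maxwellCoeff1 γ μ E H l j * Dψ l j)

/-- The density of the tangential trace of `u`, with `F = ∇ ∧ u`. -/
def traceDensity (u F φ : Fin 3 → ℂ) (Dφ : Fin 3 → Fin 3 → ℂ) : ℂ :=
  ∑ i, (F i * φ i - u i * curlOf Dφ i)

/-- The divergence terms are hidden in the trace: testing with a gradient kills the curl and leaves
`ω⁻¹ (∇ ∧ u) · ∇ψ`, which is the term in `∇ψ₁` or `∇ψ₄`. The symmetric matrices `d1` and `d4` stand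
for the Hessians of these two scalars. -/
theorem maxwellForm_eq_traceDensity {ω : ℂ} (hω : ω ≠ 0) (γ μ : ℂ) (E H : Fin 3 → ℂ)
    (ψ : Fin 8 → ℂ) (Dψ : Fin 8 → Fin 3 → ℂ) (d1 d4 : Fin 3 → Fin 3 → ℂ)
    (h1 : ∀ i j, d1 i j = d1 j i) (h4 : ∀ i j, d4 i j = d4 j i) :
    maxwellForm ω γ μ E H ψ Dψ =
      traceDensity E (fun i => Complex.I * ω * μ * H i)
        (fun i => -Complex.I * ψ (b3 i) + ω⁻¹ * Dψ 7 i)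
        (fun i j => -Complex.I * Dψ (b3 i) j + ω⁻¹ * d4 i j)
      + traceDensity H (fun i => -(Complex.I * ω * γ * E i))
        (fun i => Complex.I * ψ (b2 i) + -ω⁻¹ * Dψ 0 i)
        (fun i j => Complex.I * Dψ (b2 i) j + -ω⁻¹ * d1 i j) := by
  have hI : Complex.I ^ 2 = -1 := Complex.I_sq
  simp only [maxwellForm, maxwellCoeff0, maxwellCoeff1, traceDensity, curlOf, Fin.sum_univ_eight,
    Fin.sum_univ_three, b2, b3, Pi.smul_apply, smul_eq_mul]
  simp only [Matrix.cons_val]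
  rw [h1 2 1, h1 2 0, h1 1 0, h4 2 1, h4 2 0, h4 1 0]
  field_simp
  ring_nf
  rw [hI]
  ring

/-- Exponents of `γ` in the rescaling of the components. -/
noncomputable def expGam : Fin 8 → ℂ := ![-1 / 2, 0, 0, 0, 1 / 2, 1 / 2, 1 / 2, 0]

/-- Exponents of `μ` in the rescaling of the components. -/
noncomputable def expMu : Fin 8 → ℂ := ![0, 1 / 2, 1 / 2, 1 / 2, 0, 0, 0, -1 / 2]

/-- The weights `(γ^{-1/2}, μ^{1/2}, γ^{1/2}, μ^{-1/2})`, in terms of `log γ` and `log μ`. -/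
noncomputable def weight (lg lm : ℂ) (l : Fin 8) : ℂ := Complex.exp (expGam l * lg + expMu l * lm)

/-- The rescaled fields `(0, γ^{1/2} E, μ^{1/2} H, 0)`. -/
noncomputable def rescaled (lg lm : ℂ) (E H : Fin 3 → ℂ) : Fin 8 → ℂ :=
  ![0, Complex.exp (1 / 2 * lg) * E 0, Complex.exp (1 / 2 * lg) * E 1,
    Complex.exp (1 / 2 * lg) * E 2, Complex.exp (1 / 2 * lm) * H 0, Complex.exp (1 / 2 * lm) * H 1,
    Complex.exp (1 / 2 * lm) * H 2, 0]

/-- The weights are integrating factors: for example `∇u - (α/2) u = γ^{1/2} ∇(γ^{-1/2} u)` and `∇ ∧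
u + (α/2) ∧ u = γ^{-1/2} ∇ ∧ (γ^{1/2} u)`. The powers left over combine with those in the rescaled
fields. -/
theorem sum_rescaled_mul_firstOrder (ω lg lm : ℂ) (α β : Fin 3 → ℂ) (E H : Fin 3 → ℂ)
    (φ : Fin 8 → ℂ) (Dφ : Fin 8 → Fin 3 → ℂ) :
    ∑ l, rescaled lg lm E H l * firstOrder (ω * Complex.exp (1 / 2 * lg + 1 / 2 * lm)) α β φ Dφ l
      = maxwellForm ω (Complex.exp lg) (Complex.exp lm) E H (fun l => weight lg lm l * φ l)
        (fun l j => (expGam l * α j + expMu l * β j) * weight lg lm l * φ l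
          + weight lg lm l * Dφ l j) := by
  have hI : Complex.I ^ 2 = -1 := Complex.I_sq
  have hs : Complex.exp lg = Complex.exp (1 / 2 * lg) ^ 2 := by
    rw [← Complex.exp_nat_mul]; congr 1; push_cast; ring
  have hr : Complex.exp lm = Complex.exp (1 / 2 * lm) ^ 2 := by
    rw [← Complex.exp_nat_mul]; congr 1; push_cast; ring
  have hs' : Complex.exp (-1 / 2 * lg) = (Complex.exp (1 / 2 * lg))⁻¹ := by
    rw [← Complex.exp_neg]; congr 1; ring
  have hr' : Complex.exp (-1 / 2 * lm) = (Complex.exp (1 / 2 * lm))⁻¹ := by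
    rw [← Complex.exp_neg]; congr 1; ring
  rw [firstOrder_eq, Complex.exp_add, hs, hr]
  simp only [maxwellForm, maxwellCoeff0, maxwellCoeff1, rescaled, weight, expGam, expMu,
    Fin.sum_univ_eight, Fin.sum_univ_three, Pi.smul_apply, smul_eq_mul]
  simp only [Matrix.cons_val, zero_mul, zero_add, add_zero]
  rw [hs', hr']
  have h1 : Complex.exp (1 / 2 * lg) ≠ 0 := Complex.exp_ne_zero _
  have h2 : Complex.exp (1 / 2 * lm) ≠ 0 := Complex.exp_ne_zero _
  generalize Complex.exp (1 / 2 * lg) = s at *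
  generalize Complex.exp (1 / 2 * lm) = r at *
  field_simp
  ring

/-! ### The factorization, integrated -/

theorem MemL2loc.sub {u v : R3 → ℂ} (hu : MemL2loc u) (hv : MemL2loc v) :
    MemL2loc fun x => u x - v x := fun K hK => (hu K hK).sub (hv K hK)

theorem memL2loc_firstOrder {κ : R3 → ℂ} {α β : Fin 3 → R3 → ℂ} (hκ : LocBdd κ)
    (hα : ∀ j, LocBdd (α j)) (hβ : ∀ j, LocBdd (β j)) {w : Fin 8 → R3 → ℂ}
    {D : Fin 8 → Fin 3 → R3 → ℂ} (hw : ∀ l, HasWeakGrad (w l) (D l)) (l : Fin 8) :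
    MemL2loc fun x => firstOrder (κ x) (fun j => α j x) (fun j => β j x) (fun l => w l x)
      (fun l j => D l j x) l := by
  have h0 := fun l => (hw l).memL2
  have h1 := fun l => (hw l).memL2_grad
  have hc : ∀ {u : R3 → ℂ} (c : ℂ), MemL2loc u → MemL2loc fun x => c * u x :=
    fun c hu => (LocBdd.const c).mul_memL2loc hu
  simp only [firstOrder_eq]
  fin_cases l <;> simp only [Fin.zero_eta, Fin.mk_one, Fin.reduceFinMk, Matrix.cons_val] <;>
    repeat' first
    | apply MemL2loc.sub
    | apply MemL2loc.add
    | exact h0 _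
    | exact h1 _ _
    | exact LocBdd.mul_memL2loc hκ (h0 _)
    | exact LocBdd.mul_memL2loc (hα _) (h0 _)
    | exact LocBdd.mul_memL2loc (hβ _) (h0 _)
    | apply hc

theorem firstOrder_zero (κ : ℂ) (α β : Fin 3 → ℂ) (l : Fin 8) :
    firstOrder κ α β (fun _ => 0) (fun _ _ => 0) l = 0 := by
  rw [firstOrder_eq]
  fin_cases l <;> simp

theorem IntegralZero.nullPart {Dw Dφ : Fin 8 → Fin 3 → R3 → ℂ}
    (h : ∀ a b j k, IntegralZero fun x =>
      nullTerm (fun l j => Dw l j x) (fun l j => Dφ l j x) a b j k) :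
    IntegralZero fun x => nullPart (fun l j => Dw l j x) (fun l j => Dφ l j x) := by
  -- Each null term is kept as one opaque function, since only the difference of its two products is
  -- known to have zero integral.
  obtain ⟨N, hN⟩ : ∃ N : Fin 8 → Fin 8 → Fin 3 → Fin 3 → R3 → ℂ, ∀ a b j k x,
      nullTerm (fun l j => Dw l j x) (fun l j => Dφ l j x) a b j k = N a b j k x :=
    ⟨_, fun _ _ _ _ _ => rfl⟩
  simp only [MaxwellLip.nullPart, hN] at h ⊢
  repeat' first
    | with_reducible exact h _ _ _ _
    | with_reducible apply IntegralZero.sub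
    | with_reducible apply IntegralZero.add

theorem IntegralZero.divPart {κ : R3 → ℂ} {dκ α β : Fin 3 → R3 → ℂ} {w φ : Fin 8 → R3 → ℂ}
    {Dw Dφ : Fin 8 → Fin 3 → R3 → ℂ}
    (hv : ∀ a b j, IntegralZero fun x => divTerm (κ x) (fun j => dκ j x) (fun l => w l x)
      (fun l j => Dw l j x) (fun l => φ l x) (fun l j => Dφ l j x) a b j)
    (hα : ∀ a b j k, IntegralZero fun x => curlTerm (fun j => α j x) (fun l => w l x)
      (fun l j => Dw l j x) (fun l => φ l x) (fun l j => Dφ l j x) a b j k)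
    (hβ : ∀ a b j k, IntegralZero fun x => curlTerm (fun j => β j x) (fun l => w l x)
      (fun l j => Dw l j x) (fun l => φ l x) (fun l j => Dφ l j x) a b j k) :
    IntegralZero fun x => divPart (κ x) (fun j => dκ j x) (fun j => α j x) (fun j => β j x)
      (fun l => w l x) (fun l j => Dw l j x) (fun l => φ l x) (fun l j => Dφ l j x) := by
  obtain ⟨N, hN⟩ : ∃ N : Fin 8 → Fin 8 → Fin 3 → R3 → ℂ, ∀ a b j x,
      divTerm (κ x) (fun j => dκ j x) (fun l => w l x) (fun l j => Dw l j x) (fun l => φ l x)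
        (fun l j => Dφ l j x) a b j = N a b j x := ⟨_, fun _ _ _ _ => rfl⟩
  obtain ⟨A, hA⟩ : ∃ A : Fin 8 → Fin 8 → Fin 3 → Fin 3 → R3 → ℂ, ∀ a b j k x,
      curlTerm (fun j => α j x) (fun l => w l x) (fun l j => Dw l j x) (fun l => φ l x)
        (fun l j => Dφ l j x) a b j k = A a b j k x := ⟨_, fun _ _ _ _ _ => rfl⟩
  obtain ⟨B, hB⟩ : ∃ B : Fin 8 → Fin 8 → Fin 3 → Fin 3 → R3 → ℂ, ∀ a b j k x,
      curlTerm (fun j => β j x) (fun l => w l x) (fun l j => Dw l j x) (fun l => φ l x)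
        (fun l j => Dφ l j x) a b j k = B a b j k x := ⟨_, fun _ _ _ _ _ => rfl⟩
  simp only [MaxwellLip.divPart, hN, hA, hB] at hv hα hβ ⊢
  repeat' first
    | with_reducible exact hv _ _ _
    | with_reducible exact hα _ _ _ _
    | with_reducible exact hβ _ _ _ _
    | with_reducible apply IntegralZero.sub
    | with_reducible apply IntegralZero.add
    | with_reducible apply IntegralZero.const_mul

/-- The divergence terms are linear in `(κ, ∇κ, α, β)` jointly, so for two sets of parameters only
the compactly supported differences matter. -/
theorem divPart_sub (κ₁ κ₂ : ℂ) (dκ₁ dκ₂ α₁ α₂ β₁ β₂ : Fin 3 → ℂ) (w : Fin 8 → ℂ)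
    (Dw : Fin 8 → Fin 3 → ℂ) (φ : Fin 8 → ℂ) (Dφ : Fin 8 → Fin 3 → ℂ) :
    divPart (κ₂ - κ₁) (dκ₂ - dκ₁) (α₂ - α₁) (β₂ - β₁) w Dw φ Dφ
      = divPart κ₂ dκ₂ α₂ β₂ w Dw φ Dφ - divPart κ₁ dκ₁ α₁ β₁ w Dw φ Dφ := by
  simp only [divPart, divTerm, curlTerm, Pi.sub_apply]
  ring

theorem qDensity_eq_potentialForm (ω μo εo : ℝ) (μ ε σ : R3 → ℝ) (x : R3)
    (w : Fin 8 → ℂ) (Dw : Fin 8 → Fin 3 → ℂ) (φ : Fin 8 → ℂ) (Dφ : Fin 8 → Fin 3 → ℂ) :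
    qDensity ω μo εo μ ε σ x w Dw φ Dφ = potentialForm (kappa ω μ ε σ x)
      (theta ω μo εo μ ε σ x) (alphaVec ω ε σ x) (betaVec μ x) w Dw φ Dφ := rfl

section Admissible

variable {Ω : Set R3} {c : R3} {R ω μo εo : ℝ} {μ ε σ : R3 → ℝ}

theorem IsAdmissible.locBdd_kappa (h : IsAdmissible Ω (Metric.ball c R) μo εo μ ε σ) :
    LocBdd (kappa ω μ ε σ) := (h.lipschitz_kappa ω).choose_spec.continuous.locBdd

theorem IsAdmissible.locBdd_alpha (h : IsAdmissible Ω (Metric.ball c R) μo εo μ ε σ) (j : Fin 3) :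
    LocBdd fun x => alphaVec ω ε σ x j := (h.bddLip_logGam ω).lip.choose_spec.locBdd_pd j

theorem IsAdmissible.locBdd_beta (h : IsAdmissible Ω (Metric.ball c R) μo εo μ ε σ) (j : Fin 3) :
    LocBdd fun x => betaVec μ x j := h.bddLip_logMu.lip.choose_spec.locBdd_pd j

theorem IsAdmissible.memL2loc_firstOrder (h : IsAdmissible Ω (Metric.ball c R) μo εo μ ε σ)
    {w : Fin 8 → R3 → ℂ} {D : Fin 8 → Fin 3 → R3 → ℂ} (hw : ∀ l, HasWeakGrad (w l) (D l))
    (l : Fin 8) :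
    MemL2loc fun x => firstOrder (kappa ω μ ε σ x) (alphaVec ω ε σ x) (betaVec μ x)
      (fun l => w l x) (fun l j => D l j x) l :=
  MaxwellLip.memL2loc_firstOrder h.locBdd_kappa h.locBdd_alpha h.locBdd_beta hw l

theorem IsAdmissible.ae_factorization (h : IsAdmissible Ω (Metric.ball c R) μo εo μ ε σ)
    (hμo : 0 < μo) (hεo : 0 < εo) :
    ∀ᵐ x, ∀ (w : Fin 8 → ℂ) (Dw : Fin 8 → Fin 3 → ℂ) (φ : Fin 8 → ℂ) (Dφ : Fin 8 → Fin 3 → ℂ),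
      (∑ l, ∑ j, Dw l j * Dφ l j) - (wavenumber ω μo εo : ℂ) ^ 2 * (∑ l, w l * φ l)
          + qDensity ω μo εo μ ε σ x w Dw φ Dφ
        = - (∑ l, firstOrder (kappa ω μ ε σ x) (alphaVec ω ε σ x) (betaVec μ x) w Dw l
              * firstOrder (kappa ω μ ε σ x) (alphaVec ω ε σ x) (betaVec μ x) φ Dφ l)
          + (divPart (kappa ω μ ε σ x) (fun j => pd j (kappa ω μ ε σ) x) (alphaVec ω ε σ x)
              (betaVec μ x) w Dw φ Dφ - nullPart Dw Dφ) := by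
  filter_upwards [h.ae_pd_kappa ω] with x hx w Dw φ Dφ
  rw [qDensity_eq_potentialForm]
  exact factorization (h.kappa_sq ω hμo hεo x) hx w Dw φ Dφ

theorem pd_eq_zero_of_isTest {φ : R3 → ℂ} {U : Set R3} (hφ : IsTest U φ) {x : R3} (hx : x ∉ U)
    (j : Fin 3) : pd j φ x = 0 :=
  image_eq_zero_of_notMem_tsupport fun h => hx (hφ.2.2 (tsupport_pd_subset j φ h))

theorem eq_zero_of_isTest {φ : R3 → ℂ} {U : Set R3} (hφ : IsTest U φ) {x : R3} (hx : x ∉ U) :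
    φ x = 0 := image_eq_zero_of_notMem_tsupport fun h => hx (hφ.2.2 h)

/-- `𝒫' w` is a weak solution of the first order system. -/
theorem IsAdmissible.setIntegral_opP'_mul_test
    (h : IsAdmissible Ω (Metric.ball c R) μo εo μ ε σ) (hμo : 0 < μo) (hεo : 0 < εo)
    (hΩ' : Ω ⊆ Metric.ball c R) {w : Fin 8 → R3 → ℂ} (hw : ∀ l, MemH1loc (w l))
    (hsol : IsWeakSchrodingerSolution (Metric.ball c R) ω μo εo μ ε σ w)
    {φ : Fin 8 → R3 → ℂ} (hφ : ∀ l, IsTest Ω (φ l)) :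
    ∫ x in Ω, ∑ l, opP' ω μo εo μ ε σ w x l
      * firstOrder (kappa ω μ ε σ x) (alphaVec ω ε σ x) (betaVec μ x) (fun l => φ l x)
        (fun l j => pd j (φ l) x) l = 0 := by
  have hW := fun l => (hw l).hasWeakGrad
  have hb : Bornology.IsBounded Ω := Metric.isBounded_ball.subset hΩ'
  simp only [opP'_eq_firstOrder]
  set p : Fin 8 → R3 → ℂ := fun l x => firstOrder (kappa ω μ ε σ x) (alphaVec ω ε σ x)
    (betaVec μ x) (fun l => w l x) (fun l j => weakPd j (w l) x) l with hp
  set r : Fin 8 → R3 → ℂ := fun l x => firstOrder (kappa ω μ ε σ x) (alphaVec ω ε σ x)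
    (betaVec μ x) (fun l => φ l x) (fun l j => pd j (φ l) x) l with hr
  have hp2 : ∀ l, MemL2loc (p l) := fun l => h.memL2loc_firstOrder hW l
  have hr2 : ∀ l, MemL2loc (r l) := fun l =>
    h.memL2loc_firstOrder (fun l => (hφ l).hasWeakGrad) l
  have hr0 : ∀ l x, x ∉ Ω → r l x = 0 := by
    intro l x hx
    simp only [hr, eq_zero_of_isTest (hφ _) hx, pd_eq_zero_of_isTest (hφ _) hx]
    exact firstOrder_zero _ _ _ l
  have hpr : IntegrableOn (fun x => ∑ l, p l x * r l x) Ω :=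
    integrable_finsetSum _ fun l _ => MemLp.integrable_mul ((hp2 l).memLp_restrict hb)
      ((hr2 l).memLp_restrict hb)
  have hsupp : Function.support (fun x => ∑ l, p l x * r l x) ⊆ Ω := by
    intro x hx
    by_contra hxΩ
    exact hx (by simp [hr0 _ x hxΩ])
  have hpr' : Integrable fun x => ∑ l, p l x * r l x :=
    (integrableOn_iff_integrable_of_support_subset hsupp).1 hpr
  have hall : ∫ x in Ω, ∑ l, p l x * r l x = ∫ x, ∑ l, p l x * r l x :=
    setIntegral_eq_integral_of_forall_compl_eq_zero fun x hx => by simp [hr0 _ x hx]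
  refine Eq.trans hall ?_
  obtain ⟨Kκ, hκ⟩ := h.lipschitz_kappa ω
  obtain ⟨Kα, hα⟩ := (h.bddLip_logGam ω).lip
  obtain ⟨Kβ, hβ⟩ := h.bddLip_logMu.lip
  have hN : IntegralZero fun x => divPart (kappa ω μ ε σ x) (fun j => pd j (kappa ω μ ε σ) x)
      (alphaVec ω ε σ x) (betaVec μ x) (fun l => w l x) (fun l j => weakPd j (w l) x)
      (fun l => φ l x) (fun l j => pd j (φ l) x)
      - nullPart (fun l j => weakPd j (w l) x) (fun l j => pd j (φ l) x) :=
    (IntegralZero.divPart (fun a b j => integralZero_pd_mul_test hκ (hW a) (hφ b) j)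
      (fun a b j k => integralZero_curl_test hα (hW a) (hφ b) j k)
      (fun a b j k => integralZero_curl_test hβ (hW a) (hφ b) j k)).sub
    (IntegralZero.nullPart fun a b j k => integralZero_null (hW a) (hφ b) j k)
  have hf : Integrable fun x => (∑ l, ∑ j, weakPd j (w l) x * pd j (φ l) x)
      - (wavenumber ω μo εo : ℂ) ^ 2 * ∑ l, w l x * φ l x := by
    refine Integrable.sub (integrable_finsetSum _ fun l _ => integrable_finsetSum _ fun j _ => ?_)
      (Integrable.const_mul (integrable_finsetSum _ fun l _ => ?_) _)
    · simpa only [mul_comm] using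
        ((hW l).memL2_grad j).integrable_test_mul ((hφ l).univ.pd j)
    · simpa only [mul_comm] using (hW l).memL2.integrable_test_mul (hφ l).univ
  have hs := hsol φ fun l => (hφ l).mono hΩ'
  -- The factorization is solved for the potential because the weak equation has two separate
  -- integrals. Every piece on the right is already known to be integrable.
  have hid : ∀ᵐ x, qDensity ω μo εo μ ε σ x (fun l => w l x) (fun l j => weakPd j (w l) x)
      (fun l => φ l x) (fun l j => pd j (φ l) x)
      = (- (∑ l, p l x * r l x) + (divPart (kappa ω μ ε σ x)
        (fun j => pd j (kappa ω μ ε σ) x)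
      (alphaVec ω ε σ x) (betaVec μ x) (fun l => w l x) (fun l j => weakPd j (w l) x)
      (fun l => φ l x) (fun l j => pd j (φ l) x)
      - nullPart (fun l j => weakPd j (w l) x) (fun l j => pd j (φ l) x)))
      - ((∑ l, ∑ j, weakPd j (w l) x * pd j (φ l) x)
      - (wavenumber ω μo εo : ℂ) ^ 2 * ∑ l, w l x * φ l x) := by
    filter_upwards [h.ae_factorization (ω := ω) hμo hεo] with x hx
    rw [eq_sub_iff_add_eq, add_comm]
    exact hx _ _ _ _
  have hneg : Integrable fun x => - ∑ l, p l x * r l x := hpr'.neg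
  rw [integral_congr_ae hid, integral_sub (hneg.fun_add hN.1) hf,
    integral_add hneg hN.1, hN.2, integral_neg] at hs
  simpa using hs

end Admissible

/-! ### The difference of the potentials as an integral over `Ω` -/

/-- The two potentials differ by the product of the first order expressions over `Ω`, up to terms
that integrate to zero. -/
theorem exists_qDiffDensity_eq {Ω : Set R3} (hΩ : IsOpen Ω) {c : R3} {R : ℝ}
    (hΩ' : Ω ⊆ Metric.ball c R) {ω μo εo : ℝ} (hμo : 0 < μo) (hεo : 0 < εo)
    {μ₁ ε₁ σ₁ μ₂ ε₂ σ₂ : R3 → ℝ}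
    (h₁ : IsAdmissible Ω (Metric.ball c R) μo εo μ₁ ε₁ σ₁)
    (h₂ : IsAdmissible Ω (Metric.ball c R) μo εo μ₂ ε₂ σ₂)
    (hμ : ∀ x, x ∉ Ω → μ₁ x = μ₂ x) (hε : ∀ x, x ∉ Ω → ε₁ x = ε₂ x)
    (hσ : ∀ x, x ∉ Ω → σ₁ x = σ₂ x) {w v : Fin 8 → R3 → ℂ}
    (hw : ∀ l, MemH1loc (w l)) (hv : ∀ l, MemH1loc (v l))
    (hv_sol : ∀ᵐ x ∂(volume.restrict (Metric.ball c R)), opP' ω μo εo μ₂ ε₂ σ₂ v x = 0) :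
    Integrable (qDiffDensity ω μo εo μ₁ ε₁ σ₁ μ₂ ε₂ σ₂ w v) volume ∧
      ∫ x, qDiffDensity ω μo εo μ₁ ε₁ σ₁ μ₂ ε₂ σ₂ w v x
        = ∫ x in Ω, ∑ l, opP' ω μo εo μ₁ ε₁ σ₁ w x l * opP' ω μo εo μ₁ ε₁ σ₁ v x l := by
  have hW := fun l => (hw l).hasWeakGrad
  have hV := fun l => (hv l).hasWeakGrad
  have hb : Bornology.IsBounded Ω := Metric.isBounded_ball.subset hΩ'
  have hm := hΩ.measurableSet
  obtain ⟨Kκ₁, hκ₁⟩ := h₁.lipschitz_kappa ω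
  obtain ⟨Kα₁, hα₁⟩ := (h₁.bddLip_logGam ω).lip
  obtain ⟨Kβ₁, hβ₁⟩ := h₁.bddLip_logMu.lip
  obtain ⟨Kκ₂, hκ₂⟩ := h₂.lipschitz_kappa ω
  obtain ⟨Kα₂, hα₂⟩ := (h₂.bddLip_logGam ω).lip
  obtain ⟨Kβ₂, hβ₂⟩ := h₂.bddLip_logMu.lip
  have hgam : ∀ x, x ∉ Ω → gam ω ε₁ σ₁ x = gam ω ε₂ σ₂ x := fun x hx => by
    simp [gam, hε x hx, hσ x hx]
  have eκ : ∀ x, x ∉ Ω → kappa ω μ₁ ε₁ σ₁ x = kappa ω μ₂ ε₂ σ₂ x := fun x hx => by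
    simp [kappa, hμ x hx, hgam x hx]
  have eα : ∀ x, x ∉ Ω → logGam ω ε₁ σ₁ x = logGam ω ε₂ σ₂ x := fun x hx => by
    simp [logGam, hgam x hx]
  have eβ : ∀ x, x ∉ Ω → logMu μ₁ x = logMu μ₂ x := fun x hx => by simp [logMu, hμ x hx]
  have cpt : ∀ {f g : R3 → ℂ}, (∀ x, x ∉ Ω → f x = g x) →
      HasCompactSupport fun x => g x - f x := fun hfg =>
    HasCompactSupport.intro hb.isCompact_closure fun x hx => by
      rw [hfg x fun h => hx (subset_closure h), sub_self]
  set p : Fin 8 → R3 → ℂ := fun l x => opP' ω μo εo μ₁ ε₁ σ₁ w x l with hp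
  set r : Fin 8 → R3 → ℂ := fun l x => opP' ω μo εo μ₁ ε₁ σ₁ v x l with hr
  have hpr : IntegrableOn (fun x => ∑ l, p l x * r l x) Ω := by
    refine integrable_finsetSum _ fun l _ => MemLp.integrable_mul (p := 2) (q := 2) ?_ ?_
    · simp only [hp, opP'_eq_firstOrder]
      exact (h₁.memL2loc_firstOrder hW l).memLp_restrict hb
    · simp only [hr, opP'_eq_firstOrder]
      exact (h₁.memL2loc_firstOrder hV l).memLp_restrict hb
  have hN : IntegralZero fun x => divPart (kappa ω μ₂ ε₂ σ₂ x - kappa ω μ₁ ε₁ σ₁ x)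
      (fun j => pd j (fun x => kappa ω μ₂ ε₂ σ₂ x - kappa ω μ₁ ε₁ σ₁ x) x)
      (fun j => pd j (fun x => logGam ω ε₂ σ₂ x - logGam ω ε₁ σ₁ x) x)
      (fun j => pd j (fun x => logMu μ₂ x - logMu μ₁ x) x)
      (fun l => w l x) (fun l j => weakPd j (w l) x)
      (fun l => v l x) (fun l j => weakPd j (v l) x) :=
    IntegralZero.divPart
      (fun a b j => integralZero_pd_mul (hκ₂.sub hκ₁) (cpt eκ) (hW a) (hV b) j)
      (fun a b j k => integralZero_curl (hα₂.sub hα₁) (cpt eα) (hW a) (hV b) j k)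
      (fun a b j k => integralZero_curl (hβ₂.sub hβ₁) (cpt eβ) (hW a) (hV b) j k)
  have pd_sub : ∀ {f g : R3 → ℂ} {x : R3}, DifferentiableAt ℝ f x → DifferentiableAt ℝ g x →
      (fun j => pd j (fun y => f y - g y) x) = (fun j => pd j f x) - fun j => pd j g x := by
    intro f g x hf hg
    ext j
    simp only [pd, Pi.sub_apply]
    rw [fderiv_fun_sub hf hg]
    simp
  rw [ae_restrict_iff' measurableSet_ball] at hv_sol
  have key : ∀ᵐ x, qDiffDensity ω μo εo μ₁ ε₁ σ₁ μ₂ ε₂ σ₂ w v x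
      = Ω.indicator (fun x => ∑ l, p l x * r l x) x
        + divPart (kappa ω μ₂ ε₂ σ₂ x - kappa ω μ₁ ε₁ σ₁ x)
      (fun j => pd j (fun x => kappa ω μ₂ ε₂ σ₂ x - kappa ω μ₁ ε₁ σ₁ x) x)
      (fun j => pd j (fun x => logGam ω ε₂ σ₂ x - logGam ω ε₁ σ₁ x) x)
      (fun j => pd j (fun x => logMu μ₂ x - logMu μ₁ x) x)
      (fun l => w l x) (fun l j => weakPd j (w l) x)
      (fun l => v l x) (fun l j => weakPd j (v l) x) := by
    filter_upwards [hv_sol, h₁.ae_factorization (ω := ω) hμo hεo,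
      h₂.ae_factorization (ω := ω) hμo hεo,
      ae_pd_eq_of_eqOn hα₁ hα₂ hm.compl eα, ae_pd_eq_of_eqOn hβ₁ hβ₂ hm.compl eβ,
      hκ₁.ae_differentiableAt (μ := volume), hκ₂.ae_differentiableAt (μ := volume),
      hα₁.ae_differentiableAt (μ := volume), hα₂.ae_differentiableAt (μ := volume),
      hβ₁.ae_differentiableAt (μ := volume), hβ₂.ae_differentiableAt (μ := volume)]
      with x hx0 f1 f2 gα gβ dκ₁ dκ₂ dα₁ dα₂ dβ₁ dβ₂
    rw [pd_sub dκ₂ dκ₁, pd_sub dα₂ dα₁, pd_sub dβ₂ dβ₁, divPart_sub]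
    have f1' := f1 (fun l => w l x) (fun l j => weakPd j (w l) x)
      (fun l => v l x) (fun l j => weakPd j (v l) x)
    have f2' := f2 (fun l => w l x) (fun l j => weakPd j (w l) x)
      (fun l => v l x) (fun l j => weakPd j (v l) x)
    have a1 : alphaVec ω ε₁ σ₁ x = fun j => pd j (logGam ω ε₁ σ₁) x := rfl
    have a2 : alphaVec ω ε₂ σ₂ x = fun j => pd j (logGam ω ε₂ σ₂) x := rfl
    have b1 : betaVec μ₁ x = fun j => pd j (logMu μ₁) x := rfl
    have b2 : betaVec μ₂ x = fun j => pd j (logMu μ₂) x := rfl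
    rw [← a1, ← a2, ← b1, ← b2]
    simp only [← opP'_eq_firstOrder ω μo εo] at f1' f2'
    -- Inside `Ω` the second product vanishes since `𝒫₂'v = 0`. Outside, the coefficients agree,
    -- including a.e. their gradients, so the two products cancel.
    have hprod : Ω.indicator (fun x => ∑ l, p l x * r l x) x
        = (∑ l, p l x * r l x)
          - ∑ l, opP' ω μo εo μ₂ ε₂ σ₂ w x l * opP' ω μo εo μ₂ ε₂ σ₂ v x l := by
      by_cases hx : x ∈ Ω
      · simp [hx, hx0 (hΩ' hx)]
      · have ea : alphaVec ω ε₁ σ₁ x = alphaVec ω ε₂ σ₂ x := funext fun j => gα hx j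
        have eb : betaVec μ₁ x = betaVec μ₂ x := funext fun j => gβ hx j
        simp [hx, hp, hr, opP'_eq_firstOrder, ea, eb, eκ x hx]
    rw [hprod, qDiffDensity]
    linear_combination f2' - f1'
  have hint := (integrable_indicator_iff hm).2 hpr
  refine ⟨(hint.add hN.1).congr (key.mono fun x hx => hx.symm), ?_⟩
  rw [integral_congr_ae key, integral_add hint hN.1, hN.2, add_zero, integral_indicator hm]

/-! ### Weak curls and tangential traces -/

section Curl

variable {Ω : Set R3}

theorem memLp_curlOf_test (hb : Bornology.IsBounded Ω) {φ : Fin 3 → R3 → ℂ} {U : Set R3}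
    (hφ : ∀ i, IsTest U (φ i)) (i : Fin 3) :
    MemLp (fun x => curlOf (fun a b => pd b (φ a) x) i) 2 (volume.restrict Ω) := by
  have h : ∀ a b, MemL2loc (pd b (φ a)) := fun a b => ((hφ a).pd b).1.continuous.locBdd.memL2loc
  refine MemL2loc.memLp_restrict ?_ hb
  fin_cases i <;> simp only [curlOf, Fin.zero_eta, Fin.mk_one, Fin.reduceFinMk, Matrix.cons_val] <;>
    exact (h _ _).sub (h _ _)

theorem integrableOn_sum_mul {u v : Fin 3 → R3 → ℂ} (hu : MemL2 Ω u)
    (hv : ∀ i, MemLp (v i) 2 (volume.restrict Ω)) :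
    IntegrableOn (fun x => ∑ i, u i x * v i x) Ω :=
  integrable_finsetSum _ fun i _ => MemLp.integrable_mul (hu i) (hv i)

theorem IsTest.memLp (hb : Bornology.IsBounded Ω) {φ : R3 → ℂ} {U : Set R3} (hφ : IsTest U φ) :
    MemLp φ 2 (volume.restrict Ω) :=
  hφ.1.continuous.locBdd.memL2loc.memLp_restrict hb

theorem setIntegral_traceDensity (hb : Bornology.IsBounded Ω) {u F φ : Fin 3 → R3 → ℂ}
    (hu : MemL2 Ω u) (hF : MemL2 Ω F) {U : Set R3} (hφ : ∀ i, IsTest U (φ i)) :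
    IntegrableOn (fun x => traceDensity (fun i => u i x) (fun i => F i x) (fun i => φ i x)
        (fun a b => pd b (φ a) x)) Ω ∧
    ∫ x in Ω, traceDensity (fun i => u i x) (fun i => F i x) (fun i => φ i x)
        (fun a b => pd b (φ a) x)
      = (∫ x in Ω, ∑ i, F i x * φ i x)
        - ∫ x in Ω, ∑ i, u i x * curlOf (fun a b => pd b (φ a) x) i := by
  have h1 := integrableOn_sum_mul hF fun i => (hφ i).memLp hb
  have h2 := integrableOn_sum_mul hu fun i => memLp_curlOf_test hb hφ i
  simp only [traceDensity, Finset.sum_sub_distrib]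
  exact ⟨h1.sub h2, integral_sub h1 h2⟩

/-- The trace in the Cauchy data comes with some weak curl; uniqueness identifies it with the curl
prescribed by Maxwell's equations. -/
theorem HasWeakCurl.ae_eq (hΩ : IsOpen Ω) (hb : Bornology.IsBounded Ω) {u F F' : Fin 3 → R3 → ℂ}
    (h : HasWeakCurl Ω u F) (h' : HasWeakCurl Ω u F') (hF : MemL2 Ω F) (hF' : MemL2 Ω F')
    (i : Fin 3) : ∀ᵐ x ∂(volume.restrict Ω), F i x = F' i x := by
  have hfin : IsFiniteMeasure (volume.restrict Ω) := ⟨by simpa using hb.measure_lt_top (μ := volume)⟩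
  have hi : IntegrableOn (fun x => F i x - F' i x) Ω :=
    ((hF i).sub (hF' i)).integrable (by norm_num)
  have := hΩ.ae_eq_zero_of_integral_contDiff_smul_eq_zero (μ := volume) hi.locallyIntegrableOn ?_
  · rw [ae_restrict_iff' hΩ.measurableSet]
    filter_upwards [this] with x hx hxΩ
    exact sub_eq_zero.1 (hx hxΩ)
  · intro g hg hgc hgs
    have ht : IsTest Ω fun x => (g x : ℂ) :=
      ⟨Complex.ofRealCLM.contDiff.comp hg, hgc.comp_left (g := Complex.ofReal) (by simp),
        (closure_mono fun x hx => by simpa using hx).trans hgs⟩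
    let φ : Fin 3 → R3 → ℂ := fun m => if m = i then fun x => (g x : ℂ) else fun _ => 0
    have hφ : ∀ m, IsTest Ω (φ m) := fun m => by
      simp only [φ]
      split_ifs
      · exact ht
      · exact isTest_zero Ω
    have e := (h φ hφ).symm.trans (h' φ hφ)
    have hs : ∀ G : Fin 3 → R3 → ℂ, ∀ x, ∑ m, G m x * φ m x = G i x * g x := by
      intro G x
      rw [Finset.sum_eq_single i]
      · simp [φ]
      · intro m _ hm
        simp [φ, hm]
      · simp
    simp_rw [hs] at e
    have i1 : IntegrableOn (fun x => F i x * g x) Ω := MemLp.integrable_mul (hF i) (ht.memLp hb)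
    have i2 : IntegrableOn (fun x => F' i x * g x) Ω := MemLp.integrable_mul (hF' i) (ht.memLp hb)
    rw [← sub_eq_zero, ← integral_sub i1 i2] at e
    rw [← setIntegral_eq_integral_of_forall_compl_eq_zero (s := Ω)]
    · rw [← e]
      congr 1; ext x
      simp
      ring
    · intro x hx
      have : (g x : ℂ) = 0 := eq_zero_of_isTest ht hx
      simp [Complex.ofReal_eq_zero.1 this]

end Curl

section Form

variable {Ω : Set R3} {ω : ℝ} {γ μ : R3 → ℂ} {E H : Fin 3 → R3 → ℂ}

theorem memLp_maxwellCoeff0 (ω : ℝ) (hm : MeasurableSet Ω) (hb : Bornology.IsBounded Ω)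
    (hγ : LocBdd γ) (hμ : LocBdd μ) (hE : MemL2 Ω E) (hH : MemL2 Ω H) (l : Fin 8) :
    MemLp (fun x => maxwellCoeff0 ω (γ x) (μ x) (fun i => E i x) (fun i => H i x) l) 2
        (volume.restrict Ω) := by
  have z : MemLp (fun _ : R3 => (0 : ℂ)) 2 (volume.restrict Ω) := MemLp.zero'
  have cE : ∀ i, MemLp (fun x => (ω : ℂ) * (γ x * E i x)) 2 (volume.restrict Ω) :=
    fun i => (hγ.mul_memLp (hE i) hb hm).const_mul _
  have cH : ∀ i, MemLp (fun x => (ω : ℂ) * (μ x * H i x)) 2 (volume.restrict Ω) :=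
    fun i => (hμ.mul_memLp (hH i) hb hm).const_mul _
  fin_cases l <;> simp only [maxwellCoeff0, Fin.zero_eta, Fin.mk_one, Fin.reduceFinMk,
    Matrix.cons_val, mul_assoc] <;>
    with_reducible first
    | exact z
    | exact cE _
    | exact cH _

theorem memLp_maxwellCoeff1 (hm : MeasurableSet Ω) (hb : Bornology.IsBounded Ω)
    (hγ : LocBdd γ) (hμ : LocBdd μ) (hE : MemL2 Ω E) (hH : MemL2 Ω H) (l : Fin 8) (j : Fin 3) :
    MemLp (fun x => maxwellCoeff1 (γ x) (μ x) (fun i => E i x) (fun i => H i x) l j) 2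
        (volume.restrict Ω) := by
  have z : MemLp (fun _ : R3 => (0 : ℂ)) 2 (volume.restrict Ω) := MemLp.zero'
  have cE : ∀ i, MemLp (fun x => γ x * E i x) 2 (volume.restrict Ω) :=
    fun i => hγ.mul_memLp (hE i) hb hm
  have cH : ∀ i, MemLp (fun x => μ x * H i x) 2 (volume.restrict Ω) :=
    fun i => hμ.mul_memLp (hH i) hb hm
  have pE : ∀ i, MemLp (fun x => E i x) 2 (volume.restrict Ω) := hE
  have pH : ∀ i, MemLp (fun x => H i x) 2 (volume.restrict Ω) := hH
  have nE : ∀ i, MemLp (fun x => - E i x) 2 (volume.restrict Ω) := fun i => (hE i).neg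
  have nH : ∀ i, MemLp (fun x => - H i x) 2 (volume.restrict Ω) := fun i => (hH i).neg
  simp only [maxwellCoeff1, Pi.smul_apply, smul_eq_mul]
  refine MemLp.const_mul ?_ _
  fin_cases l <;> fin_cases j <;> simp only [Fin.zero_eta, Fin.mk_one, Fin.reduceFinMk,
    Matrix.cons_val] <;>
    with_reducible first
    | exact z
    | exact cE _
    | exact cH _
    | exact nE _
    | exact nH _
    | exact pE _
    | exact pH _

theorem integrableOn_maxwellForm (hm : MeasurableSet Ω) (hb : Bornology.IsBounded Ω)
    (hγ : LocBdd γ) (hμ : LocBdd μ) (hE : MemL2 Ω E) (hH : MemL2 Ω H) {u : Fin 8 → R3 → ℂ}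
    {D : Fin 8 → Fin 3 → R3 → ℂ} (hu : ∀ l, HasWeakGrad (u l) (D l)) :
    IntegrableOn (fun x => maxwellForm ω (γ x) (μ x) (fun i => E i x) (fun i => H i x)
      (fun l => u l x) (fun l j => D l j x)) Ω :=
  integrable_finsetSum _ fun l _ => integrableOn_firstOrder
    (memLp_maxwellCoeff0 ω hm hb hγ hμ hE hH l) (memLp_maxwellCoeff1 hm hb hγ hμ hE hH l)
    ((hu l).memL2.memLp_restrict hb) fun j => ((hu l).memL2_grad j).memLp_restrict hb

/-- Test functions and their first derivatives can be combined into test functions. -/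
theorem isTest_combination {U : Set R3} {ψ χ : R3 → ℂ} (hψ : IsTest U ψ) (hχ : IsTest U χ)
    (a b : ℂ) (i : Fin 3) :
    IsTest U (fun x => a * ψ x + b * pd i χ x) ∧
      ∀ j x, pd j (fun x => a * ψ x + b * pd i χ x) x = a * pd j ψ x + b * pd j (pd i χ) x := by
  have h2 := hχ.pd i
  refine ⟨⟨(contDiff_const.mul hψ.1).add (contDiff_const.mul h2.1),
    (hψ.2.1.mul_left (f := fun _ => a)).add (h2.2.1.mul_left (f := fun _ => b)), ?_⟩, ?_⟩
  · refine (closure_mono (Function.support_add _ _)).trans ?_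
    rw [closure_union]
    exact Set.union_subset
      ((closure_mono (Function.support_mul_subset_right _ _)).trans hψ.2.2)
      ((closure_mono (Function.support_mul_subset_right _ _)).trans h2.2.2)
  · intro j x
    have := ((hψ.differentiable x).hasFDerivAt.const_mul a).add
      ((h2.differentiable x).hasFDerivAt.const_mul b)
    have e := this.fderiv
    unfold pd at *
    erw [e]
    simp

/-- The support of `ψ` is left free: with tests in `Ω` this yields the weak equations, with tests on
`ℝ³` the dependence on tangential traces alone. -/
theorem setIntegral_maxwellForm_test (hω : ω ≠ 0) (hb : Bornology.IsBounded Ω)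
    (hE : MemL2 Ω E) (hH : MemL2 Ω H)
    (hF : MemL2 Ω fun i x => Complex.I * ω * μ x * H i x)
    (hG : MemL2 Ω fun i x => -(Complex.I * ω * γ x * E i x))
    {U : Set R3} {ψ : Fin 8 → R3 → ℂ} (hψ : ∀ l, IsTest U (ψ l)) :
    ∫ x in Ω, maxwellForm ω (γ x) (μ x) (fun i => E i x) (fun i => H i x)
      (fun l => ψ l x) (fun l j => pd j (ψ l) x)
    = (∫ x in Ω, traceDensity (fun i => E i x) (fun i => Complex.I * ω * μ x * H i x)
        (fun i => -Complex.I * ψ (b3 i) x + (ω : ℂ)⁻¹ * pd i (ψ 7) x)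
        (fun a b => pd b (fun x => -Complex.I * ψ (b3 a) x + (ω : ℂ)⁻¹ * pd a (ψ 7) x) x))
      + ∫ x in Ω, traceDensity (fun i => H i x) (fun i => -(Complex.I * ω * γ x * E i x))
        (fun i => Complex.I * ψ (b2 i) x + -(ω : ℂ)⁻¹ * pd i (ψ 0) x)
        (fun a b => pd b (fun x => Complex.I * ψ (b2 a) x + -(ω : ℂ)⁻¹ * pd a (ψ 0) x) x) := by
  have tE := fun i => isTest_combination (hψ (b3 i)) (hψ 7) (-Complex.I) (ω : ℂ)⁻¹ i
  have tH := fun i => isTest_combination (hψ (b2 i)) (hψ 0) Complex.I (-(ω : ℂ)⁻¹) i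
  rw [← integral_add (setIntegral_traceDensity hb hE hF fun i => (tE i).1).1
    (setIntegral_traceDensity hb hH hG fun i => (tH i).1).1]
  congr 1; ext x
  rw [maxwellForm_eq_traceDensity (Complex.ofReal_ne_zero.2 hω) _ _ _ _ _ _
    (fun i j => pd j (pd i (ψ 0)) x) (fun i j => pd j (pd i (ψ 7)) x)
    (fun i j => pd_comm (hψ 0) j i x) (fun i j => pd_comm (hψ 7) j i x)]
  congr 2
  · ext a b
    exact ((tE a).2 b x).symm
  · ext a b
    exact ((tH a).2 b x).symm

/-- Taking only the third, or only the second, vector block of `ψ` nonzero isolates one curl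
equation. -/
theorem hasWeakCurl_of_maxwellForm (hb : Bornology.IsBounded Ω)
    (hE : MemL2 Ω E) (hH : MemL2 Ω H)
    (hF : MemL2 Ω fun i x => Complex.I * ω * μ x * H i x)
    (hG : MemL2 Ω fun i x => -(Complex.I * ω * γ x * E i x))
    (h : ∀ ψ : Fin 8 → R3 → ℂ, (∀ l, IsTest Ω (ψ l)) →
      ∫ x in Ω, maxwellForm ω (γ x) (μ x) (fun i => E i x) (fun i => H i x)
        (fun l => ψ l x) (fun l j => pd j (ψ l) x) = 0) :
    HasWeakCurl Ω E (fun i x => Complex.I * ω * μ x * H i x) ∧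
      HasWeakCurl Ω H (fun i x => -(Complex.I * ω * γ x * E i x)) := by
  have hI : Complex.I ^ 2 = -1 := Complex.I_sq
  have z := isTest_zero Ω
  constructor
  · intro φ hφ
    have h0 := h ![fun _ => 0, fun _ => 0, fun _ => 0, fun _ => 0, φ 0, φ 1, φ 2, fun _ => 0]
      (fun l => by fin_cases l <;> first | exact z | exact hφ _)
    have e : ∀ x, maxwellForm ω (γ x) (μ x) (fun i => E i x) (fun i => H i x)
        (fun l => (![fun _ => 0, fun _ => 0, fun _ => 0, fun _ => 0, φ 0, φ 1, φ 2,
          fun _ => 0] : Fin 8 → R3 → ℂ) l x)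
        (fun l j => pd j ((![fun _ => 0, fun _ => 0, fun _ => 0, fun _ => 0, φ 0, φ 1, φ 2,
          fun _ => 0] : Fin 8 → R3 → ℂ) l) x)
        = -Complex.I * traceDensity (fun i => E i x) (fun i => Complex.I * ω * μ x * H i x)
          (fun i => φ i x) (fun a b => pd b (φ a) x) := by
      intro x
      simp only [maxwellForm, maxwellCoeff0, maxwellCoeff1, traceDensity, curlOf,
        Fin.sum_univ_eight, Fin.sum_univ_three, Pi.smul_apply, smul_eq_mul]
      simp only [Matrix.cons_val, pd_zero]
      ring_nf
      rw [hI]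
      ring
    simp_rw [e] at h0
    rw [integral_const_mul, (setIntegral_traceDensity hb hE hF hφ).2] at h0
    exact (sub_eq_zero.1 ((mul_eq_zero.1 h0).resolve_left (by simp))).symm
  · intro φ hφ
    have h0 := h ![fun _ => 0, φ 0, φ 1, φ 2, fun _ => 0, fun _ => 0, fun _ => 0, fun _ => 0]
      (fun l => by fin_cases l <;> first | exact z | exact hφ _)
    have e : ∀ x, maxwellForm ω (γ x) (μ x) (fun i => E i x) (fun i => H i x)
        (fun l => (![fun _ => 0, φ 0, φ 1, φ 2, fun _ => 0, fun _ => 0, fun _ => 0,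
          fun _ => 0] : Fin 8 → R3 → ℂ) l x)
        (fun l j => pd j ((![fun _ => 0, φ 0, φ 1, φ 2, fun _ => 0, fun _ => 0, fun _ => 0,
          fun _ => 0] : Fin 8 → R3 → ℂ) l) x)
        = Complex.I * traceDensity (fun i => H i x) (fun i => -(Complex.I * ω * γ x * E i x))
          (fun i => φ i x) (fun a b => pd b (φ a) x) := by
      intro x
      simp only [maxwellForm, maxwellCoeff0, maxwellCoeff1, traceDensity, curlOf,
        Fin.sum_univ_eight, Fin.sum_univ_three, Pi.smul_apply, smul_eq_mul]
      simp only [Matrix.cons_val, pd_zero]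
      ring_nf
      rw [hI]
      ring
    simp_rw [e] at h0
    rw [integral_const_mul, (setIntegral_traceDensity hb hH hG hφ).2] at h0
    exact (sub_eq_zero.1 ((mul_eq_zero.1 h0).resolve_left (by simp))).symm

/-- The divergence equations are consequences of the curl equations, so the full form vanishes
although only the curls are given. -/
theorem maxwellForm_of_hasWeakCurl (hω : ω ≠ 0) (hb : Bornology.IsBounded Ω)
    (hE : MemL2 Ω E) (hH : MemL2 Ω H)
    (hF : MemL2 Ω fun i x => Complex.I * ω * μ x * H i x)
    (hG : MemL2 Ω fun i x => -(Complex.I * ω * γ x * E i x))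
    (h₁ : HasWeakCurl Ω E (fun i x => Complex.I * ω * μ x * H i x))
    (h₂ : HasWeakCurl Ω H (fun i x => -(Complex.I * ω * γ x * E i x)))
    {ψ : Fin 8 → R3 → ℂ} (hψ : ∀ l, IsTest Ω (ψ l)) :
    ∫ x in Ω, maxwellForm ω (γ x) (μ x) (fun i => E i x) (fun i => H i x)
        (fun l => ψ l x) (fun l j => pd j (ψ l) x) = 0 := by
  have tE := fun i => isTest_combination (hψ (b3 i)) (hψ 7) (-Complex.I) (ω : ℂ)⁻¹ i
  have tH := fun i => isTest_combination (hψ (b2 i)) (hψ 0) Complex.I (-(ω : ℂ)⁻¹) i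
  rw [setIntegral_maxwellForm_test hω hb hE hH hF hG hψ,
    (setIntegral_traceDensity hb hE hF fun i => (tE i).1).2,
    (setIntegral_traceDensity hb hH hG fun i => (tH i).1).2,
    h₁ _ fun i => (tE i).1, h₂ _ fun i => (tH i).1]
  simp

end Form

/-! ### Rescaling -/

theorem BddLip.mul {f g : R3 → ℂ} (hf : BddLip f) (hg : BddLip g) :
    BddLip fun x => f x * g x := by
  obtain ⟨K, hK⟩ := hf.lip
  obtain ⟨M, hM⟩ := hf.bdd
  obtain ⟨K', hK'⟩ := hg.lip
  obtain ⟨M', hM'⟩ := hg.bdd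
  have hM0 : 0 ≤ M := (norm_nonneg _).trans (hM 0)
  have hM0' : 0 ≤ M' := (norm_nonneg _).trans (hM' 0)
  refine ⟨⟨Real.toNNReal (M * K' + M' * K), LipschitzWith.of_dist_le_mul fun x y => ?_⟩, M * M',
    fun x => ?_⟩
  · rw [Real.coe_toNNReal _ (by positivity), dist_eq_norm]
    have e : f x * g x - f y * g y = f x * (g x - g y) + g y * (f x - f y) := by ring
    rw [e]
    refine (norm_add_le _ _).trans ?_
    rw [norm_mul, norm_mul, ← dist_eq_norm, ← dist_eq_norm]
    have h1 := mul_le_mul (hM x) (hK'.dist_le_mul x y) dist_nonneg hM0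
    have h2 := mul_le_mul (hM' y) (hK.dist_le_mul x y) dist_nonneg hM0'
    linarith
  · rw [norm_mul]
    exact mul_le_mul (hM x) (hM' x) (norm_nonneg _) hM0

theorem IsTest.bddLip {U : Set R3} {φ : R3 → ℂ} (h : IsTest U φ) : BddLip φ :=
  ⟨h.exists_lipschitz, by
    obtain ⟨C, hC⟩ := h.2.1.isCompact.exists_bound_of_continuousOn h.1.continuous.continuousOn
    refine ⟨max C 0, fun x => ?_⟩
    by_cases hx : x ∈ tsupport φ
    · exact (hC x hx).trans (le_max_left _ _)
    · simp [image_eq_zero_of_notMem_tsupport hx]⟩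

/-- The weights as functions of the parameters. -/
noncomputable def weightFn (ω : ℝ) (μ ε σ : R3 → ℝ) (l : Fin 8) (x : R3) : ℂ :=
  weight (logGam ω ε σ x) (logMu μ x) l

/-- The reciprocals of the weights. -/
noncomputable def invWeightFn (ω : ℝ) (μ ε σ : R3 → ℝ) (l : Fin 8) (x : R3) : ℂ :=
  Complex.exp (-expGam l * logGam ω ε σ x + -expMu l * logMu μ x)

theorem weightFn_mul_invWeightFn (ω : ℝ) (μ ε σ : R3 → ℝ) (l : Fin 8) (x : R3) :
    weightFn ω μ ε σ l x * invWeightFn ω μ ε σ l x = 1 := by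
  rw [weightFn, weight, invWeightFn, ← Complex.exp_add]
  ring_nf
  exact Complex.exp_zero

section Admissible

variable {Ω : Set R3} {c : R3} {R ω μo εo : ℝ} {μ ε σ : R3 → ℝ}

theorem IsAdmissible.bddLip_weightFn (h : IsAdmissible Ω (Metric.ball c R) μo εo μ ε σ)
    (l : Fin 8) : BddLip (weightFn ω μ ε σ l) :=
  (((h.bddLip_logGam ω).const_mul _).add (h.bddLip_logMu.const_mul _)).exp

theorem IsAdmissible.bddLip_invWeightFn (h : IsAdmissible Ω (Metric.ball c R) μo εo μ ε σ)
    (l : Fin 8) : BddLip (invWeightFn ω μ ε σ l) :=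
  (((h.bddLip_logGam ω).const_mul _).add (h.bddLip_logMu.const_mul _)).exp

theorem IsAdmissible.locBdd_gam (h : IsAdmissible Ω (Metric.ball c R) μo εo μ ε σ) :
    LocBdd (gam ω ε σ) := (h.lipschitz_gam ω).choose_spec.continuous.locBdd

theorem IsAdmissible.locBdd_mu (h : IsAdmissible Ω (Metric.ball c R) μo εo μ ε σ) :
    LocBdd fun x => (μ x : ℂ) := h.lipschitz_mu.choose_spec.ofReal.continuous.locBdd

theorem IsAdmissible.ae_pd_weightFn (h : IsAdmissible Ω (Metric.ball c R) μo εo μ ε σ) :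
    ∀ᵐ x, ∀ l j, pd j (weightFn ω μ ε σ l) x
        = (expGam l * alphaVec ω ε σ x j + expMu l * betaVec μ x j) * weightFn ω μ ε σ l x ∧
      pd j (invWeightFn ω μ ε σ l) x
        = -(expGam l * alphaVec ω ε σ x j + expMu l * betaVec μ x j)
          * invWeightFn ω μ ε σ l x := by
  filter_upwards [(h.bddLip_logGam ω).ae_differentiableAt, h.bddLip_logMu.ae_differentiableAt]
    with x h1 h2 l j
  have a1 : alphaVec ω ε σ x j = pd j (logGam ω ε σ) x := rfl
  have b1 : betaVec μ x j = pd j (logMu μ) x := rfl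
  rw [a1, b1]
  refine ⟨pd_exp_add h1 h2 (expGam l) (expMu l) j, ?_⟩
  refine (pd_exp_add h1 h2 (-expGam l) (-expMu l) j).trans ?_
  rw [invWeightFn]
  ring

theorem IsAdmissible.ae_sum_rescaled_mul_firstOrder
    (h : IsAdmissible Ω (Metric.ball c R) μo εo μ ε σ) :
    ∀ᵐ x, ∀ (E H : Fin 3 → ℂ) (u : Fin 8 → ℂ) (D : Fin 8 → Fin 3 → ℂ),
      ∑ l, rescaled (logGam ω ε σ x) (logMu μ x) E H l
          * firstOrder (kappa ω μ ε σ x) (alphaVec ω ε σ x) (betaVec μ x) u D l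
        = maxwellForm ω (gam ω ε σ x) (μ x) E H (fun l => weightFn ω μ ε σ l x * u l)
          (fun l j => pd j (weightFn ω μ ε σ l) x * u l + weightFn ω μ ε σ l x * D l j) := by
  filter_upwards [h.ae_pd_weightFn (ω := ω)] with x hx E H u D
  rw [h.kappa_eq, sum_rescaled_mul_firstOrder, h.exp_logGam, h.exp_logMu]
  simp only [fun l j => (hx l j).1]
  rfl

/-- If the rescaled form vanishes on test functions, so does the Maxwell form. -/
theorem IsAdmissible.maxwellForm_test (h : IsAdmissible Ω (Metric.ball c R) μo εo μ ε σ)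
    (hΩ : IsOpen Ω) (hb : Bornology.IsBounded Ω) {E H : Fin 3 → R3 → ℂ}
    (hE : MemL2 Ω E) (hH : MemL2 Ω H)
    (h0 : ∀ φ : Fin 8 → R3 → ℂ, (∀ l, IsTest Ω (φ l)) →
      ∫ x in Ω, maxwellForm ω (gam ω ε σ x) (μ x) (fun i => E i x) (fun i => H i x)
        (fun l => weightFn ω μ ε σ l x * φ l x)
        (fun l j => pd j (weightFn ω μ ε σ l) x * φ l x
          + weightFn ω μ ε σ l x * pd j (φ l) x) = 0)
    {ψ : Fin 8 → R3 → ℂ} (hψ : ∀ l, IsTest Ω (ψ l)) :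
    ∫ x in Ω, maxwellForm ω (gam ω ε σ x) (μ x) (fun i => E i x) (fun i => H i x)
      (fun l => ψ l x) (fun l j => pd j (ψ l) x) = 0 := by
  have hm := hΩ.measurableSet
  have m0 := memLp_maxwellCoeff0 ω hm hb (h.locBdd_gam (ω := ω)) h.locBdd_mu hE hH
  have m1 := memLp_maxwellCoeff1 hm hb (h.locBdd_gam (ω := ω)) h.locBdd_mu hE hH
  set A : Fin 8 → R3 → ℂ := fun l x =>
    maxwellCoeff0 ω (gam ω ε σ x) (μ x) (fun i => E i x) (fun i => H i x) l with hA
  set B : Fin 8 → Fin 3 → R3 → ℂ := fun l j x =>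
    maxwellCoeff1 (gam ω ε σ x) (μ x) (fun i => E i x) (fun i => H i x) l j with hB
  have W := fun l => h.bddLip_weightFn (ω := ω) l
  -- Substitute `φ = W⁻¹ ψ`. This is only Lipschitz, not smooth, which is why the Lipschitz
  -- extension is needed; it plays the role of `g`, with the constant `1` as the `H¹_loc` factor.
  have key := setIntegral_sum_eq_zero_of_lipschitz (ι := Fin 8) hΩ hb
    (a := fun l x => weightFn ω μ ε σ l x * A l x + ∑ j, pd j (weightFn ω μ ε σ l) x * B l j x)
    (b := fun l j x => weightFn ω μ ε σ l x * B l j x)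
    (u := fun _ _ => 1) (D := fun _ j => pd j fun _ => 1)
    (g := fun l x => invWeightFn ω μ ε σ l x * ψ l x)
    (fun l => ((W l).continuous.locBdd.mul_memLp (m0 l) hb hm).add
      (memLp_finset_sum _ fun j _ =>
        ((W l).lip.choose_spec.locBdd_pd j).mul_memLp (m1 l j) hb hm))
    (fun l j => (W l).continuous.locBdd.mul_memLp (m1 l j) hb hm)
    (fun φ hφ => by
      refine Eq.trans ?_ (h0 φ hφ)
      congr 1; ext x
      refine Finset.sum_congr rfl fun l _ => ?_
      simp only [add_mul, mul_add, Finset.sum_add_distrib, Finset.sum_mul]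
      rw [add_assoc]
      congr 1
      · ring
      · congr 1
        · exact Finset.sum_congr rfl fun j _ => by ring
        · exact Finset.sum_congr rfl fun j _ => by ring)
    (fun l => (LipschitzWith.const (1 : ℂ)).hasWeakGrad)
    (fun l => ((h.bddLip_invWeightFn l).mul (hψ l).bddLip).lip)
    (fun l x hx => by simp [eq_zero_of_isTest (hψ l) hx])
  refine Eq.trans (integral_congr_ae ?_) key
  refine ae_restrict_of_ae ?_
  filter_upwards [h.ae_pd_weightFn (ω := ω),
    ae_all_iff.2 fun l => (h.bddLip_invWeightFn (ω := ω) l).ae_differentiableAt] with x hx hd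
  refine Finset.sum_congr rfl fun l _ => ?_
  have hW := weightFn_mul_invWeightFn ω μ ε σ l x
  have one : ∀ j, pd j (fun _ : R3 => (1 : ℂ)) x = 0 := fun j => by simp [pd]
  simp only [fun j => DifferentiableAt.pd_mul (hd l) ((hψ l).differentiable x) j, one, mul_zero,
    add_zero, mul_one, fun j => (hx l j).1, fun j => (hx l j).2]
  have e1 : ∀ j, maxwellCoeff1 (gam ω ε σ x) (μ x) (fun i => E i x) (fun i => H i x) l j
      = B l j x := fun _ => rfl
  have e0 : maxwellCoeff0 ω (gam ω ε σ x) (μ x) (fun i => E i x) (fun i => H i x) l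
      = A l x := rfl
  simp only [e1, e0, add_mul, Finset.sum_mul]
  rw [add_assoc, ← Finset.sum_add_distrib]
  congr 1
  · linear_combination (-(A l x * ψ l x)) * hW
  · refine Finset.sum_congr rfl fun j _ => ?_
    linear_combination (-(B l j x * pd j (ψ l) x)) * hW

end Admissible

/-! ### From second order solutions to Maxwell solutions -/

section Admissible

variable {Ω : Set R3} {c : R3} {R ω μo εo : ℝ} {μ ε σ : R3 → ℝ}

theorem IsAdmissible.memL2_curl (h : IsAdmissible Ω (Metric.ball c R) μo εo μ ε σ)
    (hm : MeasurableSet Ω) (hb : Bornology.IsBounded Ω) {E H : Fin 3 → R3 → ℂ}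
    (hE : MemL2 Ω E) (hH : MemL2 Ω H) :
    MemL2 Ω (fun i x => Complex.I * (ω : ℂ) * (μ x : ℂ) * H i x) ∧
      MemL2 Ω (fun i x => -(Complex.I * (ω : ℂ) * gam ω ε σ x * E i x)) := by
  constructor
  · intro i
    have := (h.locBdd_mu.mul_memLp (hH i) hb hm).const_mul (Complex.I * (ω : ℂ))
    simpa only [mul_assoc] using this
  · intro i
    have := ((h.locBdd_gam (ω := ω).mul_memLp (hE i) hb hm).const_mul (Complex.I * (ω : ℂ))).neg
    simpa only [mul_assoc, Pi.neg_def] using this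

/-- A solution of the second order equation whose image under `𝒫'` has vanishing scalar components
yields a solution of Maxwell's equations. -/
theorem IsAdmissible.exists_maxwell (h : IsAdmissible Ω (Metric.ball c R) μo εo μ ε σ)
    (hμo : 0 < μo) (hεo : 0 < εo) (hΩ : IsOpen Ω) (hΩ' : Ω ⊆ Metric.ball c R)
    {w : Fin 8 → R3 → ℂ} (hw : ∀ l, MemH1loc (w l))
    (hsol : IsWeakSchrodingerSolution (Metric.ball c R) ω μo εo μ ε σ w)
    (hcomp : ∀ᵐ x ∂(volume.restrict (Metric.ball c R)),
      opP' ω μo εo μ ε σ w x 0 = 0 ∧ opP' ω μo εo μ ε σ w x 7 = 0) :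
    ∃ E H : Fin 3 → R3 → ℂ, MemL2 Ω E ∧ MemL2 Ω H ∧ SolvesMaxwell Ω ω μ ε σ E H ∧
      ∀ᵐ x ∂(volume.restrict Ω), opP' ω μo εo μ ε σ w x
        = rescaled (logGam ω ε σ x) (logMu μ x) (fun i => E i x) (fun i => H i x) := by
  have hb : Bornology.IsBounded Ω := Metric.isBounded_ball.subset hΩ'
  have hm := hΩ.measurableSet
  have hp : ∀ l, MemLp (fun x => opP' ω μo εo μ ε σ w x l) 2 (volume.restrict Ω) := fun l => by
    simp only [opP'_eq_firstOrder]
    exact (h.memL2loc_firstOrder (fun l => (hw l).hasWeakGrad) l).memLp_restrict hb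
  -- The vector blocks of `𝒫'w` with the factors `γ^{1/2}` and `μ^{1/2}` divided out.
  let E : Fin 3 → R3 → ℂ := fun i x =>
    Complex.exp (-1 / 2 * logGam ω ε σ x) * opP' ω μo εo μ ε σ w x (b2 i)
  let H : Fin 3 → R3 → ℂ := fun i x =>
    Complex.exp (-1 / 2 * logMu μ x) * opP' ω μo εo μ ε σ w x (b3 i)
  have hE : MemL2 Ω E := fun i =>
    ((h.bddLip_logGam ω).const_mul _).exp.continuous.locBdd.mul_memLp (hp _) hb hm
  have hH : MemL2 Ω H := fun i =>
    (h.bddLip_logMu.const_mul _).exp.continuous.locBdd.mul_memLp (hp _) hb hm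
  have hres : ∀ᵐ x ∂(volume.restrict Ω), opP' ω μo εo μ ε σ w x
      = rescaled (logGam ω ε σ x) (logMu μ x) (fun i => E i x) (fun i => H i x) := by
    filter_upwards [ae_restrict_of_ae_restrict_of_subset hΩ' hcomp] with x hx
    have c1 : ∀ z y : ℂ, Complex.exp (1 / 2 * z) * (Complex.exp (-1 / 2 * z) * y) = y := by
      intro z y
      rw [← mul_assoc, ← Complex.exp_add]
      ring_nf
      simp
    ext l
    fin_cases l <;> simp only [rescaled, E, H, b2, b3, c1, Fin.zero_eta, Fin.mk_one,
      Fin.reduceFinMk, Matrix.cons_val]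
    · exact hx.1
    · exact hx.2
  obtain ⟨hF, hG⟩ := h.memL2_curl (ω := ω) hm hb hE hH
  refine ⟨E, H, hE, hH, ?_, hres⟩
  refine hasWeakCurl_of_maxwellForm (γ := gam ω ε σ) (μ := fun x => (μ x : ℂ)) hb hE hH hF hG
    fun ψ hψ => h.maxwellForm_test hΩ hb hE hH (fun φ hφ => ?_) hψ
  refine Eq.trans ?_ (h.setIntegral_opP'_mul_test hμo hεo hΩ' hw hsol hφ)
  refine integral_congr_ae ?_
  filter_upwards [hres, ae_restrict_of_ae (h.ae_sum_rescaled_mul_firstOrder (ω := ω))] with x h1 h2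
  rw [h1]
  exact (h2 _ _ _ _).symm

end Admissible

/-! ### Equal traces give equal Maxwell forms -/

/-- Solutions of Maxwell's equations for two sets of parameters, with the same tangential traces,
define the same Maxwell form on `H¹_loc`. -/
theorem setIntegral_maxwellForm_eq_of_trace_eq {Ω : Set R3} (hΩ : IsOpen Ω)
    (hb : Bornology.IsBounded Ω) {ω : ℝ} (hω : ω ≠ 0) {γ₁ μ₁ γ₂ μ₂ : R3 → ℂ}
    (hγ₁ : LocBdd γ₁) (hμ₁ : LocBdd μ₁) (hγ₂ : LocBdd γ₂) (hμ₂ : LocBdd μ₂)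
    {E₁ H₁ E₂ H₂ : Fin 3 → R3 → ℂ} (hE₁ : MemL2 Ω E₁) (hH₁ : MemL2 Ω H₁) (hE₂ : MemL2 Ω E₂)
    (hH₂ : MemL2 Ω H₂)
    (hF₁ : MemL2 Ω fun i x => Complex.I * ω * μ₁ x * H₁ i x)
    (hG₁ : MemL2 Ω fun i x => -(Complex.I * ω * γ₁ x * E₁ i x))
    (hF₂ : MemL2 Ω fun i x => Complex.I * ω * μ₂ x * H₂ i x)
    (hG₂ : MemL2 Ω fun i x => -(Complex.I * ω * γ₂ x * E₂ i x))
    (hE : ∀ φ : Fin 3 → R3 → ℂ, (∀ i, IsTest Set.univ (φ i)) →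
      ∫ x in Ω, traceDensity (fun i => E₁ i x) (fun i => Complex.I * ω * μ₁ x * H₁ i x)
          (fun i => φ i x) (fun a b => pd b (φ a) x)
        = ∫ x in Ω, traceDensity (fun i => E₂ i x) (fun i => Complex.I * ω * μ₂ x * H₂ i x)
          (fun i => φ i x) (fun a b => pd b (φ a) x))
    (hH : ∀ φ : Fin 3 → R3 → ℂ, (∀ i, IsTest Set.univ (φ i)) →
      ∫ x in Ω, traceDensity (fun i => H₁ i x) (fun i => -(Complex.I * ω * γ₁ x * E₁ i x))
          (fun i => φ i x) (fun a b => pd b (φ a) x)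
        = ∫ x in Ω, traceDensity (fun i => H₂ i x) (fun i => -(Complex.I * ω * γ₂ x * E₂ i x))
          (fun i => φ i x) (fun a b => pd b (φ a) x))
    {u : Fin 8 → R3 → ℂ} {D : Fin 8 → Fin 3 → R3 → ℂ} (hu : ∀ l, HasWeakGrad (u l) (D l)) :
    ∫ x in Ω, maxwellForm ω (γ₁ x) (μ₁ x) (fun i => E₁ i x) (fun i => H₁ i x)
        (fun l => u l x) (fun l j => D l j x)
      = ∫ x in Ω, maxwellForm ω (γ₂ x) (μ₂ x) (fun i => E₂ i x) (fun i => H₂ i x)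
        (fun l => u l x) (fun l j => D l j x) := by
  have hm := hΩ.measurableSet
  have e : ∀ (f : Fin 8 → R3 → ℂ) (df : Fin 8 → Fin 3 → R3 → ℂ),
      (∀ l, HasWeakGrad (f l) (df l)) →
      ∫ x in Ω, ∑ l, ((maxwellCoeff0 ω (γ₁ x) (μ₁ x) (fun i => E₁ i x) (fun i => H₁ i x) l
          - maxwellCoeff0 ω (γ₂ x) (μ₂ x) (fun i => E₂ i x) (fun i => H₂ i x) l) * f l x
        + ∑ j, (maxwellCoeff1 (γ₁ x) (μ₁ x) (fun i => E₁ i x) (fun i => H₁ i x) l j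
          - maxwellCoeff1 (γ₂ x) (μ₂ x) (fun i => E₂ i x) (fun i => H₂ i x) l j) * df l j x)
      = (∫ x in Ω, maxwellForm ω (γ₁ x) (μ₁ x) (fun i => E₁ i x) (fun i => H₁ i x)
          (fun l => f l x) (fun l j => df l j x))
        - ∫ x in Ω, maxwellForm ω (γ₂ x) (μ₂ x) (fun i => E₂ i x) (fun i => H₂ i x)
          (fun l => f l x) (fun l j => df l j x) := by
    intro f df hf
    rw [← integral_sub (integrableOn_maxwellForm hm hb hγ₁ hμ₁ hE₁ hH₁ hf)
      (integrableOn_maxwellForm hm hb hγ₂ hμ₂ hE₂ hH₂ hf)]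
    congr 1; ext x
    simp only [maxwellForm, sub_mul, Finset.sum_sub_distrib, ← add_sub_add_comm]
  rw [← sub_eq_zero, ← e u D hu]
  refine setIntegral_sum_eq_zero_of_forall_test hm hb
    (fun l => (memLp_maxwellCoeff0 ω hm hb hγ₁ hμ₁ hE₁ hH₁ l).sub
      (memLp_maxwellCoeff0 ω hm hb hγ₂ hμ₂ hE₂ hH₂ l))
    (fun l j => (memLp_maxwellCoeff1 hm hb hγ₁ hμ₁ hE₁ hH₁ l j).sub
      (memLp_maxwellCoeff1 hm hb hγ₂ hμ₂ hE₂ hH₂ l j)) (fun ψ hψ => ?_) hu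
  refine (e ψ (fun l j => pd j (ψ l)) fun l => (hψ l).hasWeakGrad).trans ?_
  rw [setIntegral_maxwellForm_test hω hb hE₁ hH₁ hF₁ hG₁ hψ,
    setIntegral_maxwellForm_test hω hb hE₂ hH₂ hF₂ hG₂ hψ,
    hE _ fun i => (isTest_combination (hψ (b3 i)) (hψ 7) (-Complex.I) (ω : ℂ)⁻¹ i).1,
    hH _ fun i => (isTest_combination (hψ (b2 i)) (hψ 0) Complex.I (-(ω : ℂ)⁻¹) i).1, sub_self]

end MaxwellLip

/-! ### The orthogonality identity -/

theorem mainTheorem4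
    -- the domain `Ω`, the larger ball `Ω'`, the frequency and the reference constants
    (Ω : Set R3) (hΩ : IsBoundedLipschitzDomain Ω)
    (c : R3) (R : ℝ) (hΩ' : Ω ⊆ Metric.ball c R)
    (ω μo εo : ℝ) (hω : 0 < ω) (hμo : 0 < μo) (hεo : 0 < εo)
    -- two sets of parameters that agree outside `Ω`, in particular on its boundary
    (μ₁ ε₁ σ₁ μ₂ ε₂ σ₂ : R3 → ℝ)
    (h₁ : IsAdmissible Ω (Metric.ball c R) μo εo μ₁ ε₁ σ₁)
    (h₂ : IsAdmissible Ω (Metric.ball c R) μo εo μ₂ ε₂ σ₂)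
    (hμ : ∀ x, x ∉ Ω → μ₁ x = μ₂ x) (hε : ∀ x, x ∉ Ω → ε₁ x = ε₂ x)
    (hσ : ∀ x, x ∉ Ω → σ₁ x = σ₂ x)
    -- the solutions `w₁` and `v₂`
    (w₁ v₂ : Fin 8 → R3 → ℂ)
    (hw₁ : ∀ l, MemH1loc (w₁ l)) (hv₂ : ∀ l, MemH1loc (v₂ l))
    (hw₁_sol : IsWeakSchrodingerSolution (Metric.ball c R) ω μo εo μ₁ ε₁ σ₁ w₁)
    (hw₁_comp : ∀ᵐ x ∂(volume.restrict (Metric.ball c R)),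
      opP' ω μo εo μ₁ ε₁ σ₁ w₁ x 0 = 0 ∧ opP' ω μo εo μ₁ ε₁ σ₁ w₁ x 7 = 0)
    (hv₂_sol : ∀ᵐ x ∂(volume.restrict (Metric.ball c R)), opP' ω μo εo μ₂ ε₂ σ₂ v₂ x = 0)
    -- equality of the Cauchy data sets on the boundary of `Ω`
    (hC : cauchyData Ω μ₁ ε₁ σ₁ ω = cauchyData Ω μ₂ ε₂ σ₂ ω) :
    Integrable (qDiffDensity ω μo εo μ₁ ε₁ σ₁ μ₂ ε₂ σ₂ w₁ v₂) volume ∧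
      ∫ x, qDiffDensity ω μo εo μ₁ ε₁ σ₁ μ₂ ε₂ σ₂ w₁ v₂ x = 0 := by
  have hO : IsOpen Ω := hΩ.1
  have hb : Bornology.IsBounded Ω := hΩ.2.2.1
  have hm := hO.measurableSet
  have hV := fun l => (hv₂ l).hasWeakGrad
  obtain ⟨hint, heq⟩ := exists_qDiffDensity_eq hO hΩ' (ω := ω) hμo hεo h₁ h₂ hμ hε hσ hw₁ hv₂
    hv₂_sol
  refine ⟨hint, heq.trans ?_⟩
  obtain ⟨E₁, H₁, hE₁, hH₁, hM₁, hres⟩ := h₁.exists_maxwell hμo hεo hO hΩ' hw₁ hw₁_sol hw₁_comp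
  obtain ⟨hF₁, hG₁⟩ := h₁.memL2_curl (ω := ω) hm hb hE₁ hH₁
  -- The trace pair of `(E₁, H₁)`. Transported by `hC`, it produces a solution `(E₂, H₂)` for the
  -- second parameters with the same traces.
  have hmem : (((fun φ => ∫ x in Ω, ∑ i, (Complex.I * (ω : ℂ) * (μ₁ x : ℂ) * H₁ i x * φ.1 i x
        - E₁ i x * curlOf (fun a b => pd b (φ.1 a) x) i)),
      (fun φ => ∫ x in Ω, ∑ i, (-(Complex.I * (ω : ℂ) * gam ω ε₁ σ₁ x * E₁ i x) * φ.1 i x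
        - H₁ i x * curlOf (fun a b => pd b (φ.1 a) x) i))) :
      (TestField → ℂ) × (TestField → ℂ)) ∈ cauchyData Ω μ₁ ε₁ σ₁ ω :=
    ⟨E₁, H₁, hM₁, ⟨hE₁, _, hF₁, hM₁.1, fun _ => rfl⟩, ⟨hH₁, _, hG₁, hM₁.2, fun _ => rfl⟩⟩
  rw [hC] at hmem
  obtain ⟨E₂, H₂, hM₂, ⟨hE₂, F, hF, hEF, htE⟩, ⟨hH₂, G, hG, hHG, htH⟩⟩ := hmem
  obtain ⟨hF₂, hG₂⟩ := h₂.memL2_curl (ω := ω) hm hb hE₂ hH₂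
  have aeF := ae_all_iff.2 fun i => hEF.ae_eq hO hb hM₂.1 hF hF₂ i
  have aeG := ae_all_iff.2 fun i => hHG.ae_eq hO hb hM₂.2 hG hG₂ i
  have W₁ := fun l => h₁.bddLip_weightFn (ω := ω) l
  have W₂ := fun l => h₂.bddLip_weightFn (ω := ω) l
  have hWV₁ := fun l => (hV l).lipschitz_mul (W₁ l).lip.choose_spec
  have hWV₂ := fun l => (hV l).lipschitz_mul (W₂ l).lip.choose_spec
  have step1 : ∫ x in Ω, ∑ l, opP' ω μo εo μ₁ ε₁ σ₁ w₁ x l * opP' ω μo εo μ₁ ε₁ σ₁ v₂ x l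
      = ∫ x in Ω, maxwellForm ω (gam ω ε₁ σ₁ x) (μ₁ x) (fun i => E₁ i x) (fun i => H₁ i x)
        (fun l => weightFn ω μ₁ ε₁ σ₁ l x * v₂ l x)
        (fun l j => pd j (weightFn ω μ₁ ε₁ σ₁ l) x * v₂ l x
          + weightFn ω μ₁ ε₁ σ₁ l x * weakPd j (v₂ l) x) := by
    refine integral_congr_ae ?_
    filter_upwards [hres, ae_restrict_of_ae (h₁.ae_sum_rescaled_mul_firstOrder (ω := ω))]
      with x e1 e2
    rw [e1, opP'_eq_firstOrder]
    exact e2 _ _ _ _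
  have step2 := setIntegral_maxwellForm_eq_of_trace_eq hO hb hω.ne' h₁.locBdd_gam h₁.locBdd_mu
    h₂.locBdd_gam h₂.locBdd_mu hE₁ hH₁ hE₂ hH₂ hF₁ hG₁ hF₂ hG₂
    (fun φ hφ => by
      refine (htE ⟨φ, hφ⟩).trans (integral_congr_ae ?_)
      filter_upwards [aeF] with x hx
      simp only [traceDensity, hx])
    (fun φ hφ => by
      refine (htH ⟨φ, hφ⟩).trans (integral_congr_ae ?_)
      filter_upwards [aeG] with x hx
      simp only [traceDensity, hx]) hWV₁
  have hWΩ : ∀ l x, x ∉ Ω → weightFn ω μ₁ ε₁ σ₁ l x - weightFn ω μ₂ ε₂ σ₂ l x = 0 := by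
    intro l x hx
    simp [weightFn, logGam, logMu, gam, hμ x hx, hε x hx, hσ x hx]
  -- The difference of the weights vanishes off `Ω`, so no boundary term appears and the interior
  -- weak equations for `(E₂, H₂)` suffice.
  have step3 := setIntegral_sum_eq_zero_of_lipschitz hO hb
    (memLp_maxwellCoeff0 ω hm hb (h₂.locBdd_gam (ω := ω)) h₂.locBdd_mu hE₂ hH₂)
    (memLp_maxwellCoeff1 hm hb (h₂.locBdd_gam (ω := ω)) h₂.locBdd_mu hE₂ hH₂)
    (fun ψ hψ => maxwellForm_of_hasWeakCurl hω.ne' hb hE₂ hH₂ hF₂ hG₂ hM₂.1 hM₂.2 hψ) hV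
    (fun l => ⟨_, (W₁ l).lip.choose_spec.sub (W₂ l).lip.choose_spec⟩) hWΩ
  -- With the weights of the second parameters, the form is the rescaled second field times `𝒫₂'v₂`,
  -- which is zero in `Ω`.
  have step4 : ∫ x in Ω, maxwellForm ω (gam ω ε₂ σ₂ x) (μ₂ x) (fun i => E₂ i x) (fun i => H₂ i x)
        (fun l => weightFn ω μ₂ ε₂ σ₂ l x * v₂ l x)
        (fun l j => pd j (weightFn ω μ₂ ε₂ σ₂ l) x * v₂ l x
          + weightFn ω μ₂ ε₂ σ₂ l x * weakPd j (v₂ l) x) = 0 := by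
    refine integral_eq_zero_of_ae ?_
    filter_upwards [ae_restrict_of_ae (h₂.ae_sum_rescaled_mul_firstOrder (ω := ω)),
      ae_restrict_of_ae_restrict_of_subset hΩ' hv₂_sol] with x e1 e2
    rw [← e1, ← opP'_eq_firstOrder ω μo εo, e2]
    simp
  have hsplit := integral_sub
    (integrableOn_maxwellForm hm hb (h₂.locBdd_gam (ω := ω)) h₂.locBdd_mu hE₂ hH₂ (ω := ω) hWV₁)
    (integrableOn_maxwellForm hm hb (h₂.locBdd_gam (ω := ω)) h₂.locBdd_mu hE₂ hH₂ (ω := ω) hWV₂)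
  rw [step4, sub_zero] at hsplit
  rw [step1, step2, ← hsplit]
  refine Eq.trans ?_ step3
  refine integral_congr_ae (ae_restrict_of_ae ?_)
  filter_upwards [ae_all_iff.2 fun l => (W₁ l).ae_differentiableAt,
    ae_all_iff.2 fun l => (W₂ l).ae_differentiableAt] with x d1 d2
  have hsub : ∀ l j, pd j (fun y => weightFn ω μ₁ ε₁ σ₁ l y - weightFn ω μ₂ ε₂ σ₂ l y) x
      = pd j (weightFn ω μ₁ ε₁ σ₁ l) x - pd j (weightFn ω μ₂ ε₂ σ₂ l) x := by
    intro l j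
    simp only [pd]
    rw [fderiv_fun_sub (d1 l) (d2 l)]
    simp
  simp only [maxwellForm, hsub, ← Finset.sum_sub_distrib]
  refine Finset.sum_congr rfl fun l _ => ?_
  rw [add_sub_add_comm, ← mul_sub, ← sub_mul, ← Finset.sum_sub_distrib]
  congr 1
  exact Finset.sum_congr rfl fun j _ => by ring
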